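/- Let $n \ge 2$ and $k \ge 3$ be integers and let $r > 0$. An \emph{$n \times k$-regular} is a collection of $n$ regular $k$-gons of circumradius $r$ in the plane such that the intersection of any two of them is empty, a common vertex, or a common edge, and such that the interior of their union is connected (holes are allowed). Thus, up to scale, the $n \times k$-regulars are exactly the connected edge-to-edge gluings of $n$ congruent regular $k$-gons; for $k = 3, 4, 6$ they are the polyiamonds, polyominoes and polyhexes. Put $N = \lceil k/2 \rceil (n-1)$. Then there is a single hinged dissection with $N$ pieces that can be rotated into every $n \times k$-regular of circumradius $r$, in any position, and hence also into its mirror image. Moreover, the pieces are hinged in a cycle. Explicitly: there are simple polygons $P_0, \dots, P_{N-1}$ in the plane (straight angles at vertices are allowed) and points $h_0, \dots, h_{N-1}$ such that $h_i$ is a vertex of both $P_i$ and $P_{i+1}$ (indices modulo $N$) and such that, for every $n \times k$-regular $F$, there is a continuous motion of the pieces $t \mapsto (g_0^t, \dots, g_{N-1}^t)$, $0 \le t \le 1$, by orientation-preserving isometries $g_i^t$ of the plane, with the following properties: 1. $g_i^0$ is the identity for all $i$, and every hinge is kept together throughout, that is, $g_i^t(h_i) = g_{i+1}^t(h_i)$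 for all $i$ and $t$ (the pieces may overlap during the motion); 2. in the final position the pieces $g_i^1(P_i)$ have pairwise disjoint interiors, and their union is the union of the $k$-gons of $F$; 3. in the final position no hinges cross: if two hinges, one between pieces $A, B$ and one between pieces $C, D$, with $A, B, C, D$ four different pieces, lie at the same point $p$, then $A, B$ do not separate $C$ from $D$ in the cyclic order of the pieces around $p$. -/

import Mathlib

/-! The Euclidean plane is `ℂ` throughout. -/

/-- A regular `k`-gon with circumradius `r`, given by its center and the vector from the center to
one of its vertices. -/
structure RegularPolygon (k : ℕ) (r : ℝ) where
  center : ℂ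
  spoke : ℂ
  norm_spoke : ‖spoke‖ = r

namespace RegularPolygon

variable {k : ℕ} {r : ℝ}

/-- The vertices in counterclockwise order; `vertex (j + k) = vertex j`. -/
noncomputable def vertex (P : RegularPolygon k r) (j : ℕ) : ℂ :=
  P.center + P.spoke * Complex.exp (2 * Real.pi * Complex.I * j / k)

/-- The edge that joins the `j`-th vertex to the next one. -/
def edge (P : RegularPolygon k r) (j : ℕ) : Set ℂ :=
  segment ℝ (P.vertex j) (P.vertex (j + 1))

/-- The solid polygon. -/
def region (P : RegularPolygon k r) : Set ℂ :=
  convexHull ℝ (Set.range P.vertex)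

end RegularPolygon

/-- An `n × k`-regular, made of `n` congruent regular `k`-gons of circumradius `r`: two of them
meet in the empty set, a common vertex or a common edge, and the interior of the union is
connected. Holes are allowed. -/
structure PolyRegular (n k : ℕ) (r : ℝ) where
  tile : Fin n → RegularPolygon k r
  inter_tile : ∀ i j, i ≠ j →
    (tile i).region ∩ (tile j).region = ∅ ∨
    (∃ a b, (tile i).vertex a = (tile j).vertex b ∧
      (tile i).region ∩ (tile j).region = {(tile i).vertex a}) ∨
    (∃ a b, (tile i).edge a = (tile j).edge b ∧
      (tile i).region ∩ (tile j).region = (tile i).edge a)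
  isConnected_interior : IsConnected (interior (⋃ i, (tile i).region))

/-- The part of the plane that is covered by an `n × k`-regular. -/
def PolyRegular.region {n k : ℕ} {r : ℝ} (F : PolyRegular n k r) : Set ℂ :=
  ⋃ i, (F.tile i).region

/-- A simple polygon. The cyclic sequence of its vertices traces a closed polygonal curve without
self-intersections, and `region` is the compact set with nonempty interior bounded by that curve,
that is, the curve together with its inside. A straight angle at a vertex is allowed. -/
structure SimplePolygon where
  size : ℕ
  three_le_size : 3 ≤ size
  vertex : Fin size → ℂ
  simple : ∀ i j : Fin size, ∀ s ∈ Set.Ico (0 : ℝ) 1, ∀ t ∈ Set.Ico (0 : ℝ) 1,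
    AffineMap.lineMap (vertex i) (vertex (finRotate size i)) s =
      AffineMap.lineMap (vertex j) (vertex (finRotate size j)) t → i = j ∧ s = t
  region : Set ℂ
  isCompact_region : IsCompact region
  nonempty_interior : (interior region).Nonempty
  frontier_region : frontier region = ⋃ i, segment ℝ (vertex i) (vertex (finRotate size i))

/-- A rigid motion of the plane (no reflections): the pair `(a, b)` stands for `z ↦ a * z + b`. -/
abbrev RigidMotion := Circle × ℂ

/-- The action of a rigid motion on the points of the plane. -/
def RigidMotion.act (g : RigidMotion) (z : ℂ) : ℂ := (g.1 : ℂ) * z + g.2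

/-- From the point `p`, the direction with angle `θ` leads into the interior of `A`. -/
def PointsInto (A : Set ℂ) (p : ℂ) (θ : ℝ) : Prop :=
  ∃ ε > 0, ∀ t : ℝ, 0 < t → t < ε → p + t * Complex.exp (θ * Complex.I) ∈ interior A

/-- A hinge at `p` between `A` and `B` crosses a hinge at `p` between `C` and `D`: in the cyclic
order around `p`, the pair `A`, `B` separates `C` from `D`. -/
def HingesCross (p : ℂ) (A B C D : Set ℂ) : Prop :=
  ∃ α γ β δ : ℝ, α < γ ∧ γ < β ∧ β < δ ∧ δ < α + 2 * Real.pi ∧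
    PointsInto A p α ∧ PointsInto B p β ∧
    ((PointsInto C p γ ∧ PointsInto D p δ) ∨ (PointsInto D p γ ∧ PointsInto C p δ))

/-- `N` polygonal pieces hinged together in a cycle, drawn in some initial position: the `i`-th
hinge joins the `i`-th piece to the next one (the last piece to the first one) at a point that is
a vertex of both. -/
structure CyclicHinging (N : ℕ) where
  piece : Fin N → SimplePolygon
  hinge : Fin N → ℂ
  hinge_mem : ∀ i, hinge i ∈ Set.range (piece i).vertex
  hinge_mem_next : ∀ i, hinge i ∈ Set.range (piece (finRotate N i)).vertex

namespace CyclicHinging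

variable {N : ℕ}

/-- Moving the `i`-th piece by `g i` for all `i` keeps every hinge together. -/
def KeepsHinges (H : CyclicHinging N) (g : Fin N → RigidMotion) : Prop :=
  ∀ i, (g i).act (H.hinge i) = (g (finRotate N i)).act (H.hinge i)

/-- The `i`-th piece after it has been moved by `g i`. -/
def placed (H : CyclicHinging N) (g : Fin N → RigidMotion) (i : Fin N) : Set ℂ :=
  (g i).act '' (H.piece i).region

/-- No two hinges between four different pieces cross each other. -/
def NoCrossing (H : CyclicHinging N) (g : Fin N → RigidMotion) : Prop :=
  ∀ i j, i ≠ j → i ≠ finRotate N j → finRotate N i ≠ j → finRotate N i ≠ finRotate N j →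
    (g i).act (H.hinge i) = (g j).act (H.hinge j) →
    ¬ HingesCross ((g i).act (H.hinge i)) (H.placed g i) (H.placed g (finRotate N i))
      (H.placed g j) (H.placed g (finRotate N j))

/-- The hinged pieces can be rotated into `S`: a continuous motion of the pieces, in which they may
overlap but every hinge stays together, ends in a position in which the pieces do not overlap,
their union is `S` and no hinges cross. -/
def RotatesInto (H : CyclicHinging N) (S : Set ℂ) : Prop :=
  ∃ g : Fin N → RigidMotion,
    JoinedIn {g' | H.KeepsHinges g'} (fun _ => (1, 0)) g ∧
    (∀ i j, i ≠ j → Disjoint (interior (H.placed g i)) (interior (H.placed g j))) ∧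
    (⋃ i, H.placed g i) = S ∧
    H.NoCrossing g

end CyclicHinging

/-! Put `m = ⌈k/2⌉`. All but one of the `k`-gons are cut from their centers into `m` pieces, called
slots: slot `j` is the union of the triangles over the edges `2 j` and `2 j + 1`, and for odd `k`
the last slot is a single triangle. Successive slots are hinged at the outer vertices `2, 4, …, k`,
so every edge has an end at a hinge. The remaining `k`-gon stays whole and is attached to one slot
`0` across the edge `0` (`rootPiece`). Initially the `n - 1` cut polygons lie on top of each other
on one polygon `P`, and the `i`-th piece of the cycle occupies slot `i % m`. This chain does not
depend on `F`; what depends on `F` is which pieces join to form a tile.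

Given `F`, the graph of tiles with common edges is connected (`connected_dualGraph`): sets that meet
only in finitely many points cannot have a union with connected interior. Hence there is a tile `L`
whose removal leaves the graph connected, and a neighbor `root` of `L`. The uncut polygon will cover
`L`. The other tiles are added one at a time, starting with `root` (`Arrangement.exists_singleton`,
`Arrangement.exists_insert`). If a new tile `c` shares an edge with a placed tile `p`, one end `v`
of that edge is a hinge (`exists_follows`). The cycle is opened at that hinge of `p` and the `m`
pieces of `c` are spliced in. A full period has been inserted, so all other pieces keep their slots.
The polygon of `c` moves along with `p` and in addition turns about `v`; every hinge is kept
together at all times.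

Hinges do not cross because of the invariant `Arrangement.planar`. Either the two tiles of a hinge
are glued along an edge at that hinge, or a chain of glued pairs leads around the point from one to
the other. In both cases the two pieces at the hinge are joined by an arc of directions inside a
union of pieces (`sameArc_of_adjacent`, `sameArc_of_not_adjacent`). A crossing hinge would have to
place one of its own pieces in that arc, but the pieces do not overlap (`not_hingesCross`). -/

open Set Filter Topology

/-! ### Triangles in the plane -/

/-- The cross product of two plane vectors. -/
def cross (u v : ℂ) : ℝ := u.re * v.im - u.im * v.re

/-- The barycentric coordinate that is `1` at `a` and `0` at `b` and `c`. -/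
noncomputable def bary (a b c z : ℂ) : ℝ := cross (b - z) (c - z) / cross (b - a) (c - a)

/-- The solid triangle. -/
def tri (a b c : ℂ) : Set ℂ := convexHull ℝ {a, b, c}

theorem cross_rotate (a b c : ℂ) : cross (c - b) (a - b) = cross (b - a) (c - a) := by
  simp [cross]; ring

theorem cross_rotate' (a b c : ℂ) : cross (a - c) (b - c) = cross (b - a) (c - a) := by
  simp [cross]; ring

theorem cross_swap (u v : ℂ) : cross u v = -cross v u := by
  simp [cross]; ring

theorem bary_rotate (a b c z : ℂ) :
    bary b c a z = cross (c - z) (a - z) / cross (b - a) (c - a) := by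
  rw [bary, cross_rotate a b c]

theorem bary_rotate' (a b c z : ℂ) :
    bary c a b z = cross (a - z) (b - z) / cross (b - a) (c - a) := by
  rw [bary, cross_rotate' a b c]

theorem continuous_bary (a b c : ℂ) : Continuous (bary a b c) := by
  unfold bary cross
  simp only [Complex.sub_re, Complex.sub_im]
  exact Continuous.div_const (by fun_prop) _

theorem bary_sum {a b c : ℂ} (h : cross (b - a) (c - a) ≠ 0) (z : ℂ) :
    bary a b c z + bary b c a z + bary c a b z = 1 := by
  rw [bary_rotate a b c, bary_rotate' a b c, bary, ← add_div, ← add_div, div_eq_one_iff_eq h]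
  simp [cross]; ring

theorem bary_combination {a b c : ℂ} (h : cross (b - a) (c - a) ≠ 0) (z : ℂ) :
    bary a b c z • a + bary b c a z • b + bary c a b z • c = z := by
  rw [bary_rotate a b c, bary_rotate' a b c, bary]
  apply Complex.ext
  · simp only [Complex.add_re, Complex.smul_re, smul_eq_mul]
    field_simp
    simp only [cross, Complex.sub_re, Complex.sub_im]; ring
  · simp only [Complex.add_im, Complex.smul_im, smul_eq_mul]
    field_simp
    simp only [cross, Complex.sub_re, Complex.sub_im]; ring

theorem bary_of_combination {a b c : ℂ} (h : cross (b - a) (c - a) ≠ 0) {x y w : ℝ}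
    (hs : x + y + w = 1) : bary a b c (x • a + y • b + w • c) = x := by
  unfold bary
  rw [div_eq_iff h]
  obtain rfl : w = 1 - x - y := by linarith
  simp [cross]; ring

theorem mem_tri {a b c : ℂ} (h : cross (b - a) (c - a) ≠ 0) {z : ℂ} :
    z ∈ tri a b c ↔ 0 ≤ bary a b c z ∧ 0 ≤ bary b c a z ∧ 0 ≤ bary c a b z := by
  constructor
  · intro hz
    rw [tri, convexHull_insert (by simp)] at hz
    simp only [convexHull_pair, convexJoin_singleton_left, mem_iUnion] at hz
    obtain ⟨y, ⟨p, q, hp, hq, hpq, rfl⟩, ⟨s, t, hs, ht, hst, rfl⟩⟩ := hz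
    have e : s • a + t • (p • b + q • c) = s • a + (t * p) • b + (t * q) • c := by
      simp only [smul_add, smul_smul]; ring
    have hsum : s + t * p + t * q = 1 := by rw [add_assoc, ← mul_add, hpq]; linarith
    have h1 := bary_of_combination h hsum
    have h2 := bary_of_combination (a := b) (b := c) (c := a) (by rwa [cross_rotate])
      (x := t * p) (y := t * q) (w := s)
      (by linarith)
    have h3 := bary_of_combination (a := c) (b := a) (c := b) (by rwa [cross_rotate'])
      (x := t * q) (y := s) (w := t * p) (by linarith)
    rw [e]
    refine ⟨by rwa [h1], ?_, ?_⟩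
    · rw [show s • a + (t * p) • b + (t * q) • c = (t * p) • b + (t * q) • c + s • a by ring, h2]
      positivity
    · rw [show s • a + (t * p) • b + (t * q) • c = (t * q) • c + s • a + (t * p) • b by ring, h3]
      positivity
  · rintro ⟨h1, h2, h3⟩
    rw [← bary_combination h z]
    have := bary_sum h z
    have hc := convex_convexHull ℝ ({a, b, c} : Set ℂ)
    exact hc.sum_mem (t := Finset.univ) (w := ![bary a b c z, bary b c a z, bary c a b z])
      (z := ![a, b, c]) (by intro i _; fin_cases i <;> simpa)
      (by simpa [Fin.sum_univ_three] using this)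
      (by intro i _; fin_cases i <;> exact subset_convexHull ℝ _ (by simp))
      |> fun h => by simpa [Fin.sum_univ_three, tri] using h

theorem isCompact_tri (a b c : ℂ) : IsCompact (tri a b c) :=
  (by simp : ({a, b, c} : Set ℂ).Finite).isCompact_convexHull ℝ

theorem convex_tri (a b c : ℂ) : Convex ℝ (tri a b c) := convex_convexHull ℝ _

theorem tri_rotate (a b c : ℂ) : tri b c a = tri a b c := by
  unfold tri; congr 1; ext; simp; tauto

theorem tri_swap (a b c : ℂ) : tri b a c = tri a b c := by
  unfold tri; congr 1; ext; simp; tauto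

/-- A short step from `z` straight away from `a` stays in the triangle, but it would make a
vanishing coordinate negative. The inequality obtained is strict. -/
theorem bary_nonneg_of_mem_interior {a b c : ℂ} (h : cross (b - a) (c - a) ≠ 0) {z : ℂ}
    (hz : z ∈ interior (tri a b c)) : 0 < bary a b c z := by
  have h0 := ((mem_tri h).1 (interior_subset hz)).1
  refine h0.lt_of_ne' fun h1 => ?_
  have hc : Continuous fun t : ℝ => z - t • (a - z) := by fun_prop
  have h2 : ∀ᶠ t in 𝓝[>] (0 : ℝ), z - t • (a - z) ∈ tri a b c :=
    (hc.continuousAt.tendsto.mono_left nhdsWithin_le_nhds).eventually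
      (by simpa using mem_interior_iff_mem_nhds.1 hz)
  obtain ⟨t, ht, ht0⟩ := (h2.and self_mem_nhdsWithin).exists
  have h3 := ((mem_tri h).1 ht).1
  have h4 : bary a b c (z - t • (a - z)) = (1 + t) * bary a b c z - t := by
    unfold bary; field_simp; simp [cross]; ring
  rw [h4, h1] at h3
  have : 0 < t := ht0
  linarith

theorem mem_interior_tri {a b c : ℂ} (h : cross (b - a) (c - a) ≠ 0) {z : ℂ} :
    z ∈ interior (tri a b c) ↔ 0 < bary a b c z ∧ 0 < bary b c a z ∧ 0 < bary c a b z := by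
  constructor
  · intro hz
    refine ⟨bary_nonneg_of_mem_interior h hz, bary_nonneg_of_mem_interior (by rwa [cross_rotate])
      (by rwa [tri_rotate]), bary_nonneg_of_mem_interior (by rwa [cross_rotate'])
      (by rwa [tri_rotate, tri_rotate])⟩
  · intro hz
    rw [mem_interior_iff_mem_nhds]
    have e1 := (continuous_bary a b c).continuousAt.eventually (lt_mem_nhds hz.1)
    have e2 := (continuous_bary b c a).continuousAt.eventually (lt_mem_nhds hz.2.1)
    have e3 := (continuous_bary c a b).continuousAt.eventually (lt_mem_nhds hz.2.2)
    filter_upwards [e1, e2, e3] with w h1 h2 h3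
    exact (mem_tri h).2 ⟨h1.le, h2.le, h3.le⟩

theorem nonempty_interior_tri {a b c : ℂ} (h : cross (b - a) (c - a) ≠ 0) :
    (interior (tri a b c)).Nonempty := by
  refine ⟨(1 / 3 : ℝ) • a + (1 / 3 : ℝ) • b + (1 / 3 : ℝ) • c, ?_⟩
  rw [mem_interior_tri h]
  refine ⟨?_, ?_, ?_⟩
  · rw [bary_of_combination h (by norm_num)]; norm_num
  · rw [show (1 / 3 : ℝ) • a + (1 / 3 : ℝ) • b + (1 / 3 : ℝ) • c =
      (1 / 3 : ℝ) • b + (1 / 3 : ℝ) • c + (1 / 3 : ℝ) • a by ring,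
      bary_of_combination (by rwa [cross_rotate]) (by norm_num)]; norm_num
  · rw [show (1 / 3 : ℝ) • a + (1 / 3 : ℝ) • b + (1 / 3 : ℝ) • c =
      (1 / 3 : ℝ) • c + (1 / 3 : ℝ) • a + (1 / 3 : ℝ) • b by ring,
      bary_of_combination (by rwa [cross_rotate']) (by norm_num)]; norm_num

theorem mem_segment_of_bary {a b c : ℂ} (h : cross (b - a) (c - a) ≠ 0) {z : ℂ}
    (hz : z ∈ tri a b c) (h0 : bary c a b z = 0) : z ∈ segment ℝ a b := by
  obtain ⟨h1, h2, h3⟩ := (mem_tri h).1 hz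
  have h4 := bary_sum h z
  have h5 := bary_combination h z
  rw [h0] at h4 h5
  exact ⟨_, _, h1, h2, by linarith, by simpa using h5⟩

theorem bary_lineMap {a b c : ℂ} (h : cross (b - a) (c - a) ≠ 0) (s : ℝ) :
    bary a b c (AffineMap.lineMap a b s) = 1 - s ∧ bary b c a (AffineMap.lineMap a b s) = s ∧
      bary c a b (AffineMap.lineMap a b s) = 0 := by
  rw [bary_rotate a b c, bary_rotate' a b c, bary]
  refine ⟨?_, ?_, ?_⟩
  · rw [div_eq_iff h]; simp [cross, AffineMap.lineMap_apply]; ring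
  · rw [div_eq_iff h]; simp [cross, AffineMap.lineMap_apply]; ring
  · rw [div_eq_iff h]; simp [cross, AffineMap.lineMap_apply]; ring

theorem segment_subset_frontier_tri {a b c : ℂ} (h : cross (b - a) (c - a) ≠ 0) :
    segment ℝ a b ⊆ frontier (tri a b c) := by
  intro z hz
  rw [(isCompact_tri a b c).isClosed.frontier_eq]
  refine ⟨segment_subset_convexHull (by simp) (by simp) hz, fun hi => ?_⟩
  rw [segment_eq_image_lineMap] at hz
  obtain ⟨s, -, rfl⟩ := hz
  have := ((mem_interior_tri h).1 hi).2.2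
  rw [(bary_lineMap h s).2.2] at this
  exact lt_irrefl _ this

theorem frontier_tri {a b c : ℂ} (h : cross (b - a) (c - a) ≠ 0) :
    frontier (tri a b c) = segment ℝ a b ∪ segment ℝ b c ∪ segment ℝ c a := by
  have hb : cross (c - b) (a - b) ≠ 0 := by rwa [cross_rotate]
  have hc : cross (a - c) (b - c) ≠ 0 := by rwa [cross_rotate']
  apply Subset.antisymm
  · intro z hz
    rw [(isCompact_tri a b c).isClosed.frontier_eq] at hz
    obtain ⟨hz, hi⟩ := hz
    obtain ⟨h1, h2, h3⟩ := (mem_tri h).1 hz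
    rw [mem_interior_tri h] at hi
    by_cases e3 : bary c a b z = 0
    · exact Or.inl (Or.inl (mem_segment_of_bary h hz e3))
    by_cases e1 : bary a b c z = 0
    · exact Or.inl (Or.inr (mem_segment_of_bary hb (by rwa [tri_rotate]) e1))
    by_cases e2 : bary b c a z = 0
    · exact Or.inr (mem_segment_of_bary hc (by rwa [tri_rotate, tri_rotate]) e2)
    exact absurd ⟨h1.lt_of_ne' e1, h2.lt_of_ne' e2, h3.lt_of_ne' e3⟩ hi
  · refine union_subset (union_subset (segment_subset_frontier_tri h) ?_) ?_
    · rw [← tri_rotate]; exact segment_subset_frontier_tri hb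
    · rw [← tri_rotate, ← tri_rotate]; exact segment_subset_frontier_tri hc

/-- Two triangles on opposite sides of a common edge cover a neighborhood of the open edge. -/
theorem openSegment_subset_interior_of_cross {a b x y : ℂ}
    (h : cross (b - a) (x - a) * cross (b - a) (y - a) < 0) :
    openSegment ℝ a b ⊆ interior (tri a b x ∪ tri a b y) := by
  have hx : cross (b - a) (x - a) ≠ 0 := by rintro e; simp [e] at h
  have hy : cross (b - a) (y - a) ≠ 0 := by rintro e; simp [e] at h
  intro z hz
  rw [openSegment_eq_image_lineMap] at hz
  obtain ⟨s, ⟨hs0, hs1⟩, rfl⟩ := hz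
  obtain ⟨x1, x2, -⟩ := bary_lineMap hx s
  obtain ⟨y1, y2, -⟩ := bary_lineMap hy s
  rw [mem_interior_iff_mem_nhds]
  have e1 := (continuous_bary a b x).continuousAt.eventually (lt_mem_nhds (x1 ▸ sub_pos.2 hs1))
  have e2 := (continuous_bary b x a).continuousAt.eventually (lt_mem_nhds (x2 ▸ hs0))
  have e3 := (continuous_bary a b y).continuousAt.eventually (lt_mem_nhds (y1 ▸ sub_pos.2 hs1))
  have e4 := (continuous_bary b y a).continuousAt.eventually (lt_mem_nhds (y2 ▸ hs0))
  filter_upwards [e1, e2, e3, e4] with w h1 h2 h3 h4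
  -- Both coordinates have the numerator `cross (a - w) (b - w)` over denominators of opposite sign,
  -- so they cannot both be negative.
  have key : 0 ≤ bary x a b w ∨ 0 ≤ bary y a b w := by
    rw [bary_rotate', bary_rotate']
    by_contra! hh
    have := mul_pos_of_neg_of_neg hh.1 hh.2
    rw [div_mul_div_comm] at this
    rcases (div_pos_iff.1 this) with h' | h'
    · linarith [h'.2]
    · nlinarith [h'.1]
  rcases key with h5 | h5
  · exact Or.inl ((mem_tri hx).2 ⟨h1.le, h2.le, h5⟩)
  · exact Or.inr ((mem_tri hy).2 ⟨h3.le, h4.le, h5⟩)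

/-- If `x` and `y` were on the same side of the line through `a` and `b`, points slightly off the
midpoint of the edge on that side would be interior to both triangles. -/
theorem cross_mul_neg_of_interior_inter {a b x y : ℂ} (hx : cross (b - a) (x - a) ≠ 0)
    (hy : cross (b - a) (y - a) ≠ 0) (h : interior (tri a b x ∩ tri a b y) = ∅) :
    cross (b - a) (x - a) * cross (b - a) (y - a) < 0 := by
  by_contra! hneg
  have hpos := hneg.lt_of_ne' (mul_ne_zero hx hy)
  set m : ℂ := AffineMap.lineMap a b (1 / 2 : ℝ)
  set D := cross (b - a) (x - a)
  -- `I * (b - a)` is normal to the edge, and the sign of `D` turns it to the side of `x`.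
  let f : ℝ → ℂ := fun t => m + (t * D : ℝ) • (Complex.I * (b - a))
  have hf : Tendsto f (𝓝[>] 0) (𝓝 m) := by
    have : Continuous f := by fun_prop
    simpa [f] using (this.tendsto 0).mono_left nhdsWithin_le_nhds
  have hab : 0 < (b - a).re ^ 2 + (b - a).im ^ 2 := by
    by_contra! h'
    have h1 : (b - a).re = 0 := by nlinarith [sq_nonneg (b - a).re, sq_nonneg (b - a).im]
    have h2 : (b - a).im = 0 := by nlinarith [sq_nonneg (b - a).re, sq_nonneg (b - a).im]
    exact hx (by simp only [D, cross, h1, h2]; ring)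
  have main : ∀ w, D * cross (b - a) (w - a) > 0 → ∀ᶠ t in 𝓝[>] 0, f t ∈ interior (tri a b w) := by
    intro w hw
    have hw0 : cross (b - a) (w - a) ≠ 0 := by rintro e; simp [e] at hw
    obtain ⟨m1, m2, -⟩ := bary_lineMap hw0 (1 / 2)
    have e1 := ((continuous_bary a b w).continuousAt.tendsto.comp hf).eventually
      (lt_mem_nhds (a := 0) (by rw [m1]; norm_num))
    have e2 := ((continuous_bary b w a).continuousAt.tendsto.comp hf).eventually
      (lt_mem_nhds (a := 0) (by rw [m2]; norm_num))
    filter_upwards [e1, e2, self_mem_nhdsWithin] with t h1 h2 ht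
    refine (mem_interior_tri hw0).2 ⟨h1, h2, ?_⟩
    rw [bary_rotate']
    have : cross (a - f t) (b - f t) = t * D * ((b - a).re ^ 2 + (b - a).im ^ 2) := by
      simp [f, cross, m, AffineMap.lineMap_apply]; ring
    rw [this, mul_right_comm, mul_div_assoc]
    have ht : 0 < t := ht
    have : 0 < D / cross (b - a) (w - a) := by
      rw [← mul_div_mul_right _ _ hw0]
      exact div_pos hw (mul_self_pos.2 hw0)
    positivity
  obtain ⟨t, h1, h2⟩ := ((main x (mul_self_pos.2 hx)).and (main y hpos)).exists
  have : f t ∈ interior (tri a b x ∩ tri a b y) := by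
    rw [interior_inter]; exact ⟨h1, h2⟩
  rw [h] at this
  exact this

theorem openSegment_subset_interior {a b x y : ℂ} (hx : cross (b - a) (x - a) ≠ 0)
    (hy : cross (b - a) (y - a) ≠ 0) (h : interior (tri a b x ∩ tri a b y) = ∅) :
    openSegment ℝ a b ⊆ interior (tri a b x ∪ tri a b y) :=
  openSegment_subset_interior_of_cross (cross_mul_neg_of_interior_inter hx hy h)

/-! ### Simple polygons -/

theorem val_finRotate {N : ℕ} (i : Fin N) : (finRotate N i : ℕ) = (i + 1) % N := by
  obtain ⟨N, rfl⟩ : ∃ M, N = M + 1 := ⟨N - 1, by have := i.2; omega⟩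
  rw [coe_finRotate]
  split_ifs with h
  · simp [h]
  · rw [Nat.mod_eq_of_lt]
    have := i.2
    have : (i : ℕ) ≠ N := fun h' => h (Fin.ext h')
    omega

/-- `v 0, …, v q, v (q + 1) = v 0` is a closed polygonal curve without self-intersections. -/
def IsSimpleCycle (q : ℕ) (v : ℕ → ℂ) : Prop :=
  v (q + 1) = v 0 ∧ ∀ i ≤ q, ∀ j ≤ q, ∀ s ∈ Ico (0 : ℝ) 1, ∀ t ∈ Ico (0 : ℝ) 1,
    AffineMap.lineMap (v i) (v (i + 1)) s = AffineMap.lineMap (v j) (v (j + 1)) t → i = j ∧ s = t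

namespace SimplePolygon

/-- The directed segment from `a` to `b` is an edge. -/
def HasEdge (P : SimplePolygon) (a b : ℂ) : Prop :=
  ∃ i, P.vertex i = a ∧ P.vertex (finRotate _ i) = b

theorem HasEdge.left_mem {P : SimplePolygon} {a b : ℂ} (h : P.HasEdge a b) :
    a ∈ range P.vertex := h.imp fun _ h => h.1

theorem HasEdge.right_mem {P : SimplePolygon} {a b : ℂ} (h : P.HasEdge a b) :
    b ∈ range P.vertex := by
  obtain ⟨i, -, h⟩ := h
  exact ⟨_, h⟩

/-- Sequences indexed by `ℕ`, with the first vertex repeated at `q + 1`, spare the cyclic arithmetic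
of `Fin` when boundaries are concatenated. -/
theorem exists_of_isSimpleCycle {q : ℕ} {v : ℕ → ℂ} (hq : 2 ≤ q) (hv : IsSimpleCycle q v)
    {A : Set ℂ} (hA : IsCompact A) (hi : (interior A).Nonempty)
    (hf : frontier A = ⋃ i ≤ q, segment ℝ (v i) (v (i + 1))) :
    ∃ P : SimplePolygon, P.region = A ∧ ∀ i ≤ q, P.HasEdge (v i) (v (i + 1)) := by
  have hnext : ∀ i : Fin (q + 1), v (finRotate (q + 1) i) = v (i + 1) := by
    intro i
    rw [val_finRotate]
    rcases Nat.lt_or_ge (i + 1) (q + 1) with h | h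
    · rw [Nat.mod_eq_of_lt h]
    · have h' : (i : ℕ) + 1 = q + 1 := le_antisymm i.2 h
      rw [h', Nat.mod_self, hv.1]
  refine ⟨⟨q + 1, by omega, fun i => v i, ?_, A, hA, hi, ?_⟩, rfl, ?_⟩
  · intro i j s hs t ht h
    simp only [hnext] at h
    obtain ⟨h1, h2⟩ := hv.2 i (by omega) j (by omega) s hs t ht h
    exact ⟨Fin.ext h1, h2⟩
  · simp only [hnext]
    rw [hf]
    ext z
    simp only [mem_iUnion]
    constructor
    · rintro ⟨i, hi, hz⟩
      exact ⟨⟨i, by omega⟩, hz⟩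
    · rintro ⟨i, hz⟩
      exact ⟨i, Nat.lt_succ_iff.1 i.2, hz⟩
  · intro i hi
    exact ⟨⟨i, Nat.lt_succ_iff.2 hi⟩, rfl, hnext _⟩

/-- The numbering is rotated so that the given edge comes last; without it, the path `v 0, …, v q`
from `b` to `a` remains, ready to be continued along another polygon. -/
theorem HasEdge.exists_isSimpleCycle {P : SimplePolygon} {a b : ℂ} (h : P.HasEdge a b) :
    ∃ q v, 2 ≤ q ∧ IsSimpleCycle q v ∧ v 0 = b ∧ v q = a ∧
      frontier P.region = ⋃ i ≤ q, segment ℝ (v i) (v (i + 1)) ∧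
      ∀ x y, P.HasEdge x y → ∃ i ≤ q, v i = x ∧ v (i + 1) = y := by
  obtain ⟨i, rfl, rfl⟩ := h
  have h3 := P.three_le_size
  have hpos : 0 < P.size := by omega
  let f : ℕ → Fin P.size := fun l => ⟨(i + 1 + l) % P.size, Nat.mod_lt _ hpos⟩
  have hf : ∀ l, f (l + 1) = finRotate _ (f l) := by
    intro l
    apply Fin.ext
    rw [val_finRotate]
    simp [f, ← add_assoc]
  have hinj : ∀ l ≤ P.size - 1, ∀ l' ≤ P.size - 1, f l = f l' → l = l' := by
    intro l hl l' hl' h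
    have h1 : i + 1 + l ≡ i + 1 + l' [MOD P.size] := congrArg Fin.val h
    have h2 := Nat.ModEq.add_left_cancel' _ h1
    exact Nat.ModEq.eq_of_lt_of_lt h2 (by omega) (by omega)
  have hsurj : ∀ j, ∃ l ≤ P.size - 1, f l = j := by
    intro j
    have hbij : Function.Bijective fun l : Fin P.size => f l := by
      rw [← Finite.injective_iff_bijective]
      intro l l' h
      exact Fin.ext (hinj l (by omega) l' (by omega) h)
    obtain ⟨l, hl⟩ := hbij.2 j
    exact ⟨l, by omega, hl⟩
  have hlast : f (P.size - 1) = i := by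
    apply Fin.ext
    simp only [f]
    rw [show (i : ℕ) + 1 + (P.size - 1) = i + P.size by omega, Nat.add_mod_right,
      Nat.mod_eq_of_lt i.2]
  have hzero : f 0 = finRotate _ i := by
    apply Fin.ext
    rw [val_finRotate]
  refine ⟨P.size - 1, fun l => P.vertex (f l), by omega, ⟨?_, ?_⟩, ?_, ?_, ?_, ?_⟩
  · simp only [hf, hlast, hzero]
  · intro l hl l' hl' s hs t ht h
    simp only [hf] at h
    obtain ⟨h1, h2⟩ := P.simple _ _ s hs t ht h
    exact ⟨hinj l hl l' hl' h1, h2⟩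
  · simp only [hzero]
  · simp only [hlast]
  · rw [P.frontier_region]
    ext z
    simp only [mem_iUnion, hf]
    constructor
    · rintro ⟨j, hz⟩
      obtain ⟨l, hl, rfl⟩ := hsurj j
      exact ⟨l, hl, hz⟩
    · rintro ⟨l, hl, hz⟩
      exact ⟨_, hz⟩
  · rintro x y ⟨j, rfl, rfl⟩
    obtain ⟨l, hl, rfl⟩ := hsurj j
    exact ⟨l, hl, rfl, by simp only [hf]⟩

theorem exists_tri {a b c : ℂ} (h : cross (b - a) (c - a) ≠ 0) :
    ∃ P : SimplePolygon, P.region = tri a b c ∧ P.HasEdge a b ∧ P.HasEdge b c ∧ P.HasEdge c a := by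
  let v : ℕ → ℂ := fun i => if i = 0 then a else if i = 1 then b else if i = 2 then c else a
  have hb : cross (c - b) (a - b) ≠ 0 := by rwa [cross_rotate]
  have hc : cross (a - c) (b - c) ≠ 0 := by rwa [cross_rotate']
  have key : IsSimpleCycle 2 v := by
    refine ⟨rfl, ?_⟩
    intro i hi j hj s hs t ht e
    have e1 := congrArg (bary a b c) e
    have e2 := congrArg (bary b c a) e
    have e3 := congrArg (bary c a b) e
    obtain ⟨s0, s1⟩ := hs
    obtain ⟨t0, t1⟩ := ht
    interval_cases i <;> interval_cases j <;>
      simp only [v, bary_lineMap h, bary_lineMap hb, bary_lineMap hc, zero_add, one_ne_zero,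
        if_true, if_false, OfNat.ofNat_ne_zero, OfNat.ofNat_ne_one, Nat.reduceAdd, Nat.reduceEqDiff] at e1 e2 e3 <;>
      first
        | exact ⟨rfl, by linarith⟩
        | (exfalso; linarith)
  obtain ⟨P, hP, he⟩ := exists_of_isSimpleCycle le_rfl key (isCompact_tri a b c)
    (nonempty_interior_tri h) (by
      rw [frontier_tri h]
      ext z
      simp only [mem_union, mem_iUnion]
      constructor
      · rintro ((hz | hz) | hz)
        · exact ⟨0, by norm_num, hz⟩
        · exact ⟨1, by norm_num, hz⟩
        · exact ⟨2, by norm_num, hz⟩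
      · rintro ⟨i, hi, hz⟩
        interval_cases i
        · exact Or.inl (Or.inl hz)
        · exact Or.inl (Or.inr hz)
        · exact Or.inr hz)
  exact ⟨P, hP, he 0 (by norm_num), he 1 (by norm_num), he 2 (by norm_num)⟩

/-- Away from the closed set `B`, the sets `A` and `A ∪ B` agree locally. -/
theorem mem_frontier_union_left {A B : Set ℂ} (hB : IsClosed B) {x : ℂ} (hx : x ∈ frontier A)
    (hxB : x ∉ B) : x ∈ frontier (A ∪ B) := by
  refine ⟨closure_mono subset_union_left hx.1, fun hi => hx.2 ?_⟩
  have h : interior (A ∪ B) ∩ Bᶜ ⊆ A := by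
    rintro y ⟨h1, h2⟩
    exact (interior_subset h1).resolve_right h2
  exact interior_maximal h (isOpen_interior.inter hB.isOpen_compl) ⟨hi, hxB⟩

/-- Endpoints need not be checked; this matters when polygons are glued, since the ends of the
common edge belong to both of them. -/
theorem segment_subset_of_forall_lineMap_mem {a b : ℂ} {S : Set ℂ} (hS : IsClosed S)
    (h : ∀ s ∈ Ioo (0 : ℝ) 1, AffineMap.lineMap a b s ∈ S) : segment ℝ a b ⊆ S := by
  rw [segment_eq_image_lineMap, ← closure_Ioo (zero_ne_one' ℝ)]
  refine (image_closure_subset_closure_image AffineMap.lineMap_continuous).trans ?_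
  exact closure_minimal (by rintro _ ⟨s, hs, rfl⟩; exact h s hs) hS

/-- Gluing two simple polygons that meet exactly in a common edge. -/
theorem exists_union {P Q : SimplePolygon} {a b : ℂ} (hP : P.HasEdge a b) (hQ : Q.HasEdge b a)
    (hPQ : P.region ∩ Q.region = segment ℝ a b)
    (hopen : openSegment ℝ a b ⊆ interior (P.region ∪ Q.region)) :
    ∃ R : SimplePolygon, R.region = P.region ∪ Q.region ∧
      (∀ x y, P.HasEdge x y → (x, y) ≠ (a, b) → R.HasEdge x y) ∧
      (∀ x y, Q.HasEdge x y → (x, y) ≠ (b, a) → R.HasEdge x y) := by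
  obtain ⟨p, v, hp, hv, hv0, hvp, hfP, heP⟩ := hP.exists_isSimpleCycle
  obtain ⟨q, u, hq, hu, hu0, huq, hfQ, heQ⟩ := hQ.exists_isSimpleCycle
  have hv1 : v (p + 1) = b := hv.1.trans hv0
  have hu1 : u (q + 1) = a := hu.1.trans hu0
  have hcP : IsClosed P.region := P.isCompact_region.isClosed
  have hcQ : IsClosed Q.region := Q.isCompact_region.isClosed
  have hsubP : ∀ i ≤ p, segment ℝ (v i) (v (i + 1)) ⊆ frontier P.region := fun i hi => by
    rw [hfP]; exact subset_biUnion_of_mem (u := fun i => segment ℝ (v i) (v (i + 1))) hi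
  have hsubQ : ∀ i ≤ q, segment ℝ (u i) (u (i + 1)) ⊆ frontier Q.region := fun i hi => by
    rw [hfQ]; exact subset_biUnion_of_mem (u := fun i => segment ℝ (u i) (u (i + 1))) hi
  have hmem : ∀ (x y : ℂ), ∀ s ∈ Ico (0 : ℝ) 1, AffineMap.lineMap x y s ∈ segment ℝ x y :=
    fun x y s hs => by
      rw [segment_eq_image_lineMap]; exact ⟨s, ⟨hs.1, hs.2.le⟩, rfl⟩
  -- Apart from the edge from `a` to `b`, the boundary of `P` meets `Q` only at the ends of that
  -- edge: common points lie on the last edge of a simple cycle. The half-open parametrization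
  -- leaves only `b`.
  have hPb : ∀ i < p, ∀ s ∈ Ico (0 : ℝ) 1, AffineMap.lineMap (v i) (v (i + 1)) s ∈ Q.region →
      AffineMap.lineMap (v i) (v (i + 1)) s = b := by
    intro i hi s hs h
    have h1 : AffineMap.lineMap (v i) (v (i + 1)) s ∈ segment ℝ a b :=
      hPQ ▸ ⟨hcP.frontier_subset (hsubP i hi.le (hmem _ _ s hs)), h⟩
    rw [segment_eq_image_lineMap] at h1
    obtain ⟨t, ⟨ht0, ht1⟩, ht⟩ := h1
    rcases ht1.eq_or_lt with rfl | ht1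
    · rw [← ht, AffineMap.lineMap_apply_one]
    · have := (hv.2 p le_rfl i hi.le t ⟨ht0, ht1⟩ s hs (by rw [hvp, hv1, ht])).1
      omega
  have hQa : ∀ i < q, ∀ s ∈ Ico (0 : ℝ) 1, AffineMap.lineMap (u i) (u (i + 1)) s ∈ P.region →
      AffineMap.lineMap (u i) (u (i + 1)) s = a := by
    intro i hi s hs h
    have h1 : AffineMap.lineMap (u i) (u (i + 1)) s ∈ segment ℝ b a :=
      segment_symm ℝ a b ▸ hPQ ▸ ⟨h, hcQ.frontier_subset (hsubQ i hi.le (hmem _ _ s hs))⟩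
    rw [segment_eq_image_lineMap] at h1
    obtain ⟨t, ⟨ht0, ht1⟩, ht⟩ := h1
    rcases ht1.eq_or_lt with rfl | ht1
    · rw [← ht, AffineMap.lineMap_apply_one]
    · have := (hu.2 q le_rfl i hi.le t ⟨ht0, ht1⟩ s hs (by rw [huq, hu1, ht])).1
      omega
  have h01 : (0 : ℝ) ∈ Ico (0 : ℝ) 1 := ⟨le_rfl, one_pos⟩
  have hab : a ≠ b := by
    intro h
    have := (hv.2 p le_rfl 0 (Nat.zero_le _) 0 h01 0 h01 (by simp [hvp, hv0, h])).1
    omega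
  have hPQne : ∀ i < p, ∀ j < q, ∀ s ∈ Ico (0 : ℝ) 1, ∀ t ∈ Ico (0 : ℝ) 1,
      AffineMap.lineMap (v i) (v (i + 1)) s ≠ AffineMap.lineMap (u j) (u (j + 1)) t := by
    intro i hi j hj s hs t ht h
    have h1 := hPb i hi s hs (h ▸ hcQ.frontier_subset (hsubQ j hj.le (hmem _ _ t ht)))
    have h2 := hQa j hj t ht (h ▸ hcP.frontier_subset (hsubP i hi.le (hmem _ _ s hs)))
    exact hab (h2.symm.trans (h.symm.trans h1))
  -- The path of `P` from `b` to `a`, continued by the path of `Q` from `a` to `b`: `p + q` edges in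
  -- all, so the last index is `p + q - 1`.
  let w : ℕ → ℂ := fun i => if i ≤ p then v i else u (i - p)
  have hwP : ∀ i ≤ p, w i = v i := fun i hi => if_pos hi
  have hwQ : ∀ i, w (p + i) = u i := by
    intro i
    rcases Nat.eq_zero_or_pos i with rfl | hi
    · simp [w, hvp, hu0]
    · simp only [w]
      rw [if_neg (by omega), Nat.add_sub_cancel_left]
  have hedge : ∀ i ≤ p + q - 1, (i < p ∧ w i = v i ∧ w (i + 1) = v (i + 1)) ∨
      ∃ j < q, i = p + j ∧ w i = u j ∧ w (i + 1) = u (j + 1) := by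
    intro i hi
    rcases Nat.lt_or_ge i p with h | h
    · exact Or.inl ⟨h, hwP i h.le, hwP _ h⟩
    · obtain ⟨j, rfl⟩ := Nat.exists_eq_add_of_le h
      exact Or.inr ⟨j, by omega, rfl, hwQ j, hwQ (j + 1)⟩
  have hw : IsSimpleCycle (p + q - 1) w := by
    refine ⟨?_, ?_⟩
    · rw [show p + q - 1 + 1 = p + q by omega, hwQ, huq, hwP 0 (Nat.zero_le _), hv0]
    · intro i hi j hj s hs t ht h
      rcases hedge i hi with ⟨h1, h2, h3⟩ | ⟨i', h1, rfl, h2, h3⟩ <;>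
        rcases hedge j hj with ⟨g1, g2, g3⟩ | ⟨j', g1, rfl, g2, g3⟩ <;>
        rw [h2, h3, g2, g3] at h
      · exact hv.2 i h1.le j g1.le s hs t ht h
      · exact absurd h (hPQne _ h1 _ g1 s hs t ht)
      · exact absurd h.symm (hPQne _ g1 _ h1 t ht s hs)
      · obtain ⟨e1, e2⟩ := hu.2 i' h1.le j' g1.le s hs t ht h
        exact ⟨by rw [e1], e2⟩
  have hfr : frontier (P.region ∪ Q.region) =
      ⋃ i ≤ p + q - 1, segment ℝ (w i) (w (i + 1)) := by
    apply Subset.antisymm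
    · intro x hx
      -- The open common edge has become interior; of that edge only the endpoints, which are
      -- vertices of `w`, remain on the frontier.
      have hxo : x ∉ openSegment ℝ a b := fun h => hx.2 (hopen h)
      have hxe : ∀ y z, (y = a ∧ z = b ∨ y = b ∧ z = a) → x ∈ segment ℝ y z →
          x ∈ ⋃ i ≤ p + q - 1, segment ℝ (w i) (w (i + 1)) := by
        intro y z hyz h
        have h' : x ∈ segment ℝ a b := by
          rcases hyz with ⟨rfl, rfl⟩ | ⟨rfl, rfl⟩
          · exact h
          · rwa [segment_symm]
        rw [← insert_endpoints_openSegment] at h'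
        simp only [mem_iUnion]
        rcases h' with rfl | rfl | h'
        · refine ⟨p, by omega, ?_⟩
          rw [hwP p le_rfl, hvp]; exact left_mem_segment _ _ _
        · refine ⟨0, by omega, ?_⟩
          rw [hwP 0 (Nat.zero_le _), hv0]; exact left_mem_segment _ _ _
        · exact absurd h' hxo
      have hx' : x ∈ frontier P.region ∪ frontier Q.region :=
        (frontier_union_subset _ _ hx).imp (fun h => h.1) (fun h => h.2)
      rcases hx' with h | h
      · rw [hfP] at h
        simp only [mem_iUnion] at h
        obtain ⟨i, hi, h⟩ := h
        rcases hi.eq_or_lt with rfl | hi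
        · exact hxe _ _ (Or.inl ⟨hvp, hv1⟩) h
        · simp only [mem_iUnion]
          exact ⟨i, by omega, by rwa [hwP i hi.le, hwP _ hi]⟩
      · rw [hfQ] at h
        simp only [mem_iUnion] at h
        obtain ⟨i, hi, h⟩ := h
        rcases hi.eq_or_lt with rfl | hi
        · exact hxe _ _ (Or.inr ⟨huq, hu1⟩) h
        · simp only [mem_iUnion]
          exact ⟨p + i, by omega, by rwa [add_assoc, hwQ, hwQ]⟩
    · refine iUnion₂_subset fun i hi => segment_subset_of_forall_lineMap_mem isClosed_frontier ?_
      intro s hs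
      have hs' : s ∈ Ico (0 : ℝ) 1 := ⟨hs.1.le, hs.2⟩
      rcases hedge i hi with ⟨h1, h2, h3⟩ | ⟨j, h1, -, h2, h3⟩
      · rw [h2, h3]
        refine mem_frontier_union_left hcQ (hsubP i h1.le (hmem _ _ s hs')) fun h => ?_
        have h4 := hPb i h1 s hs' h
        have := (hv.2 i h1.le 0 (Nat.zero_le _) s hs' 0 h01 (by rw [h4]; simp [hv0])).2
        exact hs.1.ne' this
      · rw [h2, h3, union_comm]
        refine mem_frontier_union_left hcP (hsubQ j h1.le (hmem _ _ s hs')) fun h => ?_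
        have h4 := hQa j h1 s hs' h
        have := (hu.2 j h1.le 0 (Nat.zero_le _) s hs' 0 h01 (by rw [h4]; simp [hu0])).2
        exact hs.1.ne' this
  obtain ⟨R, hR, he⟩ := exists_of_isSimpleCycle (by omega) hw
    (P.isCompact_region.union Q.isCompact_region)
    (P.nonempty_interior.mono (interior_mono subset_union_left)) hfr
  refine ⟨R, hR, ?_, ?_⟩
  · intro x y hxy hne
    obtain ⟨i, hi, rfl, rfl⟩ := heP x y hxy
    have hi' : i < p := hi.lt_of_ne fun h => hne (by rw [h, hvp, hv1])
    have := he i (by omega)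
    rwa [hwP i hi, hwP _ hi'] at this
  · intro x y hxy hne
    obtain ⟨i, hi, rfl, rfl⟩ := heQ x y hxy
    have hi' : i < q := hi.lt_of_ne fun h => hne (by rw [h, huq, hu1])
    have := he (p + i) (by omega)
    rwa [add_assoc, hwQ, hwQ] at this

end SimplePolygon

/-! ### Regular polygons -/

/-- An endpoint of a segment is no proper convex combination of other points of it. In parameters: a
sum of nonnegative terms vanishes, which forces every parameter to be 0 or 1. -/
theorem segment_eq_segment_iff {a b c d : ℂ} (hab : a ≠ b) (h : segment ℝ a b = segment ℝ c d) :
    (a = c ∧ b = d) ∨ (a = d ∧ b = c) := by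
  have hc : c ∈ segment ℝ a b := h ▸ left_mem_segment ℝ c d
  have hd : d ∈ segment ℝ a b := h ▸ right_mem_segment ℝ c d
  have ha : a ∈ segment ℝ c d := h ▸ left_mem_segment ℝ a b
  have hb : b ∈ segment ℝ c d := h ▸ right_mem_segment ℝ a b
  obtain ⟨s', s, hs', hs, e1, rfl⟩ := hc
  obtain ⟨t', t, ht', ht, e2, rfl⟩ := hd
  obtain ⟨u', u, hu', hu, e3, ha⟩ := ha
  obtain ⟨w', w, hw', hw, e4, hb⟩ := hb
  obtain rfl : s' = 1 - s := by linarith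
  obtain rfl : t' = 1 - t := by linarith
  obtain rfl : u' = 1 - u := by linarith
  obtain rfl : w' = 1 - w := by linarith
  have hba : b - a ≠ 0 := sub_ne_zero.2 hab.symm
  have h1 : (1 - u) * s + u * t = 0 := by
    have : (((1 - u) * s + u * t : ℝ) : ℂ) * (b - a) = 0 := by
      simp only [Complex.real_smul] at ha
      push_cast at ha ⊢
      linear_combination ha
    exact_mod_cast (mul_eq_zero.1 this).resolve_right hba
  have h2 : (1 - w) * s + w * t = 1 := by
    have : (((1 - w) * s + w * t - 1 : ℝ) : ℂ) * (b - a) = 0 := by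
      simp only [Complex.real_smul] at hb
      push_cast at hb ⊢
      linear_combination hb
    have h3 := (mul_eq_zero.1 this).resolve_right hba
    have : (1 - w) * s + w * t - 1 = 0 := by exact_mod_cast h3
    linarith
  have h3 : (1 - u) * s = 0 := by nlinarith [mul_nonneg hu' hs, mul_nonneg hu ht]
  have h4 : u * t = 0 := by nlinarith [mul_nonneg hu' hs, mul_nonneg hu ht]
  rcases mul_eq_zero.1 h3 with h5 | rfl
  · obtain rfl : u = 1 := by linarith
    obtain rfl : t = 0 := by linarith
    obtain rfl : s = 1 := by nlinarith
    right; simp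
  · obtain rfl : t = 1 := by nlinarith
    left; simp

/-! ### Vertices of a regular polygon and the linear functionals of its edges. -/

namespace RegularPolygon

variable {k : ℕ} {r : ℝ}

theorem vertex_eq (P : RegularPolygon k r) (j : ℕ) :
    P.vertex j = P.center + P.spoke * Complex.exp (2 * Real.pi * Complex.I / k) ^ j := by
  rw [vertex, ← Complex.exp_nat_mul]
  congr 3; ring

theorem exp_pow_k (hk : 3 ≤ k) : Complex.exp (2 * Real.pi * Complex.I / k) ^ k = 1 :=
  (Complex.isPrimitiveRoot_exp k (by omega)).pow_eq_one

theorem vertex_add_k (hk : 3 ≤ k) (P : RegularPolygon k r) (j : ℕ) :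
    P.vertex (j + k) = P.vertex j := by
  rw [vertex_eq, vertex_eq, pow_add, exp_pow_k hk, mul_one]

theorem vertex_congr (hk : 3 ≤ k) (P : RegularPolygon k r) {i j : ℕ} (h : i ≡ j [MOD k]) :
    P.vertex i = P.vertex j := by
  rw [vertex_eq, vertex_eq, pow_eq_pow_of_modEq h (exp_pow_k hk)]

theorem vertex_mod (hk : 3 ≤ k) (P : RegularPolygon k r) (j : ℕ) :
    P.vertex (j % k) = P.vertex j := vertex_congr hk P (Nat.mod_modEq _ _)

theorem spoke_ne_zero (hr : 0 < r) (P : RegularPolygon k r) : P.spoke ≠ 0 := by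
  rw [← norm_pos_iff, P.norm_spoke]; exact hr

/-- The signed distance of `z` from the center in the direction perpendicular to the `i`-th edge,
up to scale. -/
noncomputable def height (P : RegularPolygon k r) (i : ℕ) (z : ℂ) : ℝ :=
  ((z - P.center) * starRingEnd ℂ
    (P.spoke * Complex.exp (2 * Real.pi * Complex.I / k) ^ i * Complex.exp (Real.pi * Complex.I / k))).re

/-- The value of `height i` on the `i`-th edge. -/
noncomputable def apothem (k : ℕ) (r : ℝ) : ℝ := r ^ 2 * Real.cos (Real.pi / k)

theorem apothem_pos (hk : 3 ≤ k) (hr : 0 < r) : 0 < apothem k r := by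
  have : (3 : ℝ) ≤ k := by exact_mod_cast hk
  refine mul_pos (by positivity) (Real.cos_pos_of_mem_Ioo ⟨?_, ?_⟩)
  · have : 0 < Real.pi / k := by positivity
    linarith [Real.pi_pos]
  · rw [div_lt_div_iff₀ (by positivity) two_pos]; nlinarith [Real.pi_pos]

theorem height_center (P : RegularPolygon k r) (i : ℕ) : P.height i P.center = 0 := by
  simp [height]

theorem height_combination (P : RegularPolygon k r) (i : ℕ) (x y : ℂ) (a b : ℝ) :
    P.height i (P.center + a * (x - P.center) + b * (y - P.center)) =
      a * P.height i x + b * P.height i y := by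
  simp only [height]
  rw [← Complex.re_ofReal_mul, ← Complex.re_ofReal_mul, ← Complex.add_re]
  congr 1; ring

theorem height_lineMap (P : RegularPolygon k r) (i : ℕ) (x y : ℂ) (s : ℝ) :
    P.height i (AffineMap.lineMap x y s) = (1 - s) * P.height i x + s * P.height i y := by
  rw [← height_combination]
  congr 1
  simp [AffineMap.lineMap_apply]; ring

theorem continuous_height (P : RegularPolygon k r) (i : ℕ) : Continuous (P.height i) := by
  unfold height; fun_prop

theorem height_vertex (hk : 3 ≤ k) (P : RegularPolygon k r) (i l : ℕ) :
    P.height i (P.vertex l) = r ^ 2 * Real.cos ((2 * l - 2 * i - 1) * (Real.pi / k)) := by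
  have hk0 : (k : ℂ) ≠ 0 := by exact_mod_cast (by omega : k ≠ 0)
  have h1 : P.spoke * starRingEnd ℂ P.spoke = ((r ^ 2 : ℝ) : ℂ) := by
    rw [Complex.mul_conj, Complex.normSq_eq_norm_sq, P.norm_spoke]
  have h2 : (P.vertex l - P.center) * starRingEnd ℂ (P.spoke *
      Complex.exp (2 * Real.pi * Complex.I / k) ^ i * Complex.exp (Real.pi * Complex.I / k)) =
      ((r ^ 2 : ℝ) : ℂ) * Complex.exp (((2 * l - 2 * i - 1) * (Real.pi / k) : ℝ) * Complex.I) := by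
    rw [vertex_eq, add_sub_cancel_left, map_mul, map_mul, map_pow, ← Complex.exp_conj,
      ← Complex.exp_conj, ← h1, ← Complex.exp_nat_mul, ← Complex.exp_nat_mul]
    simp only [map_div₀, map_mul, Complex.conj_I, Complex.conj_ofReal, map_ofNat, map_natCast]
    have h3 : (((2 * l - 2 * i - 1) * (Real.pi / k) : ℝ) : ℂ) * Complex.I =
        l * (2 * Real.pi * Complex.I / k) + i * (2 * Real.pi * -Complex.I / k) +
          Real.pi * -Complex.I / k := by
      push_cast; field_simp; ring
    rw [h3, Complex.exp_add, Complex.exp_add]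
    ring
  rw [height, h2, Complex.re_ofReal_mul, Complex.exp_ofReal_mul_I_re]

/-- For `d = l - i` this is, up to `r ^ 2`, the gap between the height of the edge `i` and that of
the vertex `l`. The product vanishes at the two ends of the edge, `d = 0` and `d = 1`, and is easy
to sign elsewhere. -/
theorem cos_sub_cos_eq (k : ℕ) (d : ℝ) :
    Real.cos (Real.pi / k) - Real.cos ((2 * d - 1) * (Real.pi / k)) =
      2 * (Real.sin (d * (Real.pi / k)) * Real.sin ((d - 1) * (Real.pi / k))) := by
  rw [Real.cos_sub_cos, show (Real.pi / k + (2 * d - 1) * (Real.pi / k)) / 2 = d * (Real.pi / k) by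
    ring, show (Real.pi / k - (2 * d - 1) * (Real.pi / k)) / 2 = -((d - 1) * (Real.pi / k)) by ring,
    Real.sin_neg]
  ring

theorem sin_mul_pos {d : ℝ} (hk : 3 ≤ k) (h0 : 0 < d) (h1 : d < k) :
    0 < Real.sin (d * (Real.pi / k)) := by
  have hk' : (0 : ℝ) < k := by exact_mod_cast (by omega : 0 < k)
  apply Real.sin_pos_of_pos_of_lt_pi
  · have := Real.pi_pos; positivity
  · rw [mul_div_assoc', div_lt_iff₀ hk', mul_comm]
    exact mul_lt_mul_of_pos_left h1 Real.pi_pos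

theorem height_vertex_self (hk : 3 ≤ k) (P : RegularPolygon k r) (i : ℕ) :
    P.height i (P.vertex i) = apothem k r := by
  rw [height_vertex hk, apothem, ← Real.cos_neg]; congr 2; ring

theorem height_vertex_succ (hk : 3 ≤ k) (P : RegularPolygon k r) (i : ℕ) :
    P.height i (P.vertex (i + 1)) = apothem k r := by
  rw [height_vertex hk, apothem]; congr 2; push_cast; ring

theorem height_mod (hk : 3 ≤ k) (P : RegularPolygon k r) (i : ℕ) :
    P.height (i % k) = P.height i := by
  unfold height
  rw [pow_eq_pow_of_modEq (Nat.mod_modEq i k) (exp_pow_k hk)]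

theorem height_vertex_lt (hk : 3 ≤ k) (hr : 0 < r) (P : RegularPolygon k r) {i l : ℕ}
    (h0 : l % k ≠ i % k) (h1 : l % k ≠ (i + 1) % k) : P.height i (P.vertex l) < apothem k r := by
  rw [← vertex_mod hk, ← height_mod hk]
  rw [Nat.add_mod, Nat.mod_eq_of_lt (show 1 < k by omega)] at h1
  have hl : l % k < k := Nat.mod_lt _ (by omega)
  have hi : i % k < k := Nat.mod_lt _ (by omega)
  generalize l % k = l at *
  generalize i % k = i at *
  have h1' : l ≠ i + 1 := by
    rintro rfl; exact h1 (Nat.mod_eq_of_lt hl).symm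
  have h2 : ¬ (l = 0 ∧ i = k - 1) := by
    rintro ⟨rfl, rfl⟩
    apply h1
    rw [show k - 1 + 1 = k by omega, Nat.mod_self]
  rw [height_vertex hk, apothem, ← sub_pos, ← mul_sub,
    show (2 * (l : ℝ) - 2 * i - 1) = 2 * ((l : ℝ) - i) - 1 by ring, cos_sub_cos_eq]
  have hl' : (l : ℝ) < k := by exact_mod_cast hl
  have hi' : (i : ℝ) < k := by exact_mod_cast hi
  have hl0 : (0 : ℝ) ≤ l := Nat.cast_nonneg l
  have hi0 : (0 : ℝ) ≤ i := Nat.cast_nonneg i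
  refine mul_pos (by positivity) (mul_pos two_pos ?_)
  -- For `l` after `i` both sines are positive, for `l` before `i` both are negative.
  rcases Nat.lt_or_ge i l with h | h
  · have h3 : (i : ℝ) + 2 ≤ l := by exact_mod_cast (by omega : i + 2 ≤ l)
    exact mul_pos (sin_mul_pos hk (by linarith) (by linarith))
      (sin_mul_pos hk (by linarith) (by linarith))
  · have h3 : (l : ℝ) + 1 ≤ i := by exact_mod_cast (by omega : l + 1 ≤ i)
    have h4 : (i : ℝ) + 2 ≤ l + k := by
      exact_mod_cast (by omega : i + 2 ≤ l + k)
    have h5 := sin_mul_pos (k := k) (d := i - l) hk (by linarith) (by linarith)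
    have h6 := sin_mul_pos (k := k) (d := i - l + 1) hk (by linarith) (by linarith)
    have e1 : Real.sin ((l - i : ℝ) * (Real.pi / k)) = -Real.sin ((i - l : ℝ) * (Real.pi / k)) := by
      rw [← Real.sin_neg]; congr 1; ring
    have e2 : Real.sin ((l - i - 1 : ℝ) * (Real.pi / k)) =
        -Real.sin ((i - l + 1 : ℝ) * (Real.pi / k)) := by
      rw [← Real.sin_neg]; congr 1; ring
    rw [e1, e2]
    nlinarith [mul_pos h5 h6]

theorem height_vertex_le (hk : 3 ≤ k) (hr : 0 < r) (P : RegularPolygon k r) (i l : ℕ) :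
    P.height i (P.vertex l) ≤ apothem k r := by
  by_cases h0 : l % k = i % k
  · rw [vertex_congr hk P h0, height_vertex_self hk]
  by_cases h1 : l % k = (i + 1) % k
  · rw [vertex_congr hk P h1, height_vertex_succ hk]
  exact (height_vertex_lt hk hr P h0 h1).le

theorem eq_or_eq_of_height_vertex_eq (hk : 3 ≤ k) (hr : 0 < r) (P : RegularPolygon k r) {i l : ℕ}
    (h : P.height i (P.vertex l) = apothem k r) : l % k = i % k ∨ l % k = (i + 1) % k := by
  by_contra! h'
  exact (height_vertex_lt hk hr P h'.1 h'.2).ne h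

/-- The triangle spanned by the center and the `j`-th edge. -/
def cell (P : RegularPolygon k r) (j : ℕ) : Set ℂ := tri P.center (P.vertex j) (P.vertex (j + 1))

theorem cell_congr (hk : 3 ≤ k) (P : RegularPolygon k r) {i j : ℕ} (h : i ≡ j [MOD k]) :
    P.cell i = P.cell j := by
  rw [cell, cell, vertex_congr hk P h, vertex_congr hk P (h.add_right 1)]

theorem cross_spokes (hk : 3 ≤ k) (P : RegularPolygon k r) (j : ℕ) :
    cross (P.vertex j - P.center) (P.vertex (j + 1) - P.center) =
      r ^ 2 * Real.sin (2 * (Real.pi / k)) := by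
  have h1 : ∀ u v : ℂ, cross u v = (starRingEnd ℂ u * v).im := by
    intro u v; simp [cross]; ring
  have hn : ‖Complex.exp (2 * Real.pi * Complex.I / k)‖ = 1 :=
    Complex.norm_eq_one_of_pow_eq_one (exp_pow_k hk) (by omega)
  have h2 : starRingEnd ℂ (P.spoke * Complex.exp (2 * Real.pi * Complex.I / k) ^ j) *
      (P.spoke * Complex.exp (2 * Real.pi * Complex.I / k) ^ j) = ((r ^ 2 : ℝ) : ℂ) := by
    rw [mul_comm, Complex.mul_conj, Complex.normSq_eq_norm_sq, norm_mul, P.norm_spoke, norm_pow, hn]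
    simp
  rw [h1, vertex_eq, vertex_eq, add_sub_cancel_left, add_sub_cancel_left, pow_succ, ← mul_assoc,
    ← mul_assoc, mul_assoc (starRingEnd ℂ _), h2, Complex.im_ofReal_mul]
  congr 1
  rw [show (2 * Real.pi * Complex.I / k : ℂ) = ((2 * (Real.pi / k) : ℝ) : ℂ) * Complex.I by
    push_cast; ring, Complex.exp_ofReal_mul_I_im]

theorem cross_spokes_pos (hk : 3 ≤ k) (hr : 0 < r) (P : RegularPolygon k r) (j : ℕ) :
    0 < cross (P.vertex j - P.center) (P.vertex (j + 1) - P.center) := by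
  rw [cross_spokes hk]
  have : (3 : ℝ) ≤ k := by exact_mod_cast hk
  exact mul_pos (by positivity) (sin_mul_pos hk two_pos (by linarith))

theorem cross_spokes_ne (hk : 3 ≤ k) (hr : 0 < r) (P : RegularPolygon k r) (j : ℕ) :
    cross (P.vertex j - P.center) (P.vertex (j + 1) - P.center) ≠ 0 :=
  (cross_spokes_pos hk hr P j).ne'

/-- Dividing the argument of `z`, seen from the center and measured from the spoke, by the central
angle `δ` gives the sector as the integer part. The identity `sin δ · e^(ix) = sin (δ - x) + sin x ·
e^(iδ)` supplies the two nonnegative coefficients. -/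
theorem exists_cone (hk : 3 ≤ k) (hr : 0 < r) (P : RegularPolygon k r) (z : ℂ) :
    ∃ j < k, ∃ a b : ℝ, 0 ≤ a ∧ 0 ≤ b ∧
      z = P.center + a * (P.vertex j - P.center) + b * (P.vertex (j + 1) - P.center) := by
  have hk0 : (0 : ℝ) < k := by exact_mod_cast (by omega : 0 < k)
  have hk3 : (3 : ℝ) ≤ k := by exact_mod_cast hk
  set δ : ℝ := 2 * (Real.pi / k) with hδ
  have hδ0 : 0 < δ := by have := Real.pi_pos; positivity
  have hkδ : k * δ = 2 * Real.pi := by rw [hδ]; field_simp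
  have hδpi : δ < Real.pi := by nlinarith [Real.pi_pos]
  set w := (z - P.center) / P.spoke with hw
  have hz : z = P.center + P.spoke * w := by
    rw [hw, mul_div_cancel₀ _ (spoke_ne_zero hr P)]; ring
  obtain ⟨φ, ρ, hρ, hφ0, hφ1, hφ⟩ : ∃ φ ρ : ℝ, 0 ≤ ρ ∧ 0 ≤ φ ∧ φ < 2 * Real.pi ∧
      w = ρ * Complex.exp (φ * Complex.I) := by
    rcases le_or_gt 0 w.arg with h | h
    · exact ⟨w.arg, ‖w‖, norm_nonneg _, h, by linarith [Complex.arg_le_pi w, Real.pi_pos],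
        (Complex.norm_mul_exp_arg_mul_I w).symm⟩
    · refine ⟨w.arg + 2 * Real.pi, ‖w‖, norm_nonneg _, by linarith [Complex.neg_pi_lt_arg w, Real.pi_pos],
        by linarith, ?_⟩
      push_cast
      rw [add_mul, Complex.exp_add, Complex.exp_two_pi_mul_I, mul_one]
      exact (Complex.norm_mul_exp_arg_mul_I w).symm
  set j := ⌊φ / δ⌋₊ with hj
  have hj1 : j * δ ≤ φ := (le_div_iff₀ hδ0).1 (Nat.floor_le (by positivity))
  have hj2 : φ < (j + 1) * δ := (div_lt_iff₀ hδ0).1 (Nat.lt_floor_add_one _)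
  have hjk : j < k := by
    have : (j : ℝ) * δ < k * δ := by linarith
    exact_mod_cast lt_of_mul_lt_mul_right this hδ0.le
  set x := φ - j * δ with hx
  have hx0 : 0 ≤ x := by linarith
  have hx1 : x < δ := by linarith
  have hs : 0 < Real.sin δ := Real.sin_pos_of_pos_of_lt_pi hδ0 hδpi
  have hζ : Complex.exp (2 * Real.pi * Complex.I / k) = Complex.exp (δ * Complex.I) := by
    congr 1; rw [hδ]; push_cast; ring
  have key : (Real.sin δ : ℂ) * Complex.exp (x * Complex.I) =
      Real.sin (δ - x) + Real.sin x * Complex.exp (δ * Complex.I) := by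
    apply Complex.ext
    · rw [Complex.re_ofReal_mul, Complex.add_re, Complex.re_ofReal_mul, Complex.ofReal_re,
        Complex.exp_ofReal_mul_I_re, Complex.exp_ofReal_mul_I_re, Real.sin_sub]
      ring
    · rw [Complex.im_ofReal_mul, Complex.add_im, Complex.im_ofReal_mul, Complex.ofReal_im,
        Complex.exp_ofReal_mul_I_im, Complex.exp_ofReal_mul_I_im]
      ring
  have hφx : Complex.exp (φ * Complex.I) =
      Complex.exp (δ * Complex.I) ^ j * Complex.exp (x * Complex.I) := by
    rw [← Complex.exp_nat_mul, ← Complex.exp_add, hx]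
    congr 1; push_cast; ring
  refine ⟨j, hjk, ρ * (Real.sin (δ - x) / Real.sin δ), ρ * (Real.sin x / Real.sin δ), ?_, ?_, ?_⟩
  · have := Real.sin_nonneg_of_nonneg_of_le_pi (x := δ - x) (by linarith) (by linarith)
    positivity
  · have := Real.sin_nonneg_of_nonneg_of_le_pi (x := x) hx0 (by linarith)
    positivity
  · have hs' : (Real.sin δ : ℂ) ≠ 0 := by exact_mod_cast hs.ne'
    rw [hz, vertex_eq, vertex_eq, hζ, hφ, hφx]
    have hxe : Complex.exp (x * Complex.I) = (Real.sin (δ - x) : ℂ) / Real.sin δ +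
        Real.sin x / Real.sin δ * Complex.exp (δ * Complex.I) := by
      rw [div_mul_eq_mul_div, ← add_div, eq_div_iff hs', ← key, mul_comm]
    rw [hxe]
    simp only [Complex.ofReal_mul, Complex.ofReal_div]
    ring
end RegularPolygon

/-! ### The solid polygon, its cells and its boundary. -/

namespace RegularPolygon

variable {k : ℕ} {r : ℝ}

theorem vertex_mem_region (P : RegularPolygon k r) (j : ℕ) : P.vertex j ∈ P.region :=
  subset_convexHull ℝ _ ⟨j, rfl⟩

theorem convex_region (P : RegularPolygon k r) : Convex ℝ P.region := convex_convexHull ℝ _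

/-- The center is the mean of the vertices, because the `k`-th roots of unity sum to zero. -/
theorem center_mem_region (hk : 3 ≤ k) (P : RegularPolygon k r) : P.center ∈ P.region := by
  have hk0 : (k : ℂ) ≠ 0 := by exact_mod_cast (by omega : k ≠ 0)
  have hsum : ∑ j ∈ Finset.range k, ((k : ℝ)⁻¹) • P.vertex j = P.center := by
    simp_rw [vertex_eq, smul_add, Finset.sum_add_distrib]
    rw [← Finset.smul_sum, ← Finset.smul_sum, ← Finset.mul_sum,
      (Complex.isPrimitiveRoot_exp k (by omega)).geom_sum_eq_zero (by omega)]
    simp [hk0]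
  rw [← hsum]
  refine P.convex_region.sum_mem (fun _ _ => by positivity) ?_ fun j _ => P.vertex_mem_region j
  have : (k : ℝ) ≠ 0 := by exact_mod_cast (by omega : k ≠ 0)
  simp [this]

theorem height_le (hk : 3 ≤ k) (hr : 0 < r) (P : RegularPolygon k r) (i : ℕ) {z : ℂ}
    (hz : z ∈ P.region) : P.height i z ≤ apothem k r := by
  have hc : Convex ℝ {z | P.height i z ≤ apothem k r} := by
    intro x hx y hy a b ha hb hab
    have h := height_lineMap P i x y b
    have e : AffineMap.lineMap x y b = a • x + b • y := by
      rw [AffineMap.lineMap_apply_module]; congr 2; linarith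
    rw [e] at h
    have hx : P.height i x ≤ apothem k r := hx
    have hy : P.height i y ≤ apothem k r := hy
    change P.height i (a • x + b • y) ≤ apothem k r
    rw [h]
    have := mul_le_mul_of_nonneg_left hx ha
    have := mul_le_mul_of_nonneg_left hy hb
    obtain rfl : a = 1 - b := by linarith
    linarith
  exact convexHull_min (by rintro _ ⟨l, rfl⟩; exact height_vertex_le hk hr P i l) hc hz

theorem cell_subset_region (hk : 3 ≤ k) (P : RegularPolygon k r) (j : ℕ) : P.cell j ⊆ P.region := by
  refine convexHull_min ?_ P.convex_region
  rintro _ (rfl | rfl | rfl)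
  exacts [center_mem_region hk P, P.vertex_mem_region _, P.vertex_mem_region _]

theorem mem_cell_iff (hk : 3 ≤ k) (hr : 0 < r) (P : RegularPolygon k r) (j : ℕ) {z : ℂ} :
    z ∈ P.cell j ↔ ∃ a b : ℝ, 0 ≤ a ∧ 0 ≤ b ∧ a + b ≤ 1 ∧
      z = P.center + a * (P.vertex j - P.center) + b * (P.vertex (j + 1) - P.center) := by
  have h := cross_spokes_ne hk hr P j
  rw [cell, mem_tri h]
  constructor
  · rintro ⟨h1, h2, h3⟩
    have h4 := bary_sum h z
    have h5 := bary_combination h z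
    refine ⟨_, _, h2, h3, by linarith, ?_⟩
    have h6 : bary P.center (P.vertex j) (P.vertex (j + 1)) z =
      1 - bary (P.vertex j) (P.vertex (j + 1)) P.center z -
        bary (P.vertex (j + 1)) P.center (P.vertex j) z := by
      linarith
    conv_lhs => rw [← h5, h6]
    simp only [Complex.real_smul]
    push_cast; ring
  · rintro ⟨a, b, ha, hb, hab, rfl⟩
    have e : P.center + a * (P.vertex j - P.center) + b * (P.vertex (j + 1) - P.center) =
        (1 - a - b) • P.center + a • P.vertex j + b • P.vertex (j + 1) := by
      simp only [Complex.real_smul]; push_cast; ring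
    rw [← mem_tri h, e]
    have hc := convex_tri P.center (P.vertex j) (P.vertex (j + 1))
    have := hc.sum_mem (t := Finset.univ) (w := ![1 - a - b, a, b])
      (z := ![P.center, P.vertex j, P.vertex (j + 1)])
      (by intro i _; fin_cases i <;> simp <;> linarith)
      (by simp only [Fin.sum_univ_three, Matrix.cons_val]; ring)
      (by intro i _; fin_cases i <;> exact subset_convexHull ℝ _ (by simp))
    simpa [Fin.sum_univ_three] using this

/-- In the sector over the `j`-th edge, `height j` equals `a + b` times the apothem, so the
half-plane condition of that edge says exactly `a + b ≤ 1`. -/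
theorem region_eq (hk : 3 ≤ k) (hr : 0 < r) (P : RegularPolygon k r) :
    P.region = ⋃ j < k, P.cell j := by
  apply Subset.antisymm
  · intro z hz
    obtain ⟨j, hj, a, b, ha, hb, e⟩ := exists_cone hk hr P z
    have h1 := height_le hk hr P j hz
    rw [e, height_combination, height_vertex_self hk, height_vertex_succ hk] at h1
    have h2 := apothem_pos hk hr
    simp only [mem_iUnion]
    refine ⟨j, hj, (mem_cell_iff hk hr P j).2 ⟨a, b, ha, hb, ?_, e⟩⟩
    by_contra! h3
    nlinarith
  · exact iUnion₂_subset fun j _ => P.cell_subset_region hk j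

theorem isCompact_region (hk : 3 ≤ k) (hr : 0 < r) (P : RegularPolygon k r) :
    IsCompact P.region := by
  rw [region_eq hk hr]
  exact (finite_lt_nat k).isCompact_biUnion fun j _ => isCompact_tri _ _ _

theorem isClosed_cell (P : RegularPolygon k r) (j : ℕ) : IsClosed (P.cell j) :=
  (isCompact_tri _ _ _).isClosed

theorem isClosed_region (hk : 3 ≤ k) (hr : 0 < r) (P : RegularPolygon k r) : IsClosed P.region :=
  (isCompact_region hk hr P).isClosed

theorem nonempty_interior_cell (hk : 3 ≤ k) (hr : 0 < r) (P : RegularPolygon k r) (j : ℕ) :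
    (interior (P.cell j)).Nonempty :=
  nonempty_interior_tri (cross_spokes_ne hk hr P j)

theorem nonempty_interior_region (hk : 3 ≤ k) (hr : 0 < r) (P : RegularPolygon k r) :
    (interior P.region).Nonempty :=
  (nonempty_interior_cell hk hr P 0).mono (interior_mono (cell_subset_region hk P 0))

theorem height_eq_of_mem_edge (hk : 3 ≤ k) (P : RegularPolygon k r) {i : ℕ} {z : ℂ}
    (hz : z ∈ P.edge i) : P.height i z = apothem k r := by
  rw [edge, segment_eq_image_lineMap] at hz
  obtain ⟨s, -, rfl⟩ := hz
  rw [height_lineMap, height_vertex_self hk, height_vertex_succ hk]; ring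

theorem edge_subset_region (P : RegularPolygon k r) (i : ℕ) : P.edge i ⊆ P.region :=
  P.convex_region.segment_subset (P.vertex_mem_region _) (P.vertex_mem_region _)

/-- A point of maximal height leaves the polygon as soon as it is pushed away from the center. -/
theorem height_lt_of_mem_interior (hk : 3 ≤ k) (hr : 0 < r) (P : RegularPolygon k r) {i : ℕ} {z : ℂ}
    (hz : z ∈ interior P.region) : P.height i z < apothem k r := by
  refine (height_le hk hr P i (interior_subset hz)).lt_of_ne fun h => ?_
  have hc : Continuous fun t : ℝ => (AffineMap.lineMap P.center z (1 + t) : ℂ) :=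
    AffineMap.lineMap_continuous.comp (by fun_prop)
  have h2 : ∀ᶠ t in 𝓝[>] (0 : ℝ), AffineMap.lineMap P.center z (1 + t) ∈ P.region :=
    (hc.continuousAt.tendsto.mono_left nhdsWithin_le_nhds).eventually
      (by simpa using mem_interior_iff_mem_nhds.1 hz)
  obtain ⟨t, ht, ht0⟩ := (h2.and self_mem_nhdsWithin).exists
  have h3 := height_le hk hr P i ht
  rw [height_lineMap, height_center, h] at h3
  have : 0 < t := ht0
  nlinarith [apothem_pos hk hr]

theorem edge_subset_frontier (hk : 3 ≤ k) (hr : 0 < r) (P : RegularPolygon k r) (i : ℕ) :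
    P.edge i ⊆ frontier P.region := by
  intro z hz
  rw [(isClosed_region hk hr P).frontier_eq]
  exact ⟨P.edge_subset_region i hz, fun h =>
    (height_lt_of_mem_interior hk hr P h).ne (height_eq_of_mem_edge hk P hz)⟩

theorem mem_edge_of_add_eq_one (P : RegularPolygon k r) {j : ℕ} {a b : ℝ} (ha : 0 ≤ a)
    (hb : 0 ≤ b) (hab : a + b = 1) :
    P.center + a * (P.vertex j - P.center) + b * (P.vertex (j + 1) - P.center) ∈ P.edge j := by
  refine ⟨a, b, ha, hb, hab, ?_⟩
  obtain rfl : a = 1 - b := by linarith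
  simp only [Complex.real_smul]; push_cast; ring

theorem frontier_region (hk : 3 ≤ k) (hr : 0 < r) (P : RegularPolygon k r) :
    frontier P.region = ⋃ i < k, P.edge i := by
  have hpos := apothem_pos hk hr
  apply Subset.antisymm
  · intro z hz
    rw [(isClosed_region hk hr P).frontier_eq] at hz
    obtain ⟨hz, hi⟩ := hz
    have hz' := hz
    rw [region_eq hk hr] at hz'
    simp only [mem_iUnion] at hz' ⊢
    obtain ⟨j, hj, hz'⟩ := hz'
    obtain ⟨a, b, ha, hb, hab, e⟩ := (mem_cell_iff hk hr P j).1 hz'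
    rcases hab.eq_or_lt with hab | hab
    · exact ⟨j, hj, e ▸ mem_edge_of_add_eq_one P ha hb hab⟩
    · refine absurd ?_ hi
      -- With `a + b < 1`, all half-plane conditions hold strictly at `z`, and the strict conditions
      -- define an open set contained in the polygon.
      have hlt : ∀ i, P.height i z < apothem k r := by
        intro i
        rw [e, height_combination]
        have h1 := mul_le_mul_of_nonneg_left (height_vertex_le hk hr P i j) ha
        have h2 := mul_le_mul_of_nonneg_left (height_vertex_le hk hr P i (j + 1)) hb
        nlinarith
      have ho : IsOpen (⋂ i ∈ {i | i < k}, {w | P.height i w < apothem k r}) :=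
        (finite_lt_nat k).isOpen_biInter fun i _ =>
          isOpen_lt (continuous_height P i) continuous_const
      refine interior_maximal ?_ ho (by simpa using fun i _ => hlt i)
      intro w hw
      simp only [mem_ofPred_eq, mem_iInter] at hw
      obtain ⟨l, hl, a', b', ha', hb', e'⟩ := exists_cone hk hr P w
      have h1 := hw l hl
      rw [e', height_combination, height_vertex_self hk, height_vertex_succ hk] at h1
      refine cell_subset_region hk P l ((mem_cell_iff hk hr P l).2 ⟨a', b', ha', hb', ?_, e'⟩)
      by_contra! h3
      nlinarith
  · exact iUnion₂_subset fun j _ => edge_subset_frontier hk hr P j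

/-- A linear functional attains its maximum on a face: the weight of the center must vanish, and
every vertex of positive weight is an end of the edge `i`. -/
theorem mem_edge_of_height_eq (hk : 3 ≤ k) (hr : 0 < r) (P : RegularPolygon k r) {i : ℕ} {z : ℂ}
    (hz : z ∈ P.region) (h : P.height i z = apothem k r) : z ∈ P.edge i := by
  have hpos := apothem_pos hk hr
  rw [region_eq hk hr] at hz
  simp only [mem_iUnion] at hz
  obtain ⟨j, hj, hz⟩ := hz
  obtain ⟨a, b, ha, hb, hab, e⟩ := (mem_cell_iff hk hr P j).1 hz
  rw [e, height_combination] at h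
  have h1 := height_vertex_le hk hr P i j
  have h2 := height_vertex_le hk hr P i (j + 1)
  have hab1 : a + b = 1 := by
    refine hab.antisymm ?_
    by_contra! h3
    nlinarith [mul_le_mul_of_nonneg_left h1 ha, mul_le_mul_of_nonneg_left h2 hb]
  have hmem : ∀ l, P.height i (P.vertex l) = apothem k r → P.vertex l ∈ P.edge i := by
    intro l hl
    rcases eq_or_eq_of_height_vertex_eq hk hr P hl with h | h
    · rw [vertex_congr hk P h]; exact left_mem_segment _ _ _
    · rw [vertex_congr hk P h]; exact right_mem_segment _ _ _
  have hA : a = 0 ∨ P.vertex j ∈ P.edge i := by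
    by_contra! hh
    have := h1.lt_of_ne fun h' => hh.2 (hmem _ h')
    have ha' := ha.lt_of_ne' hh.1
    nlinarith [mul_le_mul_of_nonneg_left h2 hb]
  have hB : b = 0 ∨ P.vertex (j + 1) ∈ P.edge i := by
    by_contra! hh
    have := h2.lt_of_ne fun h' => hh.2 (hmem _ h')
    have hb' := hb.lt_of_ne' hh.1
    nlinarith [mul_le_mul_of_nonneg_left h1 ha]
  rcases hA with rfl | hA
  · obtain rfl : b = 1 := by linarith
    rw [e]; simpa using hB
  rcases hB with rfl | hB
  · obtain rfl : a = 1 := by linarith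
    rw [e]; simpa using hA
  have hc : Convex ℝ (P.edge i) := convex_segment _ _
  have := hc hA hB ha hb hab1
  rw [e]
  convert this using 1
  obtain rfl : a = 1 - b := by linarith
  simp only [Complex.real_smul]; push_cast; ring

theorem vertex_inj (hk : 3 ≤ k) (hr : 0 < r) (P : RegularPolygon k r) {i j : ℕ}
    (h : P.vertex i = P.vertex j) : i ≡ j [MOD k] := by
  rw [vertex_eq, vertex_eq, add_right_inj, mul_right_inj' (spoke_ne_zero hr P)] at h
  have h1 := Complex.isPrimitiveRoot_exp k (by omega)
  rw [← pow_mod_orderOf, ← pow_mod_orderOf (n := j), h1.eq_orderOf.symm] at h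
  exact h1.pow_inj (Nat.mod_lt _ (by omega)) (Nat.mod_lt _ (by omega)) h

theorem not_modEq_succ (hk : 3 ≤ k) (i : ℕ) : ¬ i ≡ i + 1 [MOD k] := by
  intro h
  have := (Nat.ModEq.add_left_cancel' i (show i + 0 ≡ i + 1 [MOD k] from h))
  rw [Nat.ModEq, Nat.zero_mod, Nat.mod_eq_of_lt (by omega)] at this
  omega

theorem vertex_ne_vertex_succ (hk : 3 ≤ k) (hr : 0 < r) (P : RegularPolygon k r) (i : ℕ) :
    P.vertex i ≠ P.vertex (i + 1) := fun h => not_modEq_succ hk i (vertex_inj hk hr P h)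

theorem height_lineMap_edge (hk : 3 ≤ k) (hr : 0 < r) (P : RegularPolygon k r) {i j : ℕ} {s : ℝ}
    (hs : s ∈ Ico (0 : ℝ) 1)
    (h : P.height i (AffineMap.lineMap (P.vertex j) (P.vertex (j + 1)) s) = apothem k r) :
    i ≡ j [MOD k] ∨ (s = 0 ∧ j ≡ i + 1 [MOD k]) := by
  rw [height_lineMap] at h
  have h1 := height_vertex_le hk hr P i j
  have h2 := height_vertex_le hk hr P i (j + 1)
  obtain ⟨hs0, hs1⟩ := hs
  have h3 : P.height i (P.vertex j) = apothem k r := by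
    by_contra hne
    have := h1.lt_of_ne hne
    nlinarith [mul_le_mul_of_nonneg_left h2 hs0]
  rcases eq_or_eq_of_height_vertex_eq hk hr P h3 with h4 | h4
  · exact Or.inl h4.symm
  rcases hs0.eq_or_lt with rfl | hs0
  · exact Or.inr ⟨rfl, h4⟩
  have h5 : P.height i (P.vertex (j + 1)) = apothem k r := by nlinarith
  rcases eq_or_eq_of_height_vertex_eq hk hr P h5 with h6 | h6
  · exfalso
    have h7 : (i + 1) + 1 ≡ i [MOD k] := (Nat.ModEq.add_right 1 h4).symm.trans h6
    have := Nat.ModEq.add_left_cancel' i (show i + 2 ≡ i + 0 [MOD k] from h7)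
    rw [Nat.ModEq, Nat.zero_mod, Nat.mod_eq_of_lt (by omega)] at this
    omega
  · exact Or.inl (Nat.ModEq.add_right_cancel' 1 h6).symm

theorem lineMap_edge_inj (hk : 3 ≤ k) (hr : 0 < r) (P : RegularPolygon k r) {i j : ℕ} {s t : ℝ}
    (hs : s ∈ Ico (0 : ℝ) 1) (ht : t ∈ Ico (0 : ℝ) 1)
    (h : AffineMap.lineMap (P.vertex i) (P.vertex (i + 1)) s =
      AffineMap.lineMap (P.vertex j) (P.vertex (j + 1)) t) : i ≡ j [MOD k] ∧ s = t := by
  have hmem : ∀ (i : ℕ), ∀ s ∈ Ico (0 : ℝ) 1,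
      AffineMap.lineMap (P.vertex i) (P.vertex (i + 1)) s ∈ P.edge i := fun i s hs => by
    rw [edge, segment_eq_image_lineMap]; exact ⟨s, ⟨hs.1, hs.2.le⟩, rfl⟩
  have hij : i ≡ j [MOD k] := by
    have h1 := height_lineMap_edge hk hr P (i := i) ht
      (h ▸ height_eq_of_mem_edge hk P (hmem i s hs))
    have h2 := height_lineMap_edge hk hr P (i := j) hs
      (h ▸ height_eq_of_mem_edge hk P (hmem j t ht))
    rcases h1 with h1 | ⟨rfl, h1⟩
    · exact h1
    rcases h2 with h2 | ⟨rfl, h2⟩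
    · exact h2.symm
    · rw [AffineMap.lineMap_apply_zero, AffineMap.lineMap_apply_zero] at h
      exact vertex_inj hk hr P h
  refine ⟨hij, ?_⟩
  rw [vertex_congr hk P hij, vertex_congr hk P (hij.add_right 1)] at h
  exact AffineMap.lineMap_injective ℝ (vertex_ne_vertex_succ hk hr P j) h

theorem exists_simplePolygon (hk : 3 ≤ k) (hr : 0 < r) (P : RegularPolygon k r) :
    ∃ Q : SimplePolygon, Q.region = P.region ∧ ∀ i < k, Q.HasEdge (P.vertex i) (P.vertex (i + 1)) := by
  have hcycle : IsSimpleCycle (k - 1) P.vertex := by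
    refine ⟨?_, ?_⟩
    · rw [show k - 1 + 1 = 0 + k by omega, vertex_add_k hk]
    · intro i hi j hj s hs t ht h
      obtain ⟨h1, h2⟩ := lineMap_edge_inj hk hr P hs ht h
      exact ⟨Nat.ModEq.eq_of_lt_of_lt h1 (by omega) (by omega), h2⟩
  have hfr : frontier P.region = ⋃ i ≤ k - 1, segment ℝ (P.vertex i) (P.vertex (i + 1)) := by
    rw [frontier_region hk hr]
    ext z
    simp only [mem_iUnion, edge]
    constructor
    · rintro ⟨i, hi, h⟩; exact ⟨i, by omega, h⟩
    · rintro ⟨i, hi, h⟩; exact ⟨i, by omega, h⟩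
  obtain ⟨Q, hQ, he⟩ := SimplePolygon.exists_of_isSimpleCycle (by omega) hcycle
    (isCompact_region hk hr P) (nonempty_interior_region hk hr P) hfr
  exact ⟨Q, hQ, fun i hi => he i (by omega)⟩

/-- Over the cell of an edge, the height belonging to that edge dominates all others; this
comparison is what tells the cells apart. -/
theorem height_le_of_mem_cell (hk : 3 ≤ k) (hr : 0 < r) (P : RegularPolygon k r) {j : ℕ} (i : ℕ)
    {z : ℂ} (hz : z ∈ P.cell j) : P.height i z ≤ P.height j z := by
  obtain ⟨a, b, ha, hb, -, rfl⟩ := (mem_cell_iff hk hr P j).1 hz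
  rw [height_combination, height_combination, height_vertex_self hk, height_vertex_succ hk]
  have := mul_le_mul_of_nonneg_left (height_vertex_le hk hr P i j) ha
  have := mul_le_mul_of_nonneg_left (height_vertex_le hk hr P i (j + 1)) hb
  linarith

/-- At a common point the heights `i` and `j` agree. If it is interior to the cell `j`, both ends of
the edge `j` have positive weight and so also have maximal height `i`, which makes the two edges
equal. -/
theorem interior_cell_inter_cell (hk : 3 ≤ k) (hr : 0 < r) (P : RegularPolygon k r) {i j : ℕ}
    (hij : ¬ i ≡ j [MOD k]) : interior (P.cell i ∩ P.cell j) = ∅ := by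
  rw [eq_empty_iff_forall_notMem]
  intro z hz
  rw [interior_inter] at hz
  have h1 := height_le_of_mem_cell hk hr P j (interior_subset hz.1)
  have h := cross_spokes_ne hk hr P j
  obtain ⟨-, h3, h4⟩ := (mem_interior_tri h).1 hz.2
  have h5 := bary_combination h z
  have h6 := bary_sum h z
  generalize bary P.center (P.vertex j) (P.vertex (j + 1)) z = c at *
  generalize bary (P.vertex j) (P.vertex (j + 1)) P.center z = a at *
  generalize bary (P.vertex (j + 1)) P.center (P.vertex j) z = b at *
  have e : z = P.center + a * (P.vertex j - P.center) + b * (P.vertex (j + 1) - P.center) := by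
    rw [← h5]
    obtain rfl : c = 1 - a - b := by linarith
    simp only [Complex.real_smul]; push_cast; ring
  rw [e, height_combination, height_combination, height_vertex_self hk, height_vertex_succ hk] at h1
  have g1 := height_vertex_le hk hr P i j
  have g2 := height_vertex_le hk hr P i (j + 1)
  have f1 : P.height i (P.vertex j) = apothem k r := by
    by_contra hne
    nlinarith [g1.lt_of_ne hne, mul_le_mul_of_nonneg_left g2 h4.le]
  have f2 : P.height i (P.vertex (j + 1)) = apothem k r := by
    by_contra hne
    nlinarith [g2.lt_of_ne hne, mul_le_mul_of_nonneg_left g1 h3.le]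
  -- The midpoint identifies the edge: the exceptional case of `height_lineMap_edge` concerns only
  -- `s = 0`.
  have e0 : (AffineMap.lineMap (P.vertex j) (P.vertex (j + 1)) (1 / 2 : ℝ) : ℂ) ∈ P.edge i := by
    refine mem_edge_of_height_eq hk hr P (P.edge_subset_region j ?_) ?_
    · rw [edge, segment_eq_image_lineMap]
      exact ⟨1 / 2, ⟨by norm_num, by norm_num⟩, rfl⟩
    · rw [height_lineMap, f1, f2]; ring
  have e1 := height_lineMap_edge hk hr P (s := 1 / 2) ⟨by norm_num, by norm_num⟩
    (height_eq_of_mem_edge hk P e0)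
  rcases e1 with e1 | ⟨e1, -⟩
  · exact hij e1
  · norm_num at e1

theorem cell_inter_cell_succ (hk : 3 ≤ k) (hr : 0 < r) (P : RegularPolygon k r) (i : ℕ) :
    P.cell i ∩ P.cell (i + 1) = segment ℝ P.center (P.vertex (i + 1)) := by
  apply Subset.antisymm
  · rintro z ⟨h0, h1⟩
    have h2 := height_le_of_mem_cell hk hr P i h1
    obtain ⟨a, b, ha, hb, hab, rfl⟩ := (mem_cell_iff hk hr P i).1 h0
    rw [height_combination, height_combination, height_vertex_self hk, height_vertex_succ hk,
      height_vertex_self hk] at h2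
    have h3 : P.height (i + 1) (P.vertex i) < apothem k r := by
      refine height_vertex_lt hk hr P (not_modEq_succ hk i) fun h => ?_
      have := Nat.ModEq.add_left_cancel' i (show i + 0 ≡ i + 2 [MOD k] from h)
      rw [Nat.ModEq, Nat.zero_mod, Nat.mod_eq_of_lt (by omega)] at this
      omega
    obtain rfl : a = 0 := by
      by_contra hne
      nlinarith [ha.lt_of_ne' hne]
    refine ⟨1 - b, b, by linarith, hb, by ring, ?_⟩
    simp only [Complex.real_smul]; push_cast; ring
  · refine subset_inter ?_ ?_ <;>
      exact segment_subset_convexHull (by simp) (by simp)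

theorem vertex_notMem_cell (hk : 3 ≤ k) (hr : 0 < r) (P : RegularPolygon k r) {i j : ℕ}
    (h0 : ¬ i ≡ j [MOD k]) (h1 : ¬ i ≡ j + 1 [MOD k]) : P.vertex i ∉ P.cell j := by
  intro h
  obtain ⟨a, b, ha, hb, hab, e⟩ := (mem_cell_iff hk hr P j).1 h
  have h2 := height_le_of_mem_cell hk hr P i h
  rw [height_vertex_self hk] at h2
  exact absurd h2 (height_vertex_lt hk hr P h0 h1).not_ge

end RegularPolygon

/-! ### Sets that do not overlap -/

/-- The common part of `A` and `B` has no interior point. -/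
def NonOverlapping (A B : Set ℂ) : Prop := interior (A ∩ B) = ∅

namespace NonOverlapping

variable {A B C D : Set ℂ}

theorem symm (h : NonOverlapping A B) : NonOverlapping B A := by
  rwa [NonOverlapping, inter_comm]

theorem mono (h : NonOverlapping A B) (hC : C ⊆ A) (hD : D ⊆ B) : NonOverlapping C D :=
  subset_empty_iff.1 ((interior_mono (inter_subset_inter hC hD)).trans h.subset)

/-- Closedness is essential: two sets without interior points may have a union with interior points
unless one of them is closed. -/
theorem union_left (hA : NonOverlapping A C) (hB : NonOverlapping B C) (hcA : IsClosed A)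
    (hcC : IsClosed C) : NonOverlapping (A ∪ B) C := by
  rw [NonOverlapping, union_inter_distrib_right,
    interior_union_isClosed_of_interior_empty (hcA.inter hcC) hB]
  exact hA

theorem union_right (hA : NonOverlapping C A) (hB : NonOverlapping C B) (hcA : IsClosed A)
    (hcC : IsClosed C) : NonOverlapping C (A ∪ B) :=
  (union_left hA.symm hB.symm hcA hcC).symm

theorem biUnion_left {ι : Type*} {s : Set ι} (hs : s.Finite) {f : ι → Set ℂ}
    (hf : ∀ i ∈ s, IsClosed (f i)) (hC : IsClosed C) (h : ∀ i ∈ s, NonOverlapping (f i) C) :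
    NonOverlapping (⋃ i ∈ s, f i) C := by
  induction s, hs using Set.Finite.induction_on with
  | empty => simp [NonOverlapping]
  | @insert a s ha hs ih =>
    rw [biUnion_insert]
    exact union_left (h a (mem_insert _ _))
      (ih (fun i hi => hf i (mem_insert_of_mem _ hi)) fun i hi => h i (mem_insert_of_mem _ hi))
      (hf a (mem_insert _ _)) hC

theorem disjoint_interior (h : NonOverlapping A B) : Disjoint (interior A) (interior B) := by
  rw [disjoint_iff_inter_eq_empty, ← interior_inter]; exact h

end NonOverlapping

/-! ### Rigid motions -/

namespace RigidMotion

/-- A rigid motion as an affine map. -/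
noncomputable def toAffine (g : RigidMotion) : ℂ →ᵃ[ℝ] ℂ :=
  (LinearMap.mulLeft ℝ (g.1 : ℂ)).toAffineMap + AffineMap.const ℝ ℂ g.2

theorem toAffine_apply (g : RigidMotion) (z : ℂ) : g.toAffine z = g.act z := by
  simp [toAffine, act]

theorem image_convexHull (g : RigidMotion) (s : Set ℂ) :
    g.act '' convexHull ℝ s = convexHull ℝ (g.act '' s) := by
  have := g.toAffine.image_convexHull s
  simpa only [funext g.toAffine_apply] using this

theorem image_tri (g : RigidMotion) (a b c : ℂ) :
    g.act '' tri a b c = tri (g.act a) (g.act b) (g.act c) := by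
  rw [tri, tri, image_convexHull]
  simp [image_insert_eq]

/-- First `h`, then `g`. -/
noncomputable def comp (g h : RigidMotion) : RigidMotion := (g.1 * h.1, g.1 * h.2 + g.2)

theorem comp_act (g h : RigidMotion) (z : ℂ) : (g.comp h).act z = g.act (h.act z) := by
  simp [comp, act]; ring

/-- The rotation about `p`. -/
noncomputable def rotation (p : ℂ) (u : Circle) : RigidMotion := (u, p - u * p)

theorem rotation_act_self (p : ℂ) (u : Circle) : (rotation p u).act p = p := by
  simp [rotation, act]

theorem rotation_one (p : ℂ) : rotation p 1 = (1, 0) := by simp [rotation]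

theorem comp_one (g : RigidMotion) : g.comp (1, 0) = g := by simp [comp]

/-- Two motions that agree at `p` differ by a rotation about `p`. The rotation acts first, so its
center is a point of the initial drawing, and a real angle `θ` is provided so that it can be scaled
with time. -/
theorem exists_comp_rotation {g h : RigidMotion} {p : ℂ} (e : g.act p = h.act p) :
    ∃ θ : ℝ, h = g.comp (rotation p (Circle.exp θ)) := by
  refine ⟨((g.1⁻¹ * h.1 : Circle) : ℂ).arg, ?_⟩
  rw [Circle.exp_arg]
  simp only [act] at e
  apply Prod.ext
  · simp [comp, rotation]
  · simp only [comp, rotation, Circle.coe_mul, Circle.coe_inv]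
    have : (g.1 : ℂ) ≠ 0 := Circle.coe_ne_zero _
    field_simp
    linear_combination -e

end RigidMotion

/-! ### Moving, reflecting and relabeling polygons. -/

namespace RegularPolygon

variable {k : ℕ} {r : ℝ}

@[ext] theorem ext {P Q : RegularPolygon k r} (h1 : P.center = Q.center) (h2 : P.spoke = Q.spoke) :
    P = Q := by
  cases P; cases Q; cases h1; cases h2; rfl

/-- The image under a rigid motion. -/
noncomputable def move (P : RegularPolygon k r) (g : RigidMotion) : RegularPolygon k r where
  center := g.act P.center
  spoke := g.1 * P.spoke
  norm_spoke := by rw [norm_mul, P.norm_spoke, Circle.norm_coe, one_mul]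

theorem vertex_move (P : RegularPolygon k r) (g : RigidMotion) (j : ℕ) :
    (P.move g).vertex j = g.act (P.vertex j) := by
  simp [move, vertex, RigidMotion.act]; ring

theorem image_region (P : RegularPolygon k r) (g : RigidMotion) :
    g.act '' P.region = (P.move g).region := by
  rw [region, region, RigidMotion.image_convexHull, ← range_comp]
  congr 2
  exact (funext fun j => (vertex_move P g j)).symm

theorem image_cell (P : RegularPolygon k r) (g : RigidMotion) (j : ℕ) :
    g.act '' P.cell j = (P.move g).cell j := by
  rw [cell, cell, RigidMotion.image_tri, vertex_move, vertex_move]; rfl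

theorem exists_move (hr : 0 < r) (P Q : RegularPolygon k r) : ∃ g, P.move g = Q := by
  have h : Q.spoke / P.spoke ∈ Submonoid.unitSphere ℂ := by
    rw [Submonoid.unitSphere, ← SetLike.mem_coe]
    simp [Q.norm_spoke, P.norm_spoke, hr.ne']
  have h0 := spoke_ne_zero hr P
  refine ⟨(⟨_, h⟩, Q.center - Q.spoke / P.spoke * P.center), ?_⟩
  ext1
  · simp [move, RigidMotion.act]
  · simp [move, h0]

/-- The mirror image in the midpoint of the edge `0`. -/
noncomputable def flip (P : RegularPolygon k r) : RegularPolygon k r where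
  center := P.vertex 0 + P.vertex 1 - P.center
  spoke := -P.spoke
  norm_spoke := by rw [norm_neg, P.norm_spoke]

theorem vertex_flip (P : RegularPolygon k r) (j : ℕ) :
    P.flip.vertex j = P.vertex 0 + P.vertex 1 - P.vertex j := by
  simp only [vertex, flip]; ring

theorem flip_move (P : RegularPolygon k r) (g : RigidMotion) :
    (P.move g).flip = P.flip.move g := by
  ext1
  · change (P.move g).vertex 0 + (P.move g).vertex 1 - g.act P.center = g.act P.flip.center
    simp only [flip, vertex_move, RigidMotion.act]; ring
  · simp [flip, move]

theorem height_flip (P : RegularPolygon k r) (z : ℂ) :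
    P.flip.height 0 z = P.height 0 (P.vertex 0) + P.height 0 (P.vertex 1) - P.height 0 z := by
  simp only [height, flip]
  rw [← Complex.add_re, ← Complex.sub_re]
  congr 1
  simp only [neg_mul, map_neg]
  ring

/-- The heights over the edge `0` with respect to the polygon and to its mirror image add up to
twice the apothem, so both can be at most the apothem only if both are equal to it. -/
theorem region_inter_flip (hk : 3 ≤ k) (hr : 0 < r) (P : RegularPolygon k r) :
    P.region ∩ P.flip.region = P.edge 0 := by
  apply Subset.antisymm
  · rintro z ⟨h1, h2⟩
    have h3 := height_le hk hr P 0 h1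
    have h4 := height_le hk hr P.flip 0 h2
    rw [height_flip, height_vertex_self hk, height_vertex_succ hk] at h4
    exact mem_edge_of_height_eq hk hr P h1 (by linarith)
  · refine subset_inter (P.edge_subset_region 0) ?_
    have : P.edge 0 = P.flip.edge 0 := by
      simp only [edge, vertex_flip, zero_add]
      rw [segment_symm]; congr 1 <;> ring
    rw [this]
    exact P.flip.edge_subset_region 0

/-- The vertices agree up to a cyclic shift. -/
def IsShift (P Q : RegularPolygon k r) : Prop := ∃ o, ∀ j, P.vertex j = Q.vertex (j + o)

theorem IsShift.region_eq (hk : 3 ≤ k) {P Q : RegularPolygon k r} (h : P.IsShift Q) :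
    P.region = Q.region := by
  obtain ⟨o, ho⟩ := h
  rw [region, region]
  congr 1
  apply Subset.antisymm
  · rintro _ ⟨j, rfl⟩; exact ⟨_, (ho j).symm⟩
  · rintro _ ⟨j, rfl⟩
    -- `o * (k - 1)` represents `-o` modulo `k`; the same device replaces subtraction of indices
    -- further below.
    refine ⟨j + o * (k - 1), ?_⟩
    rw [ho]
    apply vertex_congr hk
    rw [add_assoc, ← Nat.mul_succ, show (k - 1).succ = k by omega]
    simp [Nat.ModEq]

theorem exists_isShift (hk : 3 ≤ k) (P : RegularPolygon k r) (h b : ℕ) :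
    ∃ Q : RegularPolygon k r, Q.IsShift P ∧ ∀ i, Q.vertex (h + i) = P.vertex (b + i) := by
  have hn : ‖Complex.exp (2 * Real.pi * Complex.I / k)‖ = 1 :=
    Complex.norm_eq_one_of_pow_eq_one (exp_pow_k hk) (by omega)
  let o := b + h * (k - 1)
  let Q : RegularPolygon k r := ⟨P.center, P.spoke * Complex.exp (2 * Real.pi * Complex.I / k) ^ o,
    by rw [norm_mul, P.norm_spoke, norm_pow, hn, one_pow, mul_one]⟩
  have hQ : ∀ j, Q.vertex j = P.vertex (j + o) := by
    intro j
    rw [vertex_eq, vertex_eq]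
    simp only [Q]
    rw [pow_add]; ring
  refine ⟨Q, ⟨o, hQ⟩, fun i => ?_⟩
  rw [hQ]
  apply vertex_congr hk
  rw [show h + i + o = b + i + (h + h * (k - 1)) by simp only [o]; ring, Nat.add_comm h,
    ← Nat.mul_succ, show (k - 1).succ = k by omega]
  simp [Nat.ModEq]

/-- The edge vector is the spoke at its first vertex times `ζ - 1` with `ζ` a primitive `k`-th root
of unity. It therefore determines the spoke, and then the center. -/
theorem vertex_eq_of_consecutive (hk : 3 ≤ k) {P Q : RegularPolygon k r} {a b : ℕ}
    (h0 : P.vertex a = Q.vertex b) (h1 : P.vertex (a + 1) = Q.vertex (b + 1)) :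
    P.center = Q.center ∧ ∀ i, P.vertex (a + i) = Q.vertex (b + i) := by
  have hζ : Complex.exp (2 * Real.pi * Complex.I / k) - 1 ≠ 0 :=
    sub_ne_zero.2 ((Complex.isPrimitiveRoot_exp k (by omega)).ne_one (by omega))
  simp only [vertex_eq, pow_add, pow_one, ← mul_assoc] at h0 h1 ⊢
  have h2 := mul_right_cancel₀ hζ (show P.spoke * Complex.exp (2 * Real.pi * Complex.I / k) ^ a *
      (Complex.exp (2 * Real.pi * Complex.I / k) - 1) =
    Q.spoke * Complex.exp (2 * Real.pi * Complex.I / k) ^ b *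
      (Complex.exp (2 * Real.pi * Complex.I / k) - 1) by linear_combination h1 - h0)
  have h3 : P.center = Q.center := by linear_combination h0 - h2
  exact ⟨h3, fun i => by rw [h2, h3]⟩

theorem center_notMem_edge (hk : 3 ≤ k) (hr : 0 < r) (P : RegularPolygon k r) (i : ℕ) :
    P.center ∉ P.edge i := by
  intro h
  have h1 := height_eq_of_mem_edge hk P h
  rw [height_center] at h1
  exact (apothem_pos hk hr).ne h1

/-- Neighbors run through a common edge in opposite directions. -/
theorem vertex_eq_of_common_edge (hk : 3 ≤ k) (hr : 0 < r) {P Q : RegularPolygon k r} {a b : ℕ}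
    (he : P.edge a = Q.edge b) (hi : P.region ∩ Q.region = P.edge a) :
    P.vertex a = Q.vertex (b + 1) ∧ P.vertex (a + 1) = Q.vertex b := by
  refine (segment_eq_segment_iff (vertex_ne_vertex_succ hk hr P a) he).resolve_left ?_
  -- With equal directions the centers would coincide, and the common center would lie on the edge.
  rintro ⟨h0, h1⟩
  have h2 := (vertex_eq_of_consecutive hk h0 h1).1
  have : P.center ∈ P.region ∩ Q.region :=
    ⟨center_mem_region hk P, h2 ▸ center_mem_region hk Q⟩
  rw [hi] at this
  exact center_notMem_edge hk hr P a this

theorem flip_isShift (hk : 3 ≤ k) {P Q : RegularPolygon k r} {b : ℕ}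
    (h0 : P.vertex 0 = Q.vertex (b + 1)) (h1 : P.vertex 1 = Q.vertex b) : P.flip.IsShift Q := by
  have := (vertex_eq_of_consecutive hk (P := P.flip) (Q := Q) (a := 0) (b := b)
    (by rw [vertex_flip, ← h1]; ring) (by rw [vertex_flip, ← h0]; ring)).2
  exact ⟨b, fun j => by rw [add_comm, ← this, zero_add]⟩

end RegularPolygon

/-- In each of the three cases the intersection lies in the frontier of a closed set, which has no
interior points. -/
theorem PolyRegular.nonOverlapping_tile {n k : ℕ} {r : ℝ} (hk : 3 ≤ k) (hr : 0 < r)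
    (F : PolyRegular n k r) {i j : Fin n} (hij : i ≠ j) :
    NonOverlapping (F.tile i).region (F.tile j).region := by
  have h : (F.tile i).region ∩ (F.tile j).region ⊆ frontier (F.tile i).region := by
    rcases F.inter_tile i j hij with h | ⟨a, b, -, h⟩ | ⟨a, b, -, h⟩ <;> rw [h]
    · exact empty_subset _
    · exact singleton_subset_iff.2
        (RegularPolygon.edge_subset_frontier hk hr _ a (left_mem_segment _ _ _))
    · exact RegularPolygon.edge_subset_frontier hk hr _ a
  have h1 := interior_mono h
  rw [interior_frontier (RegularPolygon.isClosed_region hk hr _)] at h1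
  exact subset_empty_iff.1 h1

/-! ### The pieces -/

/-- The index of the vertex at which the `j`-th piece of a regular `k`-gon is hinged to the next
one. -/
def hingeIndex (k j : ℕ) : ℕ := min (2 * j + 2) k

namespace RegularPolygon

variable {k : ℕ} {r : ℝ}

/-- The part of the polygon between the center and the vertices `2 j`, …, `hingeIndex k j`. -/
def slotPiece (P : RegularPolygon k r) (j : ℕ) : Set ℂ :=
  ⋃ l ∈ Ico (2 * j) (hingeIndex k j), P.cell l

/-- The first piece together with the neighbor of the polygon across the edge `0`. -/
def rootPiece (P : RegularPolygon k r) : Set ℂ := P.slotPiece 0 ∪ P.flip.region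

theorem slotPiece_cases (P : RegularPolygon k r) {j : ℕ} (hj : j < (k + 1) / 2) :
    (2 * j + 2 ≤ k ∧ hingeIndex k j = 2 * j + 2 ∧
      P.slotPiece j = P.cell (2 * j) ∪ P.cell (2 * j + 1)) ∨
    (2 * j + 1 = k ∧ hingeIndex k j = 2 * j + 1 ∧ P.slotPiece j = P.cell (2 * j)) := by
  rcases Nat.lt_or_ge k (2 * j + 2) with h | h
  · have h1 : 2 * j + 1 = k := by omega
    have h2 : hingeIndex k j = 2 * j + 1 := by rw [hingeIndex]; omega
    refine Or.inr ⟨h1, h2, ?_⟩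
    have : Ico (2 * j) (2 * j + 1) = {2 * j} := by ext; simp; omega
    rw [slotPiece, h2, this, biUnion_singleton]
  · have h2 : hingeIndex k j = 2 * j + 2 := by rw [hingeIndex]; omega
    refine Or.inl ⟨h, h2, ?_⟩
    have : Ico (2 * j) (2 * j + 2) = {2 * j, 2 * j + 1} := by ext; simp; omega
    rw [slotPiece, h2, this, biUnion_pair]

theorem isClosed_slotPiece (P : RegularPolygon k r) (j : ℕ) : IsClosed (P.slotPiece j) :=
  (finite_Ico _ _).isClosed_biUnion fun l _ => P.isClosed_cell l

theorem isClosed_rootPiece (hk : 3 ≤ k) (hr : 0 < r) (P : RegularPolygon k r) :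
    IsClosed P.rootPiece :=
  (P.isClosed_slotPiece 0).union (isClosed_region hk hr _)

theorem slotPiece_subset_region (hk : 3 ≤ k) (P : RegularPolygon k r) (j : ℕ) :
    P.slotPiece j ⊆ P.region :=
  iUnion₂_subset fun l _ => P.cell_subset_region hk l

theorem iUnion_slotPiece (hk : 3 ≤ k) (hr : 0 < r) (P : RegularPolygon k r) :
    ⋃ j < (k + 1) / 2, P.slotPiece j = P.region := by
  apply Subset.antisymm (iUnion₂_subset fun j _ => P.slotPiece_subset_region hk j)
  rw [region_eq hk hr]
  refine iUnion₂_subset fun l hl => ?_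
  refine subset_iUnion₂_of_subset (l / 2) (by omega) ?_
  refine subset_biUnion_of_mem (u := fun l => P.cell l) ?_
  rw [hingeIndex, mem_Ico]; omega

theorem nonOverlapping_slotPiece (hk : 3 ≤ k) (hr : 0 < r) (P : RegularPolygon k r) {i j : ℕ}
    (hij : i ≠ j) : NonOverlapping (P.slotPiece i) (P.slotPiece j) := by
  refine NonOverlapping.biUnion_left (finite_Ico _ _) (fun l _ => P.isClosed_cell l)
    (P.isClosed_slotPiece j) fun a ha => NonOverlapping.symm ?_
  refine NonOverlapping.biUnion_left (finite_Ico _ _) (fun l _ => P.isClosed_cell l)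
    (P.isClosed_cell a) fun b hb => ?_
  refine interior_cell_inter_cell hk hr P fun h => ?_
  simp only [hingeIndex, mem_Ico] at ha hb
  have := Nat.ModEq.eq_of_lt_of_lt h (by omega) (by omega)
  omega

theorem image_slotPiece (P : RegularPolygon k r) (g : RigidMotion) (j : ℕ) :
    g.act '' P.slotPiece j = (P.move g).slotPiece j := by
  simp only [slotPiece, image_iUnion, image_cell]

theorem image_rootPiece (P : RegularPolygon k r) (g : RigidMotion) :
    g.act '' P.rootPiece = (P.move g).rootPiece := by
  rw [rootPiece, image_union, image_slotPiece, image_region, rootPiece, flip_move]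

theorem not_modEq_add {d : ℕ} (i : ℕ) (h0 : 0 < d) (hd : d < k) : ¬ i + d ≡ i [MOD k] := by
  intro h
  have := Nat.ModEq.add_left_cancel' i (show i + d ≡ i + 0 [MOD k] from h)
  rw [Nat.ModEq, Nat.zero_mod, Nat.mod_eq_of_lt hd] at this
  omega

theorem nonOverlapping_cell_succ (hk : 3 ≤ k) (hr : 0 < r) (P : RegularPolygon k r) (i : ℕ) :
    NonOverlapping (P.cell i) (P.cell (i + 1)) :=
  interior_cell_inter_cell hk hr P (not_modEq_succ hk i)

theorem nonOverlapping_flip (hk : 3 ≤ k) (hr : 0 < r) (P : RegularPolygon k r) :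
    NonOverlapping P.region P.flip.region := by
  have h1 := interior_mono (edge_subset_frontier hk hr P 0)
  rw [interior_frontier (isClosed_region hk hr _)] at h1
  rw [NonOverlapping, region_inter_flip hk hr]
  exact subset_empty_iff.1 h1

theorem cell_eq_tri_edge (P : RegularPolygon k r) (i : ℕ) :
    P.cell i = tri (P.vertex i) (P.vertex (i + 1)) P.center := (tri_rotate _ _ _).symm

theorem cell_eq_tri_end (P : RegularPolygon k r) (i : ℕ) :
    P.cell i = tri (P.vertex (i + 1)) P.center (P.vertex i) := by
  rw [cell_eq_tri_edge]; exact (tri_rotate _ _ _).symm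

theorem cell_eq_tri_start (P : RegularPolygon k r) (i : ℕ) :
    P.cell i = tri (P.vertex i) P.center (P.vertex (i + 1)) := by
  rw [cell, tri_swap]

theorem cross_edge_ne (hk : 3 ≤ k) (hr : 0 < r) (P : RegularPolygon k r) (i : ℕ) :
    cross (P.vertex (i + 1) - P.vertex i) (P.center - P.vertex i) ≠ 0 := by
  rw [cross_rotate]; exact cross_spokes_ne hk hr P i

theorem cross_end_ne (hk : 3 ≤ k) (hr : 0 < r) (P : RegularPolygon k r) (i : ℕ) :
    cross (P.center - P.vertex (i + 1)) (P.vertex i - P.vertex (i + 1)) ≠ 0 := by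
  rw [cross_rotate']; exact cross_spokes_ne hk hr P i

theorem cross_start_ne (hk : 3 ≤ k) (hr : 0 < r) (P : RegularPolygon k r) (i : ℕ) :
    cross (P.center - P.vertex i) (P.vertex (i + 1) - P.vertex i) ≠ 0 := by
  rw [cross_swap, neg_ne_zero]; exact cross_edge_ne hk hr P i

/-- Two triangles are glued along the spoke between them. The first outer edge is recorded because
the root piece is glued there, the two sides at the center because they end in the hinge vertices.
-/
theorem exists_simplePolygon_slotPiece (hk : 3 ≤ k) (hr : 0 < r) (P : RegularPolygon k r) {j : ℕ}
    (hj : j < (k + 1) / 2) :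
    ∃ Q : SimplePolygon, Q.region = P.slotPiece j ∧
      Q.HasEdge (P.vertex (2 * j)) (P.vertex (2 * j + 1)) ∧
      Q.HasEdge (P.vertex (hingeIndex k j)) P.center ∧ Q.HasEdge P.center (P.vertex (2 * j)) := by
  obtain ⟨A, hA, a1, a2, a3⟩ := SimplePolygon.exists_tri (cross_spokes_ne hk hr P (2 * j))
  rcases slotPiece_cases P hj with ⟨-, h2, h3⟩ | ⟨-, h2, h3⟩
  · obtain ⟨B, hB, b1, b2, b3⟩ := SimplePolygon.exists_tri (cross_spokes_ne hk hr P (2 * j + 1))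
    obtain ⟨R, hR, hRA, hRB⟩ := SimplePolygon.exists_union a3 b1
      (by rw [hA, hB, segment_symm]; exact cell_inter_cell_succ hk hr P _)
      (by
        rw [hA, hB]
        have := openSegment_subset_interior (cross_end_ne hk hr P (2 * j))
          (cross_start_ne hk hr P (2 * j + 1))
          (by
            rw [← cell_eq_tri_end, ← cell_eq_tri_start]
            exact nonOverlapping_cell_succ hk hr P _)
        rwa [← cell_eq_tri_end, ← cell_eq_tri_start] at this)
    have hne : ∀ i, P.vertex i ≠ P.center := fun i h =>
      center_notMem_edge hk hr P i (h ▸ left_mem_segment _ _ _)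
    rw [h2]
    refine ⟨R, by rw [hR, hA, hB, h3]; rfl, hRA _ _ a2 fun h => ?_, hRB _ _ b3 fun h => ?_,
      hRA _ _ a1 fun h => ?_⟩
    · exact vertex_ne_vertex_succ hk hr P _ (Prod.mk.inj h).1
    · exact hne _ (Prod.mk.inj h).1
    · exact hne _ (Prod.mk.inj h).2
  · rw [h2]
    exact ⟨A, by rw [hA, h3]; rfl, a2, a3, a1⟩

/-- Only the edge `0` disappears in the gluing. Both hinge vertices are ends of sides through the
center, so they remain vertices, even `vertex 0`, which lies on the glued edge. -/
theorem exists_simplePolygon_rootPiece (hk : 3 ≤ k) (hr : 0 < r) (P : RegularPolygon k r) :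
    ∃ Q : SimplePolygon, Q.region = P.rootPiece ∧ P.vertex 0 ∈ range Q.vertex ∧
      P.vertex (hingeIndex k 0) ∈ range Q.vertex := by
  obtain ⟨A, hA, a1, a2, a3⟩ := exists_simplePolygon_slotPiece hk hr P (j := 0) (by omega)
  obtain ⟨B, hB, hb⟩ := exists_simplePolygon hk hr P.flip
  have e0 : P.flip.vertex 0 = P.vertex 1 := by rw [vertex_flip]; ring
  have e1 : P.flip.vertex 1 = P.vertex 0 := by rw [vertex_flip]; ring
  have b1 := hb 0 (by omega)
  rw [zero_add, e0, e1] at b1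
  have hcell : P.cell 0 ⊆ P.slotPiece 0 :=
    subset_biUnion_of_mem (u := fun l => P.cell l) (by rw [hingeIndex, mem_Ico]; omega)
  have hedge : P.edge 0 ⊆ P.cell 0 := segment_subset_convexHull (by simp) (by simp)
  have hflip : P.flip.cell 0 = tri (P.vertex 0) (P.vertex 1) P.flip.center := by
    rw [cell_eq_tri_edge, zero_add, e0, e1, tri_swap]
  have hcell0 : P.cell 0 = tri (P.vertex 0) (P.vertex 1) P.center := cell_eq_tri_edge P 0
  have hne : ∀ i, P.vertex i ≠ P.center := fun i h =>
      center_notMem_edge hk hr P i (h ▸ left_mem_segment _ _ _)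
  have hcross := cross_edge_ne hk hr P.flip 0
  rw [zero_add, e0, e1, cross_swap, cross_rotate, neg_ne_zero] at hcross
  obtain ⟨R, hR, hRA, -⟩ := SimplePolygon.exists_union a1 b1
    (by
      rw [hA, hB]
      apply Subset.antisymm
      · exact (inter_subset_inter_left _ (P.slotPiece_subset_region hk 0)).trans
          (region_inter_flip hk hr P).subset
      · exact subset_inter (hedge.trans hcell)
          ((region_inter_flip hk hr P).superset.trans inter_subset_right))
    (by
      rw [hA, hB]
      have := openSegment_subset_interior (cross_edge_ne hk hr P 0) (y := P.flip.center)
        (by rw [cross_rotate'] at hcross ⊢; exact hcross)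
        (by
          rw [zero_add, ← hflip, ← hcell0]
          exact (nonOverlapping_flip hk hr P).mono (cell_subset_region hk _ _)
            (cell_subset_region hk _ _))
      rw [zero_add, ← hflip, ← hcell0] at this
      exact this.trans (interior_mono (union_subset_union hcell (cell_subset_region hk _ _))))
  refine ⟨R, by rw [hR, hA, hB]; rfl, ?_, ?_⟩
  · exact (hRA _ _ a3 fun h => hne _ (Prod.mk.inj h).1.symm).right_mem
  · exact (hRA _ _ a2 fun h => hne _ (Prod.mk.inj h).2.symm).left_mem

end RegularPolygon

/-! ### Directions around a point -/

theorem PointsInto.mono {A B : Set ℂ} {p : ℂ} {θ : ℝ} (h : PointsInto A p θ) (hAB : A ⊆ B) :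
    PointsInto B p θ := by
  obtain ⟨ε, hε, h⟩ := h
  exact ⟨ε, hε, fun t h0 h1 => interior_mono hAB (h t h0 h1)⟩

theorem exp_add_int_mul (θ : ℝ) (n : ℤ) :
    Complex.exp ((θ + n * (2 * Real.pi) : ℝ) * Complex.I) = Complex.exp (θ * Complex.I) := by
  push_cast
  rw [add_mul, mul_assoc (n : ℂ), Complex.exp_add, Complex.exp_int_mul_two_pi_mul_I, mul_one]

theorem pointsInto_add_int_mul {A : Set ℂ} {p : ℂ} {θ : ℝ} (n : ℤ) :
    PointsInto A p (θ + n * (2 * Real.pi)) ↔ PointsInto A p θ := by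
  unfold PointsInto
  simp only [exp_add_int_mul]

theorem PointsInto.notMem_of_nonOverlapping {A B : Set ℂ} {p : ℂ} {θ : ℝ}
    (hA : PointsInto A p θ) (h : NonOverlapping A B) : ¬ PointsInto B p θ := by
  rintro ⟨ε, hε, hB⟩
  obtain ⟨ε', hε', hA⟩ := hA
  have hm : 0 < min ε ε' := lt_min hε hε'
  exact h.disjoint_interior.le_bot
    ⟨hA (min ε ε' / 2) (by linarith) (by linarith [min_le_right ε ε']),
      hB (min ε ε' / 2) (by linarith) (by linarith [min_le_left ε ε'])⟩

/-- The directions `γ` and `δ` at `p` can be turned into each other through directions that lead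
into the interior of `S`. -/
def SameArc (S : Set ℂ) (p : ℂ) (γ δ : ℝ) : Prop :=
  ∃ n : ℤ, ∀ θ ∈ uIcc γ (δ + n * (2 * Real.pi)), PointsInto S p θ

theorem SameArc.symm {S : Set ℂ} {p : ℂ} {γ δ : ℝ} (h : SameArc S p γ δ) : SameArc S p δ γ := by
  obtain ⟨n, h⟩ := h
  refine ⟨-n, fun θ hθ => (pointsInto_add_int_mul n).1 (h _ ?_)⟩
  rw [mem_uIcc] at hθ ⊢
  push_cast at hθ
  rcases hθ with ⟨h1, h2⟩ | ⟨h1, h2⟩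
  · right; constructor <;> linarith
  · left; constructor <;> linarith

theorem SameArc.trans {S : Set ℂ} {p : ℂ} {γ δ ε : ℝ} (h : SameArc S p γ δ)
    (h' : SameArc S p δ ε) : SameArc S p γ ε := by
  obtain ⟨n, h⟩ := h
  obtain ⟨n', h'⟩ := h'
  refine ⟨n + n', fun θ hθ => ?_⟩
  rcases uIcc_subset_uIcc_union_uIcc (b := δ + n * (2 * Real.pi)) hθ with h1 | h1
  · exact h θ h1
  · rw [← pointsInto_add_int_mul (-n)]
    apply h'
    rw [mem_uIcc] at h1 ⊢
    push_cast at h1 ⊢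
    rcases h1 with ⟨h1, h2⟩ | ⟨h1, h2⟩
    · left; constructor <;> linarith
    · right; constructor <;> linarith

theorem HingesCross.swap {p : ℂ} {A B C D : Set ℂ} (h : HingesCross p A B C D) :
    HingesCross p C D A B := by
  obtain ⟨α, γ, β, δ, h1, h2, h3, h4, hA, hB, ⟨hC, hD⟩ | ⟨hD, hC⟩⟩ := h
  · refine ⟨γ, β, δ, α + 2 * Real.pi, h2, h3, h4, by linarith, hC, hD, Or.inr ⟨hB, ?_⟩⟩
    simpa using (pointsInto_add_int_mul 1).2 hA
  · refine ⟨δ - 2 * Real.pi, α, γ, β, by linarith, h1, h2, by linarith, ?_, hD, Or.inl ⟨hA, hB⟩⟩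
    have := (pointsInto_add_int_mul (-1)).2 hC
    push_cast at this
    rwa [neg_one_mul, ← sub_eq_add_neg] at this

/-- In a crossing, the directions `α` and `β` separate `γ` from `δ` on the circle, so an arc from
`γ` to `δ` inside `S` passes through one of them. But they lead into sets that do not overlap `S`.
-/
theorem not_hingesCross {p : ℂ} {A B C D S : Set ℂ} (hA : NonOverlapping A S)
    (hB : NonOverlapping B S)
    (h : ∀ γ δ, PointsInto C p γ → PointsInto D p δ → SameArc S p γ δ) :
    ¬ HingesCross p A B C D := by
  rintro ⟨α, γ, β, δ, h1, h2, h3, h4, hα, hβ, hCD⟩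
  have harc : SameArc S p γ δ := by
    rcases hCD with ⟨hC, hD⟩ | ⟨hD, hC⟩
    · exact h _ _ hC hD
    · exact (h _ _ hC hD).symm
  obtain ⟨n, harc⟩ := harc
  -- The sign of `n` tells which way the arc turns: upward it passes `β`, downward it passes `α`.
  rcases le_or_gt 0 n with hn | hn
  · refine hβ.notMem_of_nonOverlapping hB (harc β ?_)
    have : (0 : ℝ) ≤ n * (2 * Real.pi) :=
      mul_nonneg (by exact_mod_cast hn) (by linarith [Real.pi_pos])
    rw [mem_uIcc]; left; constructor <;> linarith
  · refine hα.notMem_of_nonOverlapping hA (harc α ?_)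
    have h5 : (n : ℝ) ≤ -1 := by exact_mod_cast (by omega : n ≤ -1)
    have : n * (2 * Real.pi) ≤ -1 * (2 * Real.pi) :=
      mul_le_mul_of_nonneg_right h5 (by linarith [Real.pi_pos])
    rw [mem_uIcc]; right; constructor <;> linarith

/-- Positive combinations of a direction into the interior of `T` with a direction inside `T` lead
into the interior again, so everything between the two directions is covered. The direction `θ` may
run along the boundary of `T`; it is only required to lead into the interior of the larger set `S`,
as a common edge of two triangles does. -/
theorem Convex.sameArc {T S : Set ℂ} {p : ℂ} {γ θ t : ℝ} (hT : Convex ℝ T) (hp : p ∉ interior T)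
    (hpT : p ∈ T) (hTS : T ⊆ S) (hγ : PointsInto T p γ) (ht : 0 < t)
    (hq : p + t * Complex.exp (θ * Complex.I) ∈ T) (hθ : PointsInto S p θ) :
    SameArc S p γ θ := by
  -- The representative of `θ` within a half turn of `γ` is chosen, so the arc takes the short way.
  obtain ⟨n, ⟨hn1, hn2⟩, -⟩ :=
    existsUnique_add_zsmul_mem_Ioc Real.two_pi_pos θ (γ - Real.pi)
  rw [zsmul_eq_mul] at hn1 hn2
  refine ⟨n, ?_⟩
  rw [← pointsInto_add_int_mul n] at hθ
  rw [← exp_add_int_mul θ n] at hq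
  generalize θ + n * (2 * Real.pi) = θ at *
  obtain ⟨ε, hε, hγ⟩ := hγ
  have hTt : ∀ u : ℝ, 0 ≤ u → u ≤ t → p + u * Complex.exp (θ * Complex.I) ∈ T := by
    intro u h0 h1
    have := hT.lineMap_mem hpT hq (t := u / t) ⟨by positivity, (div_le_one ht).2 h1⟩
    convert this using 1
    have : (t : ℂ) ≠ 0 := by exact_mod_cast ht.ne'
    simp [AffineMap.lineMap_apply]; field_simp; ring
  -- The point in question is the midpoint of an interior point on the ray `γ` and a point of `T` on
  -- the ray `θ`.
  have hcomb : ∀ a b : ℝ, 0 < a → 0 ≤ b → ∀ᶠ u : ℝ in 𝓝[>] 0,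
      p + u * (a * Complex.exp (γ * Complex.I) + b * Complex.exp (θ * Complex.I)) ∈ interior T := by
    intro a b ha hb
    have e1 : ∀ᶠ u in 𝓝[>] (0 : ℝ), 2 * u * a < ε := by
      have : Tendsto (fun u : ℝ => 2 * u * a) (𝓝[>] 0) (𝓝 (2 * 0 * a)) :=
        ((by fun_prop : Continuous fun u : ℝ => 2 * u * a).tendsto 0).mono_left nhdsWithin_le_nhds
      exact this.eventually (gt_mem_nhds (by simpa using hε))
    have e2 : ∀ᶠ u in 𝓝[>] (0 : ℝ), 2 * u * b < t := by
      have : Tendsto (fun u : ℝ => 2 * u * b) (𝓝[>] 0) (𝓝 (2 * 0 * b)) :=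
        ((by fun_prop : Continuous fun u : ℝ => 2 * u * b).tendsto 0).mono_left nhdsWithin_le_nhds
      exact this.eventually (gt_mem_nhds (by simpa using ht))
    filter_upwards [e1, e2, self_mem_nhdsWithin] with u h1 h2 hu
    have hu : 0 < u := hu
    have h3 := hT.combo_interior_self_mem_interior (hγ (2 * u * a) (by positivity) h1)
      (hTt (2 * u * b) (by positivity) h2.le) (a := 1 / 2) (b := 1 / 2) (by norm_num) (by norm_num)
      (by norm_num)
    convert h3 using 1
    simp only [Complex.real_smul]; push_cast; ring
  have hinto : ∀ φ a b : ℝ, 0 < a → 0 ≤ b → Complex.exp (φ * Complex.I) =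
      a * Complex.exp (γ * Complex.I) + b * Complex.exp (θ * Complex.I) → PointsInto T p φ := by
    intro φ a b ha hb e
    have := hcomb a b ha hb
    rw [← e] at this
    rw [Filter.Eventually, mem_nhdsGT_iff_exists_Ioo_subset] at this
    obtain ⟨η, hη, h⟩ := this
    exact ⟨η, hη, fun u h0 h1 => h ⟨h0, h1⟩⟩
  have hsum : ∀ φ : ℝ, (Real.sin (θ - γ) : ℂ) * Complex.exp (φ * Complex.I) =
      Real.sin (θ - φ) * Complex.exp (γ * Complex.I) +
        Real.sin (φ - γ) * Complex.exp (θ * Complex.I) := by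
    intro φ
    apply Complex.ext
    · simp only [Complex.add_re, Complex.re_ofReal_mul, Complex.exp_ofReal_mul_I_re, Real.sin_sub]
      ring
    · simp only [Complex.add_im, Complex.im_ofReal_mul, Complex.exp_ofReal_mul_I_im, Real.sin_sub]
      ring
  -- For opposite directions the combination with equal weights is `p` itself, which would then be
  -- interior.
  have hpi : θ ≠ γ + Real.pi := by
    rintro rfl
    apply hp
    obtain ⟨u, hu⟩ := (hcomb 1 1 one_pos zero_le_one).exists
    convert hu using 1
    push_cast
    rw [add_mul, Complex.exp_add, Complex.exp_pi_mul_I]; ring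
  have hlt : θ < γ + Real.pi := lt_of_le_of_ne (by linarith) hpi
  intro φ hφ
  by_cases hφθ : φ = θ
  · rw [hφθ]; exact hθ
  refine PointsInto.mono ?_ hTS
  by_cases hφγ : φ = γ
  · exact hinto φ 1 0 one_pos le_rfl (by rw [hφγ]; simp)
  rw [mem_uIcc] at hφ
  have key : 0 < Real.sin (θ - φ) / Real.sin (θ - γ) ∧
      0 < Real.sin (φ - γ) / Real.sin (θ - γ) ∧ Real.sin (θ - γ) ≠ 0 := by
    rcases hφ with ⟨h1, h2⟩ | ⟨h1, h2⟩
    · have h1 := lt_of_le_of_ne' h1 hφγ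
      have h2 := lt_of_le_of_ne h2 hφθ
      have s1 := Real.sin_pos_of_pos_of_lt_pi (x := θ - φ) (by linarith) (by linarith)
      have s2 := Real.sin_pos_of_pos_of_lt_pi (x := φ - γ) (by linarith) (by linarith)
      have s3 := Real.sin_pos_of_pos_of_lt_pi (x := θ - γ) (by linarith) (by linarith)
      exact ⟨div_pos s1 s3, div_pos s2 s3, s3.ne'⟩
    · have h1 := lt_of_le_of_ne' h1 hφθ
      have h2 := lt_of_le_of_ne h2 hφγ
      have s1 := Real.sin_neg_of_neg_of_neg_pi_lt (x := θ - φ) (by linarith) (by linarith)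
      have s2 := Real.sin_neg_of_neg_of_neg_pi_lt (x := φ - γ) (by linarith) (by linarith)
      have s3 := Real.sin_neg_of_neg_of_neg_pi_lt (x := θ - γ) (by linarith) (by linarith)
      exact ⟨div_pos_of_neg_of_neg s1 s3, div_pos_of_neg_of_neg s2 s3, s3.ne⟩
  refine hinto φ _ _ key.1 key.2.1.le ?_
  have hs : (Real.sin (θ - γ) : ℂ) ≠ 0 := by exact_mod_cast key.2.2
  rw [← mul_right_inj' hs, hsum φ]
  simp only [Complex.ofReal_div]
  field_simp

theorem exists_mul_exp {z : ℂ} (hz : z ≠ 0) :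
    ∃ t θ : ℝ, 0 < t ∧ z = t * Complex.exp (θ * Complex.I) :=
  ⟨‖z‖, z.arg, norm_pos_iff.2 hz, (Complex.norm_mul_exp_arg_mul_I z).symm⟩

theorem pointsInto_of_openSegment {S : Set ℂ} {p q : ℂ} {t θ : ℝ} (ht : 0 < t)
    (hq : q = p + t * Complex.exp (θ * Complex.I)) (h : openSegment ℝ p q ⊆ interior S) :
    PointsInto S p θ := by
  refine ⟨t, ht, fun u h0 h1 => h ⟨1 - u / t, u / t, ?_, by positivity, by ring, ?_⟩⟩
  · rw [sub_pos, div_lt_one ht]; exact h1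
  · have : (t : ℂ) ≠ 0 := by exact_mod_cast ht.ne'
    rw [hq]
    simp only [Complex.real_smul]; push_cast; field_simp; ring

theorem Convex.exists_pointsInto {T : Set ℂ} {p : ℂ} (hT : Convex ℝ T) (hp : p ∉ interior T)
    (hpT : p ∈ T) (hi : (interior T).Nonempty) : ∃ θ, PointsInto T p θ := by
  obtain ⟨z, hz⟩ := hi
  obtain ⟨t, θ, ht, e⟩ := exists_mul_exp (sub_ne_zero.2 (show z ≠ p by rintro rfl; exact hp hz))
  exact ⟨θ, pointsInto_of_openSegment ht (by rw [← e]; ring)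
    (hT.openSegment_self_interior_subset_interior hpT hz)⟩

theorem vertex_notMem_interior_tri {p q x : ℂ} (h : cross (q - p) (x - p) ≠ 0) :
    p ∉ interior (tri p q x) := fun hi =>
  (segment_subset_frontier_tri h (left_mem_segment ℝ p q)).2 hi

/-- Turning from one triangle into another across a common edge. -/
theorem sameArc_of_common_edge {S : Set ℂ} {p q x y : ℂ} {γ δ : ℝ}
    (hx : cross (q - p) (x - p) ≠ 0) (hy : cross (q - p) (y - p) ≠ 0)
    (h : NonOverlapping (tri p q x) (tri p q y)) (hxS : tri p q x ⊆ S) (hyS : tri p q y ⊆ S)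
    (hγ : PointsInto (tri p q x) p γ) (hδ : PointsInto (tri p q y) p δ) : SameArc S p γ δ := by
  have hqp : q - p ≠ 0 := by rintro e; exact hx (by simp [e, cross])
  obtain ⟨t, θ, ht, e⟩ := exists_mul_exp hqp
  have hq : q = p + t * Complex.exp (θ * Complex.I) := by rw [← e]; ring
  have hθ : PointsInto S p θ := pointsInto_of_openSegment ht hq
    ((openSegment_subset_interior hx hy h).trans (interior_mono (union_subset hxS hyS)))
  have hp : ∀ x, p ∈ tri p q x := fun x => subset_convexHull ℝ _ (by simp)
  have hq' : ∀ x, p + t * Complex.exp (θ * Complex.I) ∈ tri p q x := fun x => by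
    rw [← hq]; exact subset_convexHull ℝ _ (by simp)
  exact ((convex_tri p q x).sameArc (vertex_notMem_interior_tri hx) (hp x) hxS hγ ht
    (hq' x) hθ).trans ((convex_tri p q y).sameArc (vertex_notMem_interior_tri hy) (hp y) hyS hδ ht
    (hq' y) hθ).symm

theorem PointsInto.exists_notMem {A B : Set ℂ} {p : ℂ} {γ : ℝ} (hγ : PointsInto A p γ)
    (hB : IsClosed B) (hp : p ∉ B) :
    ∃ t : ℝ, 0 < t ∧ p + t * Complex.exp (γ * Complex.I) ∈ A \ B := by
  obtain ⟨ε, hε, h⟩ := hγ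
  have hc : Tendsto (fun t : ℝ => p + t * Complex.exp (γ * Complex.I)) (𝓝[>] 0) (𝓝 p) := by
    have : Continuous fun t : ℝ => p + t * Complex.exp (γ * Complex.I) := by fun_prop
    simpa using (this.tendsto 0).mono_left nhdsWithin_le_nhds
  obtain ⟨t, h1, h2⟩ := ((hc.eventually (hB.isOpen_compl.mem_nhds hp)).and
    (Ioo_mem_nhdsGT hε)).exists
  exact ⟨t, h2.1, interior_subset (h t h2.1 h2.2), h1⟩

/-! ### Directions at the two hinge vertices of a piece. -/

namespace RegularPolygon

variable {k : ℕ} {r : ℝ}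

/-- `A` is the `j`-th piece of `P`; the first piece may be enlarged by the neighbor of `P` across
the edge `0`. -/
def IsPiece (P : RegularPolygon k r) (j : ℕ) (A : Set ℂ) : Prop :=
  A = P.slotPiece j ∨ j = 0 ∧ A = P.rootPiece

theorem IsPiece.slotPiece_subset {P : RegularPolygon k r} {j : ℕ} {A : Set ℂ}
    (h : P.IsPiece j A) : P.slotPiece j ⊆ A := by
  rcases h with rfl | ⟨rfl, rfl⟩
  · exact Subset.rfl
  · exact subset_union_left

theorem vertex_notMem_interior_cell (hk : 3 ≤ k) (hr : 0 < r) (P : RegularPolygon k r) (i : ℕ) :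
    P.vertex i ∉ interior (P.cell i) := by
  rw [cell_eq_tri_edge]; exact vertex_notMem_interior_tri (cross_edge_ne hk hr P i)

theorem vertex_succ_notMem_interior_cell (hk : 3 ≤ k) (hr : 0 < r) (P : RegularPolygon k r)
    (i : ℕ) : P.vertex (i + 1) ∉ interior (P.cell i) := by
  rw [cell_eq_tri_end]; exact vertex_notMem_interior_tri (cross_end_ne hk hr P i)

theorem vertex_mem_cell (P : RegularPolygon k r) (i : ℕ) : P.vertex i ∈ P.cell i :=
  subset_convexHull ℝ _ (by simp)

theorem vertex_succ_mem_cell (P : RegularPolygon k r) (i : ℕ) : P.vertex (i + 1) ∈ P.cell i :=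
  subset_convexHull ℝ _ (by simp)

theorem convex_cell (P : RegularPolygon k r) (i : ℕ) : Convex ℝ (P.cell i) := convex_tri _ _ _

theorem cell_subset_slotPiece_start (P : RegularPolygon k r) {j : ℕ} (hj : j < (k + 1) / 2) :
    P.cell (2 * j) ⊆ P.slotPiece j :=
  subset_biUnion_of_mem (u := fun l => P.cell l) (by rw [hingeIndex, mem_Ico]; omega)

theorem cell_subset_slotPiece_end (P : RegularPolygon k r) {j : ℕ} (hj : j < (k + 1) / 2) :
    P.cell (hingeIndex k j - 1) ⊆ P.slotPiece j :=
  subset_biUnion_of_mem (u := fun l => P.cell l) (by rw [hingeIndex, mem_Ico]; omega)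

theorem sameArc_cell_succ (hk : 3 ≤ k) (hr : 0 < r) (P : RegularPolygon k r) (i : ℕ) {S : Set ℂ}
    {γ δ : ℝ} (h0 : P.cell i ⊆ S) (h1 : P.cell (i + 1) ⊆ S)
    (hγ : PointsInto (P.cell i) (P.vertex (i + 1)) γ)
    (hδ : PointsInto (P.cell (i + 1)) (P.vertex (i + 1)) δ) :
    SameArc S (P.vertex (i + 1)) γ δ := by
  have hno := nonOverlapping_cell_succ hk hr P i
  rw [cell_eq_tri_end] at h0 hγ hno
  rw [cell_eq_tri_start] at h1 hδ hno
  exact sameArc_of_common_edge (cross_end_ne hk hr P i) (cross_start_ne hk hr P (i + 1)) hno h0 h1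
    hγ hδ

theorem sameArc_cell_of_common_edge (hk : 3 ≤ k) (hr : 0 < r) {P Q : RegularPolygon k r} {i j : ℕ}
    {S : Set ℂ} {γ δ : ℝ} (e0 : P.vertex (i + 1) = Q.vertex j)
    (e1 : P.vertex i = Q.vertex (j + 1)) (hno : NonOverlapping P.region Q.region)
    (h0 : P.cell i ⊆ S) (h1 : Q.cell j ⊆ S) (hγ : PointsInto (P.cell i) (P.vertex (i + 1)) γ)
    (hδ : PointsInto (Q.cell j) (P.vertex (i + 1)) δ) : SameArc S (P.vertex (i + 1)) γ δ := by
  have hno := hno.mono (cell_subset_region hk P i) (cell_subset_region hk Q j)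
  have hP : P.cell i = tri (P.vertex (i + 1)) (P.vertex i) P.center := by
    rw [cell_eq_tri_edge, tri_swap]
  have hQ : Q.cell j = tri (P.vertex (i + 1)) (P.vertex i) Q.center := by
    rw [cell_eq_tri_edge, e0, e1]
  have cP : cross (P.vertex i - P.vertex (i + 1)) (P.center - P.vertex (i + 1)) ≠ 0 := by
    rw [cross_swap, cross_rotate, neg_ne_zero]; exact cross_edge_ne hk hr P i
  have cQ : cross (P.vertex i - P.vertex (i + 1)) (Q.center - P.vertex (i + 1)) ≠ 0 := by
    rw [e0, e1]; exact cross_edge_ne hk hr Q j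
  rw [hP] at h0 hγ hno
  rw [hQ] at h1 hδ hno
  exact sameArc_of_common_edge cP cQ hno h0 h1 hγ hδ

/-- Near `p` the set `A` is contained in `T`, as the closed rest `B` stays away from `p`; thus any
direction into `A` is a direction inside the convex set `T`. -/
theorem sameArc_of_local {A B T S : Set ℂ} {p : ℂ} {γ δ : ℝ} (hT : Convex ℝ T)
    (hp : p ∉ interior T) (hpT : p ∈ T) (hTS : T ⊆ S) (hAS : A ⊆ S) (hAB : A ⊆ B ∪ T)
    (hB : IsClosed B) (hpB : p ∉ B) (hγ : PointsInto A p γ) (hδ : PointsInto T p δ) :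
    SameArc S p γ δ := by
  obtain ⟨t, ht, hA, hB⟩ := hγ.exists_notMem hB hpB
  exact (hT.sameArc hp hpT hTS hδ ht ((hAB hA).resolve_left hB) (hγ.mono hAS)).symm

/-- Of all cells of the piece only the last one touches the end hinge. The neighbor attached to the
root piece does not reach it either, because the vertex `2` is not on the edge `0`. -/
theorem sameArc_end (hk : 3 ≤ k) (hr : 0 < r) {P : RegularPolygon k r} {j : ℕ}
    (hj : j < (k + 1) / 2) {A S : Set ℂ} (hA : P.IsPiece j A) (hAS : A ⊆ S) {γ δ : ℝ}
    (hγ : PointsInto A (P.vertex (hingeIndex k j)) γ)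
    (hδ : PointsInto (P.cell (hingeIndex k j - 1)) (P.vertex (hingeIndex k j)) δ) :
    SameArc S (P.vertex (hingeIndex k j)) γ δ := by
  have hTS := (cell_subset_slotPiece_end P hj).trans (hA.slotPiece_subset.trans hAS)
  have main : ∀ B, IsClosed B → P.vertex (hingeIndex k j) ∉ B →
      A ⊆ B ∪ P.cell (hingeIndex k j - 1) → SameArc S (P.vertex (hingeIndex k j)) γ δ := by
    intro B hB hpB hAB
    obtain ⟨h, hh⟩ : ∃ h, hingeIndex k j = h + 1 :=
      ⟨hingeIndex k j - 1, by rw [hingeIndex]; omega⟩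
    rw [hh] at hγ hδ hTS hpB hAB ⊢
    rw [Nat.add_sub_cancel] at hδ hTS hAB
    exact sameArc_of_local (P.convex_cell h) (vertex_succ_notMem_interior_cell hk hr P h)
      (P.vertex_succ_mem_cell h) hTS hAS hAB hB hpB hγ hδ
  rcases slotPiece_cases P hj with ⟨-, h2, h3⟩ | ⟨h1, h2, h3⟩
  · have hn : P.vertex (hingeIndex k j) ∉ P.cell (2 * j) := by
      rw [h2]
      exact vertex_notMem_cell hk hr P (not_modEq_add (2 * j) two_pos (by omega))
        fun h => not_modEq_succ hk (2 * j + 1) h.symm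
    rcases hA with rfl | ⟨rfl, rfl⟩
    · refine main _ (P.isClosed_cell (2 * j)) hn ?_
      rw [h3, h2]; exact Subset.rfl
    · refine main _ ((P.isClosed_cell 0).union (isClosed_region hk hr P.flip)) ?_ ?_
      · rintro (h | h)
        · exact hn h
        · have h4 : P.vertex (hingeIndex k 0) ∈ P.edge 0 :=
            region_inter_flip hk hr P ▸ ⟨P.vertex_mem_region _, h⟩
          rcases eq_or_eq_of_height_vertex_eq hk hr P (height_eq_of_mem_edge hk P h4) with h | h
          · rw [h2] at h
            exact not_modEq_add 0 two_pos (by omega) h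
          · rw [h2] at h
            exact not_modEq_succ hk 1 h.symm
      · rw [rootPiece, h3, h2]
        rintro z ((h | h) | h)
        exacts [Or.inl (Or.inl h), Or.inr h, Or.inl (Or.inr h)]
  · rcases hA with rfl | ⟨rfl, rfl⟩
    · refine main ∅ isClosed_empty (notMem_empty _) ?_
      rw [h3, h2, empty_union]; exact Subset.rfl
    · omega

/-- Only the first cell touches the start vertex, with one exception: at the vertex `0`, the root
piece also contains the attached neighbor. -/
theorem sameArc_start (hk : 3 ≤ k) (hr : 0 < r) {P : RegularPolygon k r} {j : ℕ}
    (hj : j < (k + 1) / 2) {A S : Set ℂ} (hA : P.IsPiece j A) (hAS : A ⊆ S) {γ δ : ℝ}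
    (hγ : PointsInto A (P.vertex (2 * j)) γ)
    (hδ : PointsInto (P.cell (2 * j)) (P.vertex (2 * j)) δ) :
    SameArc S (P.vertex (2 * j)) γ δ := by
  have hTS := (cell_subset_slotPiece_start P hj).trans (hA.slotPiece_subset.trans hAS)
  have main : ∀ B, IsClosed B → P.vertex (2 * j) ∉ B →
      A ⊆ B ∪ P.cell (2 * j) → SameArc S (P.vertex (2 * j)) γ δ := fun B hB hpB hAB =>
    sameArc_of_local (P.convex_cell _) (vertex_notMem_interior_cell hk hr P _)
      (P.vertex_mem_cell _) hTS hAS hAB hB hpB hγ hδ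
  rcases slotPiece_cases P hj with ⟨-, h2, h3⟩ | ⟨h1, h2, h3⟩
  · have hn : P.vertex (2 * j) ∉ P.cell (2 * j + 1) :=
      vertex_notMem_cell hk hr P (not_modEq_succ hk _)
        fun h => not_modEq_add (2 * j) two_pos (by omega) h.symm
    rcases hA with rfl | ⟨rfl, rfl⟩
    · refine main _ (P.isClosed_cell (2 * j + 1)) hn ?_
      rw [h3, union_comm]
    · obtain ⟨t, ht, ht1, ht2⟩ := hγ.exists_notMem (P.isClosed_cell 1) hn
      rw [rootPiece, h3] at ht1
      rcases ht1 with (h | h) | h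
      · exact ((P.convex_cell 0).sameArc (vertex_notMem_interior_cell hk hr P 0)
          (P.vertex_mem_cell 0) hTS hδ ht h (hγ.mono hAS)).symm
      · exact absurd h ht2
      -- The direction leads into the attached neighbor, so the arc turns inside the neighbor first
      -- and then across the edge `0` into the first cell.
      · have e0 : P.flip.vertex 0 = P.vertex 1 := by rw [vertex_flip]; ring
        have e1 : P.flip.vertex 1 = P.vertex 0 := by rw [vertex_flip]; ring
        have hmem : P.vertex 0 ∈ P.flip.cell 0 := e1 ▸ P.flip.vertex_succ_mem_cell 0
        have hfr : P.vertex 0 ∉ interior P.flip.region := by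
          have := edge_subset_frontier hk hr P.flip 0 (right_mem_segment _ _ _)
          rw [zero_add, e1] at this
          exact this.2
        have hsub := cell_subset_region hk P.flip 0
        obtain ⟨ε, hε⟩ := (P.flip.convex_cell 0).exists_pointsInto
          (fun h => hfr (interior_mono hsub h)) hmem (nonempty_interior_cell hk hr _ _)
        have hLS : P.flip.region ⊆ S := subset_union_right.trans hAS
        have h1 := (P.flip.convex_region).sameArc hfr (hsub hmem) hLS (hε.mono hsub) ht h
          (hγ.mono hAS)
        have h2 := sameArc_cell_of_common_edge hk hr (P := P.flip) (Q := P) (i := 0) (j := 0)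
          e1 e0 (nonOverlapping_flip hk hr P).symm (hsub.trans hLS) hTS (by rwa [e1])
          (by rw [e1]; exact hδ)
        rw [e1] at h2
        exact h1.symm.trans h2
  · rcases hA with rfl | ⟨rfl, rfl⟩
    · refine main ∅ isClosed_empty (notMem_empty _) ?_
      rw [h3, empty_union]
    · omega

end RegularPolygon

/-! ### Cyclic sequences -/

/-- Insert `m` copies of `c` after the position `i₀`. -/
def insertRun {α : Type*} (τ : ℕ → α) (c : α) (m i₀ : ℕ) (i : ℕ) : α :=
  if i ≤ i₀ then τ i else if i ≤ i₀ + m then c else τ (i - m)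

section insertRun

variable {α : Type*} {τ : ℕ → α} {c : α} {m N i₀ : ℕ}

theorem insertRun_of_le {i : ℕ} (h : i ≤ i₀) : insertRun τ c m i₀ i = τ i := if_pos h

theorem insertRun_mid {i : ℕ} (h : i₀ < i) (h' : i ≤ i₀ + m) : insertRun τ c m i₀ i = c := by
  rw [insertRun, if_neg (by omega), if_pos h']

theorem insertRun_of_lt {i : ℕ} (h : i₀ + m < i) : insertRun τ c m i₀ i = τ (i - m) := by
  rw [insertRun, if_neg (by omega), if_neg (by omega)]

theorem insertRun_add {i : ℕ} (h : i₀ < i) : insertRun τ c m i₀ (i + m) = τ i := by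
  rw [insertRun_of_lt (by omega), Nat.add_sub_cancel]

theorem insertRun_succ_left {i : ℕ} (h : i < i₀) (hi₀ : i₀ < N) :
    insertRun τ c m i₀ ((i + 1) % (N + m)) = τ ((i + 1) % N) := by
  rw [Nat.mod_eq_of_lt (show i + 1 < N + m by omega), Nat.mod_eq_of_lt (show i + 1 < N by omega),
    insertRun_of_le (by omega)]

theorem insertRun_succ_right {i : ℕ} (h : i₀ ≤ i) (hi : i < N) :
    insertRun τ c m i₀ ((i + m + 1) % (N + m)) = τ ((i + 1) % N) := by
  rcases Nat.lt_or_ge (i + 1) N with h1 | h1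
  · rw [Nat.mod_eq_of_lt (show i + m + 1 < N + m by omega), Nat.mod_eq_of_lt h1,
      show i + m + 1 = i + 1 + m by ring, insertRun_add (by omega)]
  · obtain rfl : i + 1 = N := by omega
    rw [show i + m + 1 = i + 1 + m by ring, Nat.mod_self, Nat.mod_self,
      insertRun_of_le (Nat.zero_le _)]

/-- The insertion breaks only the link after `i₀`. All other links survive with their slots, since
later positions are shifted by exactly `m`. -/
theorem insertRun_embed (hi₀ : i₀ < N) {i : ℕ} (hi : i < N) (hne : i ≠ i₀) :
    ∃ i' < N + m, i' % m = i % m ∧ insertRun τ c m i₀ i' = τ i ∧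
      insertRun τ c m i₀ ((i' + 1) % (N + m)) = τ ((i + 1) % N) := by
  rcases lt_or_gt_of_ne hne with h | h
  · exact ⟨i, by omega, rfl, insertRun_of_le h.le, insertRun_succ_left h hi₀⟩
  · exact ⟨i + m, by omega, Nat.add_mod_right _ _, insertRun_add h, insertRun_succ_right h.le hi⟩

theorem insertRun_enter (hm : 0 < m) (hi₀ : i₀ < N) :
    insertRun τ c m i₀ ((i₀ + 1) % (N + m)) = c := by
  rw [Nat.mod_eq_of_lt (by omega), insertRun_mid (by omega) (by omega)]

theorem insertRun_cases (hm : 0 < m) (hi₀ : i₀ < N) {i : ℕ} (hi : i < N + m) :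
    (∃ l < N, l ≠ i₀ ∧ i % m = l % m ∧ insertRun τ c m i₀ i = τ l ∧
      insertRun τ c m i₀ ((i + 1) % (N + m)) = τ ((l + 1) % N)) ∨
    (i = i₀ ∧ insertRun τ c m i₀ i = τ i₀ ∧ insertRun τ c m i₀ ((i + 1) % (N + m)) = c) ∨
    (i = i₀ + m ∧ insertRun τ c m i₀ i = c ∧
      insertRun τ c m i₀ ((i + 1) % (N + m)) = τ ((i₀ + 1) % N)) ∨
    (insertRun τ c m i₀ i = c ∧ insertRun τ c m i₀ ((i + 1) % (N + m)) = c) := by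
  rcases lt_trichotomy i i₀ with h | rfl | h
  · exact Or.inl ⟨i, by omega, h.ne, rfl, insertRun_of_le h.le, insertRun_succ_left h hi₀⟩
  · exact Or.inr (Or.inl ⟨rfl, insertRun_of_le le_rfl, insertRun_enter hm hi₀⟩)
  rcases lt_trichotomy i (i₀ + m) with h' | rfl | h'
  · refine Or.inr (Or.inr (Or.inr ⟨insertRun_mid h h'.le, ?_⟩))
    rw [Nat.mod_eq_of_lt (by omega), insertRun_mid (by omega) (by omega)]
  · exact Or.inr (Or.inr (Or.inl ⟨rfl, insertRun_mid h le_rfl, insertRun_succ_right le_rfl hi₀⟩))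
  · obtain ⟨l, rfl⟩ : ∃ l, i = l + m := ⟨i - m, by omega⟩
    exact Or.inl ⟨l, by omega, by omega, Nat.add_mod_right _ _, insertRun_add (by omega),
      insertRun_succ_right (by omega) (by omega)⟩

theorem eq_of_mod_eq_of_lt {a b : ℕ} (h : a % m = b % m) (h1 : a < b + m) (h2 : b < a + m) :
    a = b := by
  rcases le_total a b with hab | hab
  · have := (Nat.modEq_iff_dvd' hab).1 h
    have := Nat.eq_zero_of_dvd_of_lt this (by omega)
    omega
  · have := (Nat.modEq_iff_dvd' hab).1 h.symm
    have := Nat.eq_zero_of_dvd_of_lt this (by omega)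
    omega

/-- The run has length `m`, so its residues modulo `m` are distinct, and the shift by `m` preserves
the residues of the old entries. -/
theorem insertRun_inj (hc : ∀ i < N, τ i ≠ c)
    (hτ : ∀ i < N, ∀ i' < N, τ i = τ i' → i % m = i' % m → i = i') {i i' : ℕ}
    (hi : i < N + m) (hi' : i' < N + m) (hi₀ : i₀ < N)
    (h : insertRun τ c m i₀ i = insertRun τ c m i₀ i') (hmod : i % m = i' % m) : i = i' := by
  have key : ∀ i < N + m, (i₀ < i ∧ i ≤ i₀ + m ∧ insertRun τ c m i₀ i = c) ∨
      ∃ l < N, insertRun τ c m i₀ i = τ l ∧ i % m = l % m ∧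
        (i = l ∧ l ≤ i₀ ∨ i = l + m ∧ i₀ < l) := by
    intro i hi
    rcases Nat.lt_or_ge i₀ i with h | h
    · rcases Nat.lt_or_ge (i₀ + m) i with h' | h'
      · obtain ⟨l, rfl⟩ : ∃ l, i = l + m := ⟨i - m, by omega⟩
        exact Or.inr ⟨l, by omega, insertRun_add (by omega), Nat.add_mod_right _ _,
          Or.inr ⟨rfl, by omega⟩⟩
      · exact Or.inl ⟨h, h', insertRun_mid h h'⟩
    · exact Or.inr ⟨i, by omega, insertRun_of_le h, rfl, Or.inl ⟨rfl, h⟩⟩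
  rcases key i hi with ⟨h1, h2, h3⟩ | ⟨l, hl, h1, h2, h3⟩ <;>
    rcases key i' hi' with ⟨g1, g2, g3⟩ | ⟨l', hl', g1, g2, g3⟩
  · exact eq_of_mod_eq_of_lt hmod (by omega) (by omega)
  · exact absurd (by rw [← g1, ← h, h3]) (hc l' hl')
  · exact absurd (by rw [← h1, h, g3]) (hc l hl)
  · have := hτ l hl l' hl' (by rw [← h1, h, g1]) (by rw [← h2, hmod, g2])
    omega

theorem insertRun_surj (hm : 0 < m) (hi₀ : i₀ < N) {j : ℕ} (hj : j < m) :
    ∃ i < N + m, insertRun τ c m i₀ i = c ∧ i % m = j := by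
  have hd := Nat.mod_lt (j + (i₀ + 1) * (m - 1)) hm
  -- The offset into the run is `j - (i₀ + 1)` modulo `m`, with `m - 1` in the role of `-1`.
  refine ⟨i₀ + 1 + (j + (i₀ + 1) * (m - 1)) % m, by omega, insertRun_mid (by omega) (by omega), ?_⟩
  rw [Nat.add_mod_mod, show i₀ + 1 + (j + (i₀ + 1) * (m - 1)) = j + (i₀ + 1) * (1 + (m - 1)) by ring,
    show 1 + (m - 1) = m by omega, Nat.add_mul_mod_self_right, Nat.mod_eq_of_lt hj]

end insertRun

/-! ### Arrangements of hinged pieces -/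

namespace RegularPolygon

variable {k : ℕ} {r : ℝ}

theorem IsShift.symm (hk : 3 ≤ k) {P Q : RegularPolygon k r} (h : P.IsShift Q) : Q.IsShift P := by
  obtain ⟨o, ho⟩ := h
  refine ⟨o * (k - 1), fun j => ?_⟩
  rw [ho]
  apply vertex_congr hk
  rw [add_assoc, ← Nat.mul_succ, show (k - 1).succ = k by omega]
  simp [Nat.ModEq]

theorem region_eq_of_consecutive (hk : 3 ≤ k) {P Q : RegularPolygon k r} {a b : ℕ}
    (h0 : P.vertex a = Q.vertex b) (h1 : P.vertex (a + 1) = Q.vertex (b + 1)) :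
    P.region = Q.region := by
  have h := (vertex_eq_of_consecutive hk h0 h1).2
  refine IsShift.region_eq hk ⟨a * (k - 1) + b, fun j => ?_⟩
  rw [show j + (a * (k - 1) + b) = b + (j + a * (k - 1)) by ring, ← h]
  apply vertex_congr hk
  rw [show a + (j + a * (k - 1)) = j + (a * (k - 1) + a) by ring, ← Nat.mul_succ,
    show (k - 1).succ = k by omega]
  simp [Nat.ModEq]

/-- Around the vertex at which they are hinged, `Q` comes next after `P`. -/
def Follows (j : ℕ) (P Q : RegularPolygon k r) : Prop :=
  P.vertex (hingeIndex k j - 1) = Q.vertex (hingeIndex k j + 1)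

/-- Across any of its edges, a polygon can be hinged to its neighbor. -/
theorem exists_follows (hk : 3 ≤ k) (P Q : RegularPolygon k r) {a b : ℕ}
    (h0 : P.vertex a = Q.vertex (b + 1)) (h1 : P.vertex (a + 1) = Q.vertex b) :
    ∃ j < (k + 1) / 2, ∃ R : RegularPolygon k r, R.IsShift Q ∧
      P.vertex (hingeIndex k j) = R.vertex (hingeIndex k j) ∧ (Follows j P R ∨ Follows j R P) := by
  have hak : a % k < k := Nat.mod_lt _ (by omega)
  have hka : 0 < k := by omega
  have h0' : P.vertex (a % k) = Q.vertex (b + 1) := by rw [vertex_mod hk, h0]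
  have h1' : P.vertex (a % k + 1) = Q.vertex b := by
    rw [← h1]; exact vertex_congr hk P ((Nat.mod_modEq a k).add_right 1)
  generalize a % k = l at *
  -- An edge of even index starts at a hinge vertex, an edge of odd index ends at one; this decides
  -- which of the two polygons comes first.
  rcases Nat.even_or_odd' l with ⟨j, rfl | rfl⟩
  · obtain ⟨i, hi, hmod⟩ : ∃ i < (k + 1) / 2, hingeIndex k i ≡ 2 * j [MOD k] := by
      rcases Nat.eq_zero_or_pos j with rfl | hj
      -- The hinge at the vertex `0` is that of the last slot, where it has the index `k`.
      · refine ⟨(k + 1) / 2 - 1, by omega, ?_⟩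
        rw [hingeIndex, show min (2 * ((k + 1) / 2 - 1) + 2) k = k by omega]
        simp [Nat.ModEq]
      · refine ⟨j - 1, by omega, ?_⟩
        rw [hingeIndex, show min (2 * (j - 1) + 2) k = 2 * j by omega]
    have hpos : hingeIndex k i - 1 + 1 = hingeIndex k i := by rw [hingeIndex]; omega
    obtain ⟨R, hR, hv⟩ := exists_isShift hk Q (hingeIndex k i - 1) b
    refine ⟨i, hi, R, hR, ?_, Or.inr ?_⟩
    · rw [vertex_congr hk P hmod, h0']
      have := hv 1
      rw [hpos] at this
      exact this.symm
    · rw [Follows, vertex_congr hk P (hmod.add_right 1), h1']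
      exact hv 0
  · have hi : hingeIndex k j = 2 * j + 2 := by rw [hingeIndex]; omega
    obtain ⟨R, hR, hv⟩ := exists_isShift hk Q (hingeIndex k j) b
    refine ⟨j, by omega, R, hR, ?_, Or.inl ?_⟩
    · rw [hi]; rw [hi] at hv
      exact h1'.trans (hv 0).symm
    · rw [Follows, hv 1, hi]
      exact h0'

end RegularPolygon

/-- A placement of the hinged pieces that covers part of `F`, together with a motion that leads to
it from the position in which all polygons lie on `P`. The `i`-th piece belongs to the tile
`owner i`; the pieces of a tile move together. -/
structure Arrangement {n k : ℕ} {r : ℝ} (F : PolyRegular n k r) (P : RegularPolygon k r)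
    (root : Fin n) (m : ℕ) where
  tiles : Finset (Fin n)
  owner : ℕ → Fin n
  motion : ℝ → Fin n → RigidMotion
  continuous_motion : ∀ x, Continuous fun t => motion t x
  motion_zero : ∀ x, motion 0 x = (1, 0)
  isShift : ∀ x ∈ tiles, (P.move (motion 1 x)).IsShift (F.tile x)
  owner_zero : owner 0 = root
  owner_mem : ∀ i < m * tiles.card, owner i ∈ tiles
  owner_inj : ∀ i < m * tiles.card, ∀ i' < m * tiles.card,
    owner i = owner i' → i % m = i' % m → i = i'
  owner_surj : ∀ x ∈ tiles, ∀ j < m, ∃ i < m * tiles.card, owner i = x ∧ i % m = j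
  hinge : ∀ i < m * tiles.card, ∀ t,
    (motion t (owner i)).act (P.vertex (hingeIndex k (i % m))) =
      (motion t (owner ((i + 1) % (m * tiles.card)))).act (P.vertex (hingeIndex k (i % m)))
  -- The first alternative is a hinge whose tiles are glued there. In the second, a chain of such
  -- glued hinges of the same slot number runs around the point, from the tile after the hinge to
  -- the tile before it; the chain is empty for a hinge inside one tile.
  planar : ∀ i < m * tiles.card,
    (P.move (motion 1 (owner i))).Follows (i % m)
      (P.move (motion 1 (owner ((i + 1) % (m * tiles.card))))) ∨
    Relation.ReflTransGen (fun x y => ∃ l < m * tiles.card, l % m = i % m ∧ owner l = x ∧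
      owner ((l + 1) % (m * tiles.card)) = y ∧
      (P.move (motion 1 x)).Follows (i % m) (P.move (motion 1 y)))
      (owner ((i + 1) % (m * tiles.card))) (owner i)

namespace Arrangement

variable {n k : ℕ} {r : ℝ} {F : PolyRegular n k r} {P : RegularPolygon k r} {root : Fin n} {m : ℕ}

/-- The hinge `i₀` splits into one on entering the run of `c` and one on leaving it. One of these
joins `c` to `p` and is glued. The other inherits the chain of the old hinge, lengthened by the new
glued pair. Because of `hno` the old hinge has such a chain, and it was not itself a step in any
chain, so no chain is destroyed. -/
theorem exists_insert_at (A : Arrangement F P root m) (hm : 0 < m) {c : Fin n} (hc : c ∉ A.tiles)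
    {i₀ : ℕ} (hi₀ : i₀ < m * A.tiles.card) {p : Fin n} {g : RigidMotion}
    (hg : (P.move g).IsShift (F.tile c))
    (heq : (A.motion 1 p).act (P.vertex (hingeIndex k (i₀ % m))) =
      g.act (P.vertex (hingeIndex k (i₀ % m))))
    (hfol : (A.owner i₀ = p ∧ (P.move (A.motion 1 p)).Follows (i₀ % m) (P.move g)) ∨
      (A.owner ((i₀ + 1) % (m * A.tiles.card)) = p ∧
        (P.move g).Follows (i₀ % m) (P.move (A.motion 1 p))))
    (hno : ¬ (P.move (A.motion 1 (A.owner i₀))).Follows (i₀ % m)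
      (P.move (A.motion 1 (A.owner ((i₀ + 1) % (m * A.tiles.card)))))) :
    ∃ A' : Arrangement F P root m, A'.tiles = insert c A.tiles ∧
      ∀ x ∈ A.tiles, A'.motion 1 x = A.motion 1 x := by
  obtain ⟨θ, rfl⟩ := RigidMotion.exists_comp_rotation heq
  set N := m * A.tiles.card with hN
  have hN' : m * (insert c A.tiles).card = N + m := by
    rw [Finset.card_insert_of_notMem hc, mul_add, mul_one]
  have hNpos : 0 < N := by omega
  set v := P.vertex (hingeIndex k (i₀ % m)) with hv
  -- The tile `c` turns about `v` relative to `p`. At time `0` all polygons coincide, so `v` is the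
  -- hinge vertex of both.
  let M : ℝ → Fin n → RigidMotion := fun t x =>
    if x = c then (A.motion t p).comp (RigidMotion.rotation v (Circle.exp (t * θ)))
    else A.motion t x
  have hMc : ∀ t, M t c = (A.motion t p).comp (RigidMotion.rotation v (Circle.exp (t * θ))) :=
    fun t => if_pos rfl
  have hne : ∀ {x}, x ∈ A.tiles → x ≠ c := fun hx h => hc (h ▸ hx)
  have hMx : ∀ t, ∀ x ∈ A.tiles, M t x = A.motion t x := fun t x hx => if_neg (hne hx)
  have hM1 : M 1 c = (A.motion 1 p).comp (RigidMotion.rotation v (Circle.exp θ)) := by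
    rw [hMc, one_mul]
  have hsucc : ∀ i, A.owner ((i + 1) % N) ∈ A.tiles := fun i => A.owner_mem _ (Nat.mod_lt _ hNpos)
  have hMhinge : ∀ t, (M t c).act v = (A.motion t p).act v := fun t => by
    rw [hMc, RigidMotion.comp_act, RigidMotion.rotation_act_self]
  have hph : ∀ t, (A.motion t (A.owner i₀)).act v = (A.motion t p).act v ∧
      (A.motion t (A.owner ((i₀ + 1) % N))).act v = (A.motion t p).act v := by
    intro t
    have := A.hinge i₀ hi₀ t
    rcases hfol with ⟨h, -⟩ | ⟨h, -⟩
    · rw [← h]; exact ⟨rfl, this.symm⟩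
    · rw [← h]; exact ⟨this, rfl⟩
  set τ := insertRun A.owner c m i₀ with hτ
  have hmod : (i₀ + m) % m = i₀ % m := Nat.add_mod_right _ _
  have hstep : ∀ j x y, (∃ l < N, l % m = j ∧ A.owner l = x ∧ A.owner ((l + 1) % N) = y ∧
      (P.move (A.motion 1 x)).Follows j (P.move (A.motion 1 y))) →
      ∃ l < N + m, l % m = j ∧ τ l = x ∧ τ ((l + 1) % (N + m)) = y ∧
        (P.move (M 1 x)).Follows j (P.move (M 1 y)) := by
    rintro j x y ⟨l, hl, rfl, rfl, rfl, h⟩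
    -- Steps of chains are glued hinges, hence different from the broken one.
    have hl0 : l ≠ i₀ := by rintro rfl; exact hno h
    obtain ⟨l', hl', e1, e2, e3⟩ := insertRun_embed (τ := A.owner) (c := c) (m := m) hi₀ hl hl0
    refine ⟨l', hl', e1, e2, e3, ?_⟩
    rwa [hMx 1 _ (A.owner_mem l hl), hMx 1 _ (hsucc l)]
  have hold := (A.planar i₀ hi₀).resolve_left hno
  have hold' := Relation.ReflTransGen.mono (hstep (i₀ % m)) _ _ hold
  have hi₀m : i₀ + m < N + m := by omega
  refine ⟨⟨insert c A.tiles, τ, M, ?_, ?_, ?_, ?_, ?_, ?_, ?_, ?_, ?_⟩, rfl, hMx 1⟩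
  · intro x
    by_cases hx : x = c
    · subst hx
      simp only [hMc, RigidMotion.comp, RigidMotion.rotation]
      have := A.continuous_motion p
      refine (this.fst.mul (by fun_prop)).prodMk (Continuous.add (Continuous.mul ?_ ?_) this.snd)
      · exact continuous_subtype_val.comp this.fst
      · exact continuous_const.sub ((continuous_subtype_val.comp
          (by fun_prop : Continuous fun t : ℝ => Circle.exp (t * θ))).mul continuous_const)
    · simp only [M, if_neg hx]
      exact A.continuous_motion x
  · intro x
    by_cases hx : x = c
    · subst hx
      rw [hMc, A.motion_zero, zero_mul, Circle.exp_zero, RigidMotion.rotation_one,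
        RigidMotion.comp_one]
    · simp only [M, if_neg hx]
      exact A.motion_zero x
  · intro x hx
    rcases Finset.mem_insert.1 hx with rfl | hx
    · rw [hM1]; exact hg
    · rw [hMx 1 x hx]; exact A.isShift x hx
  · rw [hτ, insertRun_of_le (Nat.zero_le _), A.owner_zero]
  · intro i hi
    rw [hN'] at hi
    rcases insertRun_cases (τ := A.owner) (c := c) hm hi₀ hi with
      ⟨l, hl, -, -, e, -⟩ | ⟨-, e, -⟩ | ⟨-, e, -⟩ | ⟨e, -⟩ <;> rw [hτ, e]
    · exact Finset.mem_insert_of_mem (A.owner_mem l hl)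
    · exact Finset.mem_insert_of_mem (A.owner_mem i₀ hi₀)
    · exact Finset.mem_insert_self _ _
    · exact Finset.mem_insert_self _ _
  · intro i hi i' hi' h h'
    rw [hN'] at hi hi'
    exact insertRun_inj (fun i hi => hne (A.owner_mem i hi)) A.owner_inj hi hi' hi₀ h h'
  · intro x hx j hj
    rw [hN']
    rcases Finset.mem_insert.1 hx with rfl | hx
    · exact insertRun_surj hm hi₀ hj
    · obtain ⟨i, hi, rfl, rfl⟩ := A.owner_surj x hx j hj
      by_cases h : i = i₀
      · subst h
        exact ⟨i, by omega, insertRun_of_le le_rfl, rfl⟩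
      · obtain ⟨l', hl', e1, e2, -⟩ :=
          insertRun_embed (τ := A.owner) (c := c) (m := m) hi₀ hi h
        exact ⟨l', hl', e2, e1⟩
  · intro i hi t
    rw [hN'] at hi ⊢
    rcases insertRun_cases (τ := A.owner) (c := c) hm hi₀ hi with
      ⟨l, hl, -, e0, e1, e2⟩ | ⟨rfl, e1, e2⟩ | ⟨rfl, e1, e2⟩ | ⟨e1, e2⟩ <;> rw [hτ, e1, e2]
    · rw [e0, hMx t _ (A.owner_mem l hl), hMx t _ (hsucc l)]
      exact A.hinge l hl t
    · rw [hMhinge, hMx t _ (A.owner_mem i hi₀)]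
      exact (hph t).1
    · rw [hmod, hMhinge, hMx t _ (hsucc i₀)]
      exact (hph t).2.symm
  · intro i hi
    rw [hN'] at hi ⊢
    rcases insertRun_cases (τ := A.owner) (c := c) hm hi₀ hi with
      ⟨l, hl, -, e0, e1, e2⟩ | ⟨rfl, e1, e2⟩ | ⟨rfl, e1, e2⟩ | ⟨e1, e2⟩
    · rw [hτ, e1, e2, e0, ← hτ]
      rw [hMx 1 _ (A.owner_mem l hl), hMx 1 _ (hsucc l)]
      exact (A.planar l hl).imp_right fun h => Relation.ReflTransGen.mono (hstep (l % m)) _ _ h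
    · rw [hτ, e1, e2, ← hτ, hMx 1 _ (A.owner_mem i hi₀)]
      rcases hfol with ⟨h, hf⟩ | ⟨h, hf⟩
      · left
        rw [h, hM1]; exact hf
      · right
        -- From `c` the new chain steps to `p`, the old successor, and then follows the old chain.
        refine Relation.ReflTransGen.head ?_ hold'
        refine ⟨i + m, hi₀m, hmod, insertRun_mid (by omega) le_rfl,
          insertRun_succ_right le_rfl hi₀, ?_⟩
        rw [hM1, hMx 1 _ (hsucc i), h]; exact hf
    · rw [hτ, e1, e2, ← hτ, hmod, hMx 1 _ (hsucc i₀)]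
      rcases hfol with ⟨h, hf⟩ | ⟨h, hf⟩
      · right
        -- The old chain ends at `p`, the owner of the piece `i₀`; one more step leads to `c`.
        refine Relation.ReflTransGen.tail hold' ?_
        refine ⟨i₀, by omega, rfl, insertRun_of_le le_rfl, insertRun_enter hm hi₀, ?_⟩
        rw [hM1, hMx 1 _ (A.owner_mem i₀ hi₀), h]; exact hf
      · left
        rw [hM1, h]; exact hf
    · right
      rw [hτ, e1, e2]

/-- A tile that shares an edge with an already placed one can be added. -/
theorem exists_insert (hk : 3 ≤ k) (hr : 0 < r) (A : Arrangement F P root ((k + 1) / 2))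
    {p c : Fin n} (hp : p ∈ A.tiles) (hc : c ∉ A.tiles)
    (h : ∃ a b, (F.tile p).edge a = (F.tile c).edge b ∧
      (F.tile p).region ∩ (F.tile c).region = (F.tile p).edge a) :
    ∃ A' : Arrangement F P root ((k + 1) / 2), A'.tiles = insert c A.tiles ∧
      ∀ x ∈ A.tiles, A'.motion 1 x = A.motion 1 x := by
  obtain ⟨a, b, he, hi⟩ := h
  have hm : 0 < (k + 1) / 2 := by omega
  obtain ⟨h0, h1⟩ := RegularPolygon.vertex_eq_of_common_edge hk hr he hi
  obtain ⟨o, ho⟩ := (A.isShift p hp).symm hk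
  rw [ho] at h0 h1
  rw [show a + 1 + o = a + o + 1 by ring] at h1
  obtain ⟨j, hj, R, hR, hv, hf⟩ := RegularPolygon.exists_follows hk _ _ h0 h1
  obtain ⟨g, rfl⟩ := RegularPolygon.exists_move hr P R
  have hcard : 0 < A.tiles.card := Finset.card_pos.2 ⟨p, hp⟩
  have hpos : hingeIndex k j - 1 + 1 = hingeIndex k j := by rw [hingeIndex]; omega
  -- The place of `c` is not yet taken. If the hinge to be opened were already glued, the tile on
  -- its other side would share two consecutive vertices with the new polygon and so coincide with
  -- it.
  have hregion : ∀ x ∈ A.tiles, (P.move (A.motion 1 x)).region ≠ (P.move g).region := by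
    intro x hx e
    have h2 := F.nonOverlapping_tile hk hr (show x ≠ c by rintro rfl; exact hc hx)
    rw [← (A.isShift x hx).region_eq hk, ← hR.region_eq hk, e, NonOverlapping, inter_self] at h2
    exact (RegularPolygon.nonempty_interior_region hk hr _).ne_empty h2
  rw [RegularPolygon.vertex_move, RegularPolygon.vertex_move] at hv
  have main : ∀ i₀ < (k + 1) / 2 * A.tiles.card, i₀ % ((k + 1) / 2) = j →
      ((A.owner i₀ = p ∧ (P.move (A.motion 1 p)).Follows j (P.move g)) ∨
      (A.owner ((i₀ + 1) % ((k + 1) / 2 * A.tiles.card)) = p ∧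
        (P.move g).Follows j (P.move (A.motion 1 p)))) →
      ∃ A' : Arrangement F P root ((k + 1) / 2), A'.tiles = insert c A.tiles ∧
        ∀ x ∈ A.tiles, A'.motion 1 x = A.motion 1 x := by
    rintro i₀ hi₀ rfl hfol
    refine A.exists_insert_at hm hc hi₀ hR hv hfol fun hF => ?_
    have hh := A.hinge i₀ hi₀ 1
    have hs : A.owner ((i₀ + 1) % ((k + 1) / 2 * A.tiles.card)) ∈ A.tiles :=
      A.owner_mem _ (Nat.mod_lt _ (by positivity))
    rcases hfol with ⟨hp', hfol⟩ | ⟨hp', hfol⟩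
    · refine hregion _ hs (RegularPolygon.region_eq_of_consecutive hk
        (a := hingeIndex k (i₀ % ((k + 1) / 2))) (b := hingeIndex k (i₀ % ((k + 1) / 2))) ?_ ?_)
      · rw [RegularPolygon.vertex_move, RegularPolygon.vertex_move, ← hh, hp', hv]
      · rw [hp'] at hF
        exact hF.symm.trans hfol
    · refine hregion _ (A.owner_mem i₀ hi₀) (RegularPolygon.region_eq_of_consecutive hk
        (a := hingeIndex k (i₀ % ((k + 1) / 2)) - 1) (b := hingeIndex k (i₀ % ((k + 1) / 2)) - 1)
        ?_ ?_)
      · rw [hp'] at hF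
        exact Eq.trans hF hfol.symm
      · rw [hpos, RegularPolygon.vertex_move, RegularPolygon.vertex_move, hh, hp', hv]
  set N := (k + 1) / 2 * A.tiles.card with hN
  have hNpos : 0 < N := by positivity
  rcases hf with hf | hf
  · obtain ⟨i₀, hi₀, e1, e2⟩ := A.owner_surj p hp j hj
    exact main i₀ hi₀ e2 (Or.inl ⟨e1, hf⟩)
  -- Here `c` comes before `p`, so the link that ends at the piece of `p` in the next slot is
  -- opened; `i₁ + (N - 1)` is the cyclic predecessor.
  · obtain ⟨i₁, hi₁, e1, e2⟩ := A.owner_surj p hp ((j + 1) % ((k + 1) / 2)) (Nat.mod_lt _ hm)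
    have hsucc : ((i₁ + (N - 1)) % N + 1) % N = i₁ := by
      rw [Nat.mod_add_mod, show i₁ + (N - 1) + 1 = i₁ + N by omega, Nat.add_mod_right,
        Nat.mod_eq_of_lt hi₁]
    refine main ((i₁ + (N - 1)) % N) (Nat.mod_lt _ hNpos) ?_ (Or.inr ⟨by rw [hsucc, e1], hf⟩)
    have h3 : (i₁ + (N - 1)) % N + 1 ≡ j + 1 [MOD (k + 1) / 2] := by
      have h4 : (i₁ + (N - 1)) % N + 1 ≡ i₁ [MOD (k + 1) / 2] := by
        have : (i₁ + (N - 1)) % N + 1 ≡ i₁ [MOD N] := by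
          rw [Nat.ModEq, hsucc, Nat.mod_eq_of_lt hi₁]
        exact this.of_dvd (Dvd.intro _ rfl)
      exact h4.trans (by rw [Nat.ModEq, e2])
    have h5 := Nat.ModEq.add_right_cancel' 1 h3
    rw [h5, Nat.mod_eq_of_lt hj]

/-- A single tile. -/
theorem exists_singleton (m : ℕ) (F : PolyRegular n k r) (P : RegularPolygon k r)
    (root : Fin n) (g : RigidMotion) (hg : (P.move g).IsShift (F.tile root)) :
    ∃ A : Arrangement F P root m, A.tiles = {root} ∧ A.motion 1 root = g := by
  let M : ℝ → RigidMotion := fun t => (Circle.exp (t * (g.1 : ℂ).arg), t * g.2)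
  have hM1 : M 1 = g := by
    apply Prod.ext
    · simp [M, Circle.exp_arg]
    · simp [M]
  refine ⟨⟨{root}, fun _ => root, fun t _ => M t, ?_, ?_, ?_, rfl, ?_, ?_, ?_, ?_, ?_⟩, rfl, hM1⟩
  · intro _
    simp only [M]; fun_prop
  · intro _; simp [M]
  · intro x hx
    rw [Finset.mem_singleton] at hx
    subst hx
    rw [hM1]; exact hg
  · intro _ _; exact Finset.mem_singleton_self _
  · intro i hi i' hi' _ h
    rw [Finset.card_singleton, mul_one] at hi hi'
    rwa [Nat.mod_eq_of_lt hi, Nat.mod_eq_of_lt hi'] at h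
  · intro x hx j hj
    refine ⟨j, by simpa using hj, (Finset.mem_singleton.1 hx).symm, Nat.mod_eq_of_lt hj⟩
  · intro _ _ _; rfl
  · intro _ _
    exact Or.inr Relation.ReflTransGen.refl

end Arrangement

/-! ### Arithmetic of the slots, and the hinged cycle itself. -/

theorem hingeIndex_inj {k i j : ℕ} (hk : 3 ≤ k) (hi : i < (k + 1) / 2) (hj : j < (k + 1) / 2)
    (h : hingeIndex k i ≡ hingeIndex k j [MOD k]) : i = j := by
  have hi' : hingeIndex k i = hingeIndex k i - 1 + 1 := by rw [hingeIndex]; omega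
  have hj' : hingeIndex k j = hingeIndex k j - 1 + 1 := by rw [hingeIndex]; omega
  rw [hi', hj'] at h
  have := Nat.ModEq.eq_of_lt_of_lt (Nat.ModEq.add_right_cancel' 1 h)
    (by rw [hingeIndex]; omega) (by rw [hingeIndex]; omega)
  simp only [hingeIndex] at this
  omega

/-- The vertex where a slot ends is the one where the next slot starts; from the last slot to the
first this is `k ≡ 0`. -/
theorem two_mul_succ_mod_modEq {k : ℕ} (hk : 3 ≤ k) (i : ℕ) :
    2 * ((i + 1) % ((k + 1) / 2)) ≡ hingeIndex k (i % ((k + 1) / 2)) [MOD k] := by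
  have hi := Nat.mod_lt i (show 0 < (k + 1) / 2 by omega)
  rw [← Nat.mod_add_mod]
  generalize i % ((k + 1) / 2) = j at *
  rcases Nat.lt_or_ge (j + 1) ((k + 1) / 2) with h | h
  · rw [Nat.mod_eq_of_lt h, hingeIndex, min_eq_left (by omega)]
    exact Nat.ModEq.refl _
  · rw [show j + 1 = (k + 1) / 2 by omega, Nat.mod_self, hingeIndex, min_eq_right (by omega)]
    simp [Nat.ModEq]

theorem ne_succ_mod {m : ℕ} (hm : 2 ≤ m) (i : ℕ) : i % m ≠ (i + 1) % m := by
  intro h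
  have := Nat.ModEq.add_left_cancel' i (show i + 0 ≡ i + 1 [MOD m] from h)
  rw [Nat.ModEq, Nat.zero_mod, Nat.mod_eq_of_lt (by omega)] at this
  omega

namespace RegularPolygon

variable {k : ℕ} {r : ℝ}

/-- The pieces of the hinged dissection in the polygon `P`; each polygon is cut into `m` pieces. -/
noncomputable def piece (P : RegularPolygon k r) (m i : ℕ) : Set ℂ :=
  if i = 0 then P.rootPiece else P.slotPiece (i % m)

theorem isPiece_piece (P : RegularPolygon k r) (m i : ℕ) : P.IsPiece (i % m) (P.piece m i) := by
  by_cases h : i = 0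
  · subst h
    exact Or.inr ⟨Nat.zero_mod m, if_pos rfl⟩
  · exact Or.inl (if_neg h)

theorem image_piece (P : RegularPolygon k r) (g : RigidMotion) (m i : ℕ) :
    g.act '' P.piece m i = (P.move g).piece m i := by
  unfold piece
  split_ifs
  · exact image_rootPiece P g
  · exact image_slotPiece P g _

theorem isClosed_piece (hk : 3 ≤ k) (hr : 0 < r) (P : RegularPolygon k r) (m i : ℕ) :
    IsClosed (P.piece m i) := by
  unfold piece
  split_ifs
  · exact isClosed_rootPiece hk hr P
  · exact P.isClosed_slotPiece _

theorem exists_simplePolygon_piece (hk : 3 ≤ k) (hr : 0 < r) (P : RegularPolygon k r) (i : ℕ) :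
    ∃ Q : SimplePolygon, Q.region = P.piece ((k + 1) / 2) i ∧
      P.vertex (2 * (i % ((k + 1) / 2))) ∈ range Q.vertex ∧
      P.vertex (hingeIndex k (i % ((k + 1) / 2))) ∈ range Q.vertex := by
  by_cases h : i = 0
  · obtain ⟨Q, h1, h2, h3⟩ := exists_simplePolygon_rootPiece hk hr P
    refine ⟨Q, by rw [h1, piece, if_pos h], ?_, ?_⟩
    · rwa [h, Nat.zero_mod, mul_zero]
    · rwa [h, Nat.zero_mod]
  · obtain ⟨Q, h1, h2, h3, h4⟩ := exists_simplePolygon_slotPiece hk hr P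
      (Nat.mod_lt i (show 0 < (k + 1) / 2 by omega))
    exact ⟨Q, by rw [h1, piece, if_neg h], h2.left_mem, h3.left_mem⟩

/-- The hinged dissection, drawn with all its pieces in one polygon. -/
theorem exists_cyclicHinging (hk : 3 ≤ k) (hr : 0 < r) (P : RegularPolygon k r) (s : ℕ) :
    ∃ H : CyclicHinging ((k + 1) / 2 * s),
      (∀ i, (H.piece i).region = P.piece ((k + 1) / 2) i) ∧
      ∀ i, H.hinge i = P.vertex (hingeIndex k (i % ((k + 1) / 2))) := by
  choose Q h1 h2 h3 using exists_simplePolygon_piece hk hr P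
  refine ⟨⟨fun i => Q i, fun i => P.vertex (hingeIndex k (i % ((k + 1) / 2))), fun i => h3 i,
    fun i => ?_⟩, fun i => h1 i, fun i => rfl⟩
  have h := h2 (finRotate _ i)
  rw [val_finRotate, Nat.mod_mod_of_dvd _ (Dvd.intro _ rfl)] at h
  rwa [vertex_congr hk P (two_mul_succ_mod_modEq hk i), ← val_finRotate] at h

end RegularPolygon

/-! ### Arcs of directions around a hinge in the final position. -/

namespace Arrangement

variable {n k : ℕ} {r : ℝ} {F : PolyRegular n k r} {P : RegularPolygon k r} {root : Fin n} {m : ℕ}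

/-- The final position of the polygon that becomes the tile `x`. -/
noncomputable def polygon (A : Arrangement F P root m) (x : Fin n) : RegularPolygon k r :=
  P.move (A.motion 1 x)

/-- The final position of the `i`-th piece. -/
noncomputable def placedPiece (A : Arrangement F P root m) (i : ℕ) : Set ℂ :=
  (A.polygon (A.owner i)).piece m i

/-- The index of the piece after the `i`-th one. -/
def next (A : Arrangement F P root m) (i : ℕ) : ℕ := (i + 1) % (m * A.tiles.card)

/-- The final position of the hinge between the `i`-th piece and the next one. -/
noncomputable def hingePoint (A : Arrangement F P root m) (i : ℕ) : ℂ :=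
  (A.polygon (A.owner i)).vertex (hingeIndex k (i % m))

/-- The tiles of the `i`-th and of the next piece are glued along an edge at their hinge. -/
def Adjacent (A : Arrangement F P root m) (i : ℕ) : Prop :=
  (A.polygon (A.owner i)).Follows (i % m) (A.polygon (A.owner (A.next i)))

theorem next_mod (A : Arrangement F P root m) (i : ℕ) : A.next i % m = (i + 1) % m :=
  Nat.mod_mod_of_dvd _ (Dvd.intro _ rfl)

theorem next_lt (A : Arrangement F P root m) {i : ℕ} (hi : i < m * A.tiles.card) :
    A.next i < m * A.tiles.card := Nat.mod_lt _ (by omega)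

theorem next_inj (A : Arrangement F P root m) {i j : ℕ} (hi : i < m * A.tiles.card)
    (hj : j < m * A.tiles.card) (h : A.next i = A.next j) : i = j :=
  Nat.ModEq.eq_of_lt_of_lt (Nat.ModEq.add_right_cancel' 1 h) hi hj

theorem hingePoint_eq (A : Arrangement F P root m) {i : ℕ} (hi : i < m * A.tiles.card) :
    (A.polygon (A.owner (A.next i))).vertex (hingeIndex k (i % m)) = A.hingePoint i := by
  rw [hingePoint, polygon, polygon, RegularPolygon.vertex_move, RegularPolygon.vertex_move]
  exact (A.hinge i hi 1).symm

theorem region_polygon (hk : 3 ≤ k) (A : Arrangement F P root m) {x : Fin n} (hx : x ∈ A.tiles) :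
    (A.polygon x).region = (F.tile x).region := (A.isShift x hx).region_eq hk

theorem nonOverlapping_polygon (hk : 3 ≤ k) (hr : 0 < r) (A : Arrangement F P root m) {x y : Fin n}
    (hx : x ∈ A.tiles) (hy : y ∈ A.tiles) (hxy : x ≠ y) :
    NonOverlapping (A.polygon x).region (A.polygon y).region := by
  rw [A.region_polygon hk hx, A.region_polygon hk hy]
  exact F.nonOverlapping_tile hk hr hxy

theorem isClosed_placedPiece (hk : 3 ≤ k) (hr : 0 < r) (A : Arrangement F P root m) (i : ℕ) :
    IsClosed (A.placedPiece i) := RegularPolygon.isClosed_piece hk hr _ _ _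

theorem cell_end_subset (hk : 3 ≤ k) (A : Arrangement F P root ((k + 1) / 2)) (i : ℕ) :
    (A.polygon (A.owner i)).cell (hingeIndex k (i % ((k + 1) / 2)) - 1) ⊆ A.placedPiece i :=
  (RegularPolygon.cell_subset_slotPiece_end _ (Nat.mod_lt i (by omega))).trans
    (RegularPolygon.isPiece_piece _ _ i).slotPiece_subset

theorem cell_start_subset (hk : 3 ≤ k) (A : Arrangement F P root ((k + 1) / 2)) (i : ℕ) :
    (A.polygon (A.owner (A.next i))).cell (hingeIndex k (i % ((k + 1) / 2))) ⊆
      A.placedPiece (A.next i) := by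
  rw [← RegularPolygon.cell_congr hk _ (two_mul_succ_mod_modEq hk i), ← next_mod A]
  exact (RegularPolygon.cell_subset_slotPiece_start _ (Nat.mod_lt _ (by omega))).trans
    (RegularPolygon.isPiece_piece _ _ _).slotPiece_subset

theorem sameArc_placedPiece_end (hk : 3 ≤ k) (hr : 0 < r)
    (A : Arrangement F P root ((k + 1) / 2)) (i : ℕ) {S : Set ℂ} (hS : A.placedPiece i ⊆ S)
    {γ δ : ℝ} (hγ : PointsInto (A.placedPiece i) (A.hingePoint i) γ)
    (hδ : PointsInto ((A.polygon (A.owner i)).cell (hingeIndex k (i % ((k + 1) / 2)) - 1))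
      (A.hingePoint i) δ) : SameArc S (A.hingePoint i) γ δ :=
  RegularPolygon.sameArc_end hk hr (Nat.mod_lt i (by omega)) (RegularPolygon.isPiece_piece _ _ i)
    hS hγ hδ

theorem sameArc_placedPiece_start (hk : 3 ≤ k) (hr : 0 < r)
    (A : Arrangement F P root ((k + 1) / 2)) {i : ℕ} (hi : i < (k + 1) / 2 * A.tiles.card)
    {S : Set ℂ} (hS : A.placedPiece (A.next i) ⊆ S)
    {γ δ : ℝ} (hγ : PointsInto (A.placedPiece (A.next i)) (A.hingePoint i) γ)
    (hδ : PointsInto ((A.polygon (A.owner (A.next i))).cell (hingeIndex k (i % ((k + 1) / 2))))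
      (A.hingePoint i) δ) : SameArc S (A.hingePoint i) γ δ := by
  have hmod := two_mul_succ_mod_modEq hk i
  rw [← next_mod A] at hmod
  rw [← RegularPolygon.cell_congr hk _ hmod] at hδ
  rw [← A.hingePoint_eq hi, ← RegularPolygon.vertex_congr hk _ hmod] at hγ hδ ⊢
  exact RegularPolygon.sameArc_start hk hr (Nat.mod_lt _ (by omega))
    (RegularPolygon.isPiece_piece _ _ _) hS hγ hδ

theorem exists_pointsInto_cell (hk : 3 ≤ k) (hr : 0 < r) (Q : RegularPolygon k r) (i : ℕ) :
    ∃ θ, PointsInto (Q.cell i) (Q.vertex i) θ :=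
  (Q.convex_cell i).exists_pointsInto (Q.vertex_notMem_interior_cell hk hr i) (Q.vertex_mem_cell i)
    (Q.nonempty_interior_cell hk hr i)

theorem exists_pointsInto_cell_succ (hk : 3 ≤ k) (hr : 0 < r) (Q : RegularPolygon k r) (i : ℕ) :
    ∃ θ, PointsInto (Q.cell i) (Q.vertex (i + 1)) θ :=
  (Q.convex_cell i).exists_pointsInto (Q.vertex_succ_notMem_interior_cell hk hr i)
    (Q.vertex_succ_mem_cell i) (Q.nonempty_interior_cell hk hr i)

theorem hingeIndex_pred_succ (hk : 3 ≤ k) (j : ℕ) : hingeIndex k j - 1 + 1 = hingeIndex k j := by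
  rw [hingeIndex]; omega

theorem sameArc_of_follows (hk : 3 ≤ k) (hr : 0 < r) {Q R : RegularPolygon k r} {j : ℕ} {S : Set ℂ}
    {γ δ : ℝ} (hv : Q.vertex (hingeIndex k j) = R.vertex (hingeIndex k j)) (hf : Q.Follows j R)
    (hno : NonOverlapping Q.region R.region) (hQ : Q.cell (hingeIndex k j - 1) ⊆ S)
    (hR : R.cell (hingeIndex k j) ⊆ S)
    (hγ : PointsInto (Q.cell (hingeIndex k j - 1)) (Q.vertex (hingeIndex k j)) γ)
    (hδ : PointsInto (R.cell (hingeIndex k j)) (Q.vertex (hingeIndex k j)) δ) :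
    SameArc S (Q.vertex (hingeIndex k j)) γ δ := by
  rw [RegularPolygon.Follows] at hf
  obtain ⟨h, hh⟩ : ∃ h, hingeIndex k j = h + 1 := ⟨_, (hingeIndex_pred_succ hk j).symm⟩
  rw [hh] at hv hQ hR hγ hδ hf ⊢
  rw [Nat.add_sub_cancel] at hf hQ hγ
  exact RegularPolygon.sameArc_cell_of_common_edge hk hr hv hf hno hQ hR hγ hδ

theorem owner_ne_of_adjacent (hk : 3 ≤ k) (hr : 0 < r) (A : Arrangement F P root m) {i : ℕ}
    (h : A.Adjacent i) : A.owner i ≠ A.owner (A.next i) := by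
  intro e
  rw [Adjacent, ← e, RegularPolygon.Follows] at h
  have := RegularPolygon.vertex_inj hk hr _ h
  rw [show hingeIndex k (i % m) + 1 = hingeIndex k (i % m) - 1 + 2 by
    have := hingeIndex_pred_succ hk (i % m); omega] at this
  exact RegularPolygon.not_modEq_add _ two_pos (by omega) this.symm

/-- The arc turns inside the first piece to its last cell, crosses the glued edge into the first
cell of the next piece, and turns on inside that piece. -/
theorem sameArc_of_adjacent (hk : 3 ≤ k) (hr : 0 < r) (A : Arrangement F P root ((k + 1) / 2))
    {i : ℕ} (hi : i < (k + 1) / 2 * A.tiles.card) (h : A.Adjacent i) {S : Set ℂ}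
    (h0 : A.placedPiece i ⊆ S) (h1 : A.placedPiece (A.next i) ⊆ S) {γ δ : ℝ}
    (hγ : PointsInto (A.placedPiece i) (A.hingePoint i) γ)
    (hδ : PointsInto (A.placedPiece (A.next i)) (A.hingePoint i) δ) :
    SameArc S (A.hingePoint i) γ δ := by
  obtain ⟨ε, hε⟩ := exists_pointsInto_cell_succ hk hr (A.polygon (A.owner i))
    (hingeIndex k (i % ((k + 1) / 2)) - 1)
  rw [hingeIndex_pred_succ hk] at hε
  obtain ⟨ε', hε'⟩ := exists_pointsInto_cell hk hr (A.polygon (A.owner (A.next i)))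
    (hingeIndex k (i % ((k + 1) / 2)))
  rw [A.hingePoint_eq hi] at hε'
  refine (A.sameArc_placedPiece_end hk hr i h0 hγ hε).trans (SameArc.trans ?_
    (A.sameArc_placedPiece_start hk hr hi h1 hδ hε').symm)
  exact sameArc_of_follows hk hr (A.hingePoint_eq hi).symm h
    (A.nonOverlapping_polygon hk hr (A.owner_mem _ hi) (A.owner_mem _ (A.next_lt hi))
      (A.owner_ne_of_adjacent hk hr h))
    ((A.cell_end_subset hk i).trans h0) ((A.cell_start_subset hk i).trans h1) hε hε'

/-- The arc follows the chain given by `planar`. In each tile of the chain it turns across the spoke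
between the cells `j` and `j - 1`, then across the glued edge into the next tile. Only pieces at
glued hinges at this point are used besides the two given ones, so `S` needs to contain no others.
-/
theorem sameArc_of_not_adjacent (hk : 3 ≤ k) (hr : 0 < r) (A : Arrangement F P root ((k + 1) / 2))
    {i : ℕ} (hi : i < (k + 1) / 2 * A.tiles.card) (h : ¬ A.Adjacent i) {S : Set ℂ}
    (h0 : A.placedPiece i ⊆ S) (h1 : A.placedPiece (A.next i) ⊆ S)
    (hS : ∀ l < (k + 1) / 2 * A.tiles.card, l % ((k + 1) / 2) = i % ((k + 1) / 2) → A.Adjacent l →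
      A.hingePoint l = A.hingePoint i → A.placedPiece l ⊆ S ∧ A.placedPiece (A.next l) ⊆ S)
    {γ δ : ℝ} (hγ : PointsInto (A.placedPiece i) (A.hingePoint i) γ)
    (hδ : PointsInto (A.placedPiece (A.next i)) (A.hingePoint i) δ) :
    SameArc S (A.hingePoint i) γ δ := by
  have hchain := (A.planar i hi).resolve_left h
  set j := hingeIndex k (i % ((k + 1) / 2)) with hj
  set p := A.hingePoint i with hp
  have hjj : j - 1 + 1 = j := hingeIndex_pred_succ hk _
  have turn : ∀ Q : RegularPolygon k r, Q.vertex j = p → Q.cell (j - 1) ⊆ S → Q.cell j ⊆ S →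
      ∀ γ δ, PointsInto (Q.cell (j - 1)) p γ → PointsInto (Q.cell j) p δ → SameArc S p γ δ := by
    intro Q hQ h0 h1 γ δ hγ hδ
    rw [← hQ] at hγ hδ ⊢
    have := Q.sameArc_cell_succ hk hr (j - 1) (S := S) (γ := γ) (δ := δ)
    rw [hjj] at this
    exact this h0 h1 hγ hδ
  -- Induction along the chain: the arc has reached the cell `j` of the polygon `x`, the one on the
  -- far side of the spoke.
  have key : ∀ x, Relation.ReflTransGen (fun x y => ∃ l < (k + 1) / 2 * A.tiles.card,
      l % ((k + 1) / 2) = i % ((k + 1) / 2) ∧ A.owner l = x ∧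
        A.owner ((l + 1) % ((k + 1) / 2 * A.tiles.card)) = y ∧
        (P.move (A.motion 1 x)).Follows (i % ((k + 1) / 2)) (P.move (A.motion 1 y)))
      (A.owner ((i + 1) % ((k + 1) / 2 * A.tiles.card))) x →
      (A.polygon x).vertex j = p ∧ (A.polygon x).cell j ⊆ S ∧
        ∃ ε, PointsInto ((A.polygon x).cell j) p ε ∧ SameArc S p δ ε := by
    intro x hx
    induction hx with
    | refl =>
      have e : (A.polygon (A.owner (A.next i))).vertex j = p := A.hingePoint_eq hi
      obtain ⟨ε, hε⟩ := exists_pointsInto_cell hk hr (A.polygon (A.owner (A.next i))) j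
      rw [e] at hε
      exact ⟨e, (A.cell_start_subset hk i).trans h1, ε, hε,
        A.sameArc_placedPiece_start hk hr hi h1 hδ hε⟩
    | tail _ hstep ih =>
      obtain ⟨l, hl, hmod, rfl, rfl, hf⟩ := hstep
      obtain ⟨e, hcell, ε, hε, harc⟩ := ih
      have hadj : A.Adjacent l := by rw [Adjacent, hmod]; exact hf
      have hlp : A.hingePoint l = p := by rw [hingePoint, hmod]; exact e
      obtain ⟨hl0, hl1⟩ := hS l hl hmod hadj hlp
      have e' : (A.polygon (A.owner (A.next l))).vertex j = p := by
        rw [← hlp, ← A.hingePoint_eq hl, hmod]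
      have c0 := (A.cell_end_subset hk l).trans hl0
      have c1 := (A.cell_start_subset hk l).trans hl1
      rw [hmod] at c0 c1
      obtain ⟨ε₁, hε₁⟩ := exists_pointsInto_cell_succ hk hr (A.polygon (A.owner l)) (j - 1)
      rw [hjj, e] at hε₁
      obtain ⟨ε₂, hε₂⟩ := exists_pointsInto_cell hk hr (A.polygon (A.owner (A.next l))) j
      rw [e'] at hε₂
      refine ⟨e', c1, ε₂, hε₂, harc.trans ((turn _ e c0 hcell _ _ hε₁ hε).symm.trans ?_)⟩
      rw [← e] at hε₁ hε₂ ⊢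
      exact sameArc_of_follows hk hr (e.trans e'.symm) hf
        (A.nonOverlapping_polygon hk hr (A.owner_mem _ hl) (A.owner_mem _ (A.next_lt hl))
          (A.owner_ne_of_adjacent hk hr hadj)) c0 c1 hε₁ hε₂
  obtain ⟨e, hcell, ε, hε, harc⟩ := key _ hchain
  have c0 := (A.cell_end_subset hk i).trans h0
  obtain ⟨ε₁, hε₁⟩ := exists_pointsInto_cell_succ hk hr (A.polygon (A.owner i)) (j - 1)
  rw [hjj, e] at hε₁
  exact (A.sameArc_placedPiece_end hk hr i h0 hγ hε₁).trans
    ((turn _ e c0 hcell _ _ hε₁ hε).trans harc.symm)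

end Arrangement

namespace RegularPolygon

variable {k : ℕ} {r : ℝ}

theorem piece_subset (hk : 3 ≤ k) (P : RegularPolygon k r) (m i : ℕ) :
    P.piece m i ⊆ P.region ∪ if i = 0 then P.flip.region else ∅ := by
  unfold piece
  split_ifs with h
  · exact union_subset_union_left _ (P.slotPiece_subset_region hk 0)
  · exact (P.slotPiece_subset_region hk _).trans subset_union_left

end RegularPolygon

/-! ### The final position: no overlap, full cover, no crossing. -/

namespace Arrangement

variable {n k : ℕ} {r : ℝ} {F : PolyRegular n k r} {P : RegularPolygon k r} {root : Fin n} {m : ℕ}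

/-- The root piece covers the remaining tile `L`. -/
def Covers (A : Arrangement F P root m) (L : Fin n) : Prop :=
  L ∉ A.tiles ∧ (A.polygon root).flip.region = (F.tile L).region

/-- Only the piece `0` reaches beyond its own tile, into `L`, where no other piece lies. By symmetry
it is enough to let the second index be nonzero. -/
theorem nonOverlapping_of_ne_zero (hk : 3 ≤ k) (hr : 0 < r) (A : Arrangement F P root m)
    {L : Fin n} (hL : A.Covers L) {i i' : ℕ} (hi : i < m * A.tiles.card)
    (hi' : i' < m * A.tiles.card) (h : i ≠ i') (h0 : i' ≠ 0) :
    NonOverlapping (A.placedPiece i) (A.placedPiece i') := by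
  have e' : A.placedPiece i' = (A.polygon (A.owner i')).slotPiece (i' % m) := if_neg h0
  have hsub : A.placedPiece i' ⊆ (F.tile (A.owner i')).region := by
    rw [e', ← A.region_polygon hk (A.owner_mem _ hi')]
    exact RegularPolygon.slotPiece_subset_region hk _ _
  have hslot : NonOverlapping ((A.polygon (A.owner i)).slotPiece (i % m)) (A.placedPiece i') := by
    by_cases ho : A.owner i = A.owner i'
    · rw [e', ← ho]
      exact RegularPolygon.nonOverlapping_slotPiece hk hr _ fun e =>
        h (A.owner_inj i hi i' hi' ho e)
    · rw [e']
      exact (A.nonOverlapping_polygon hk hr (A.owner_mem _ hi) (A.owner_mem _ hi') ho).mono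
        (RegularPolygon.slotPiece_subset_region hk _ _)
        (RegularPolygon.slotPiece_subset_region hk _ _)
  by_cases hi0 : i = 0
  · subst hi0
    rw [Nat.zero_mod] at hslot
    rw [show A.placedPiece 0 = (A.polygon (A.owner 0)).slotPiece 0 ∪
      (A.polygon (A.owner 0)).flip.region by
        rw [placedPiece, RegularPolygon.piece, if_pos rfl]; rfl]
    refine hslot.union_left ?_ (RegularPolygon.isClosed_slotPiece _ _)
      (A.isClosed_placedPiece hk hr _)
    rw [A.owner_zero, hL.2]
    refine (F.nonOverlapping_tile hk hr ?_).mono Subset.rfl hsub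
    rintro rfl
    exact hL.1 (A.owner_mem i' hi')
  · have e : A.placedPiece i = (A.polygon (A.owner i)).slotPiece (i % m) := if_neg hi0
    rwa [e]

theorem nonOverlapping_placedPiece (hk : 3 ≤ k) (hr : 0 < r) (A : Arrangement F P root m)
    {L : Fin n} (hL : A.Covers L) {i i' : ℕ} (hi : i < m * A.tiles.card)
    (hi' : i' < m * A.tiles.card) (h : i ≠ i') :
    NonOverlapping (A.placedPiece i) (A.placedPiece i') := by
  by_cases h0 : i' = 0
  · exact (A.nonOverlapping_of_ne_zero hk hr hL hi' hi h.symm fun e => h (e.trans h0.symm)).symm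
  · exact A.nonOverlapping_of_ne_zero hk hr hL hi hi' h h0

theorem iUnion_placedPiece (hk : 3 ≤ k) (hr : 0 < r) (A : Arrangement F P root ((k + 1) / 2))
    {L : Fin n} (hL : A.Covers L) (hroot : root ∈ A.tiles) (hall : ∀ x, x ≠ L → x ∈ A.tiles) :
    ⋃ i < (k + 1) / 2 * A.tiles.card, A.placedPiece i = F.region := by
  have hpos : 0 < (k + 1) / 2 * A.tiles.card :=
    Nat.mul_pos (by omega) (Finset.card_pos.2 ⟨root, hroot⟩)
  apply Subset.antisymm
  · refine iUnion₂_subset fun i hi => (RegularPolygon.piece_subset hk _ _ i).trans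
      (union_subset ?_ ?_)
    · rw [A.region_polygon hk (A.owner_mem i hi)]
      exact subset_iUnion (fun x => (F.tile x).region) _
    · split_ifs with h
      · rw [h, A.owner_zero, hL.2]
        exact subset_iUnion (fun x => (F.tile x).region) _
      · exact empty_subset _
  · refine iUnion_subset fun x => ?_
    by_cases hx : x = L
    · rw [hx, ← hL.2]
      refine Subset.trans ?_ (subset_iUnion₂ (s := fun i _ => A.placedPiece i) 0 hpos)
      rw [placedPiece, A.owner_zero, RegularPolygon.piece, if_pos rfl]
      exact subset_union_right
    · rw [← A.region_polygon hk (hall x hx), ← RegularPolygon.iUnion_slotPiece hk hr]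
      refine iUnion₂_subset fun j hj => ?_
      obtain ⟨i, hi, rfl, rfl⟩ := A.owner_surj x (hall x hx) j hj
      exact (RegularPolygon.isPiece_piece _ _ i).slotPiece_subset.trans
        (subset_iUnion₂ (s := fun i _ => A.placedPiece i) i hi)

/-- The two pieces at a glued hinge already contain an arc that joins them, and two different pieces
cannot interrupt it. -/
theorem not_hingesCross_of_adjacent (hk : 3 ≤ k) (hr : 0 < r)
    (A : Arrangement F P root ((k + 1) / 2)) {L : Fin n} (hL : A.Covers L) {i j : ℕ}
    (hi : i < (k + 1) / 2 * A.tiles.card) (hj : j < (k + 1) / 2 * A.tiles.card)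
    (h1 : i ≠ j) (h2 : i ≠ A.next j) (h3 : A.next i ≠ j) (h4 : A.next i ≠ A.next j)
    (h : A.Adjacent j) :
    ¬ HingesCross (A.hingePoint j) (A.placedPiece i) (A.placedPiece (A.next i))
      (A.placedPiece j) (A.placedPiece (A.next j)) := by
  have hno : ∀ l < (k + 1) / 2 * A.tiles.card, l ≠ j → l ≠ A.next j →
      NonOverlapping (A.placedPiece l) (A.placedPiece j ∪ A.placedPiece (A.next j)) :=
    fun l hl e e' => NonOverlapping.union_right (A.nonOverlapping_placedPiece hk hr hL hl hj e)
      (A.nonOverlapping_placedPiece hk hr hL hl (A.next_lt hj) e') (A.isClosed_placedPiece hk hr _)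
      (A.isClosed_placedPiece hk hr _)
  exact not_hingesCross (hno i hi h1 h2) (hno _ (A.next_lt hi) h3 h4) fun γ δ hγ hδ =>
    A.sameArc_of_adjacent hk hr hj h subset_union_left subset_union_right hγ hδ

/-- Two pieces of one tile with hinges at the same point are in the same slot. -/
theorem mod_eq_of_owner_eq (hk : 3 ≤ k) (hr : 0 < r) (A : Arrangement F P root ((k + 1) / 2))
    {x : Fin n} {i j : ℕ}
    (h : (A.polygon x).vertex (hingeIndex k (i % ((k + 1) / 2))) =
      (A.polygon x).vertex (hingeIndex k (j % ((k + 1) / 2)))) :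
    i % ((k + 1) / 2) = j % ((k + 1) / 2) :=
  hingeIndex_inj hk (Nat.mod_lt _ (by omega)) (Nat.mod_lt _ (by omega))
    (RegularPolygon.vertex_inj hk hr _ h)

/-- Otherwise the two hinges of the piece `j` would be the same vertex of its tile, although they
belong to successive slots. -/
theorem next_ne_of_hingePoint_eq (hk : 3 ≤ k) (hr : 0 < r)
    (A : Arrangement F P root ((k + 1) / 2)) {i j : ℕ} (hi : i < (k + 1) / 2 * A.tiles.card)
    (h : A.hingePoint i = A.hingePoint j) : A.next i ≠ j := by
  intro e
  rw [← A.hingePoint_eq hi, e, hingePoint] at h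
  have := A.mod_eq_of_owner_eq hk hr h
  rw [← e, A.next_mod] at this
  exact ne_succ_mod (by omega) i this

/-- The arc for the hinge `j` runs through glued hinges at the same point. The hinge `i` is not
glued, so it is none of these, and no piece at one of them is the piece `i` or the one after it:
such a piece would have both its hinges at one point, or share its incoming hinge with another.
Hence the arc lies in the union of all pieces except those two. -/
theorem not_hingesCross_of_not_adjacent (hk : 3 ≤ k) (hr : 0 < r)
    (A : Arrangement F P root ((k + 1) / 2)) {L : Fin n} (hL : A.Covers L) {i j : ℕ}
    (hi : i < (k + 1) / 2 * A.tiles.card) (hj : j < (k + 1) / 2 * A.tiles.card)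
    (h1 : i ≠ j) (h2 : i ≠ A.next j) (h3 : A.next i ≠ j) (h4 : A.next i ≠ A.next j)
    (hp : A.hingePoint i = A.hingePoint j) (hai : ¬ A.Adjacent i) (haj : ¬ A.Adjacent j) :
    ¬ HingesCross (A.hingePoint j) (A.placedPiece i) (A.placedPiece (A.next i))
      (A.placedPiece j) (A.placedPiece (A.next j)) := by
  set T := {l | l < (k + 1) / 2 * A.tiles.card ∧ l ≠ i ∧ l ≠ A.next i} with hT
  have hfin : T.Finite := (finite_lt_nat _).subset fun l hl => hl.1
  have hclosed : IsClosed (⋃ l ∈ T, A.placedPiece l) :=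
    hfin.isClosed_biUnion fun l _ => A.isClosed_placedPiece hk hr l
  have hsub : ∀ l ∈ T, A.placedPiece l ⊆ ⋃ l ∈ T, A.placedPiece l := fun l hl =>
    subset_biUnion_of_mem (u := A.placedPiece) hl
  have hno : ∀ l < (k + 1) / 2 * A.tiles.card, l ∉ T →
      NonOverlapping (A.placedPiece l) (⋃ l ∈ T, A.placedPiece l) := fun l hl hlT =>
    (NonOverlapping.biUnion_left hfin (fun l _ => A.isClosed_placedPiece hk hr l)
      (A.isClosed_placedPiece hk hr l) fun x hx =>
        A.nonOverlapping_placedPiece hk hr hL hx.1 hl fun e => hlT (e ▸ hx)).symm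
  refine not_hingesCross (hno i hi fun h => h.2.1 rfl) (hno _ (A.next_lt hi) fun h => h.2.2 rfl)
    fun γ δ hγ hδ => A.sameArc_of_not_adjacent hk hr hj haj (hsub j ⟨hj, h1.symm, h3.symm⟩)
      (hsub _ ⟨A.next_lt hj, h2.symm, h4.symm⟩) (fun l hl _ hl1 hl2 => ?_) hγ hδ
  have hli : A.hingePoint l = A.hingePoint i := hl2.trans hp.symm
  have hne : l ≠ i := by rintro rfl; exact hai hl1
  refine ⟨hsub l ⟨hl, hne, (A.next_ne_of_hingePoint_eq hk hr hi hli.symm).symm⟩,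
    hsub _ ⟨A.next_lt hl, A.next_ne_of_hingePoint_eq hk hr hl hli, fun e => hne
      (A.next_inj hl hi e)⟩⟩

theorem not_hingesCross_placedPiece (hk : 3 ≤ k) (hr : 0 < r)
    (A : Arrangement F P root ((k + 1) / 2)) {L : Fin n} (hL : A.Covers L) {i j : ℕ}
    (hi : i < (k + 1) / 2 * A.tiles.card) (hj : j < (k + 1) / 2 * A.tiles.card)
    (h1 : i ≠ j) (h2 : i ≠ A.next j) (h3 : A.next i ≠ j) (h4 : A.next i ≠ A.next j)
    (hp : A.hingePoint i = A.hingePoint j) :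
    ¬ HingesCross (A.hingePoint i) (A.placedPiece i) (A.placedPiece (A.next i))
      (A.placedPiece j) (A.placedPiece (A.next j)) := by
  by_cases haj : A.Adjacent j
  · rw [hp]
    exact A.not_hingesCross_of_adjacent hk hr hL hi hj h1 h2 h3 h4 haj
  by_cases hai : A.Adjacent i
  · exact fun h => A.not_hingesCross_of_adjacent hk hr hL hj hi h1.symm h3.symm h2.symm h4.symm hai
      h.swap
  · rw [hp]
    exact A.not_hingesCross_of_not_adjacent hk hr hL hi hj h1 h2 h3 h4 hp hai haj

/-- A complete arrangement yields a final position of the hinged pieces. -/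
theorem rotatesInto (hk : 3 ≤ k) (hr : 0 < r) (A : Arrangement F P root ((k + 1) / 2))
    {L : Fin n} (hL : A.Covers L) (hroot : root ∈ A.tiles) (hall : ∀ x, x ≠ L → x ∈ A.tiles)
    {H : CyclicHinging ((k + 1) / 2 * A.tiles.card)}
    (hpiece : ∀ i, (H.piece i).region = P.piece ((k + 1) / 2) i)
    (hhinge : ∀ i, H.hinge i = P.vertex (hingeIndex k (i % ((k + 1) / 2)))) :
    H.RotatesInto F.region := by
  let g : ℝ → Fin ((k + 1) / 2 * A.tiles.card) → RigidMotion := fun t i => A.motion t (A.owner i)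
  have hplaced : ∀ i, H.placed (g 1) i = A.placedPiece i := fun i => by
    rw [CyclicHinging.placed, hpiece, RegularPolygon.image_piece]; rfl
  have hpoint : ∀ i, (g 1 i).act (H.hinge i) = A.hingePoint i := fun i => by
    rw [hhinge, hingePoint, polygon, RegularPolygon.vertex_move]
  have hnext : ∀ i, (finRotate _ i : ℕ) = A.next i := val_finRotate
  have hne : ∀ {i j : Fin ((k + 1) / 2 * A.tiles.card)}, i ≠ j → (i : ℕ) ≠ j :=
    fun h e => h (Fin.ext e)
  refine ⟨g 1, ?_, ?_, ?_, ?_⟩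
  · refine JoinedIn.ofLine (f := g) (Continuous.continuousOn
      (continuous_pi fun i => A.continuous_motion _)) (funext fun i => A.motion_zero _) rfl ?_
    rintro _ ⟨t, -, rfl⟩ i
    rw [hhinge]
    simp only [g, hnext]
    exact A.hinge i i.2 t
  · intro i j hij
    rw [hplaced, hplaced]
    exact (A.nonOverlapping_placedPiece hk hr hL i.2 j.2 (hne hij)).disjoint_interior
  · rw [← A.iUnion_placedPiece hk hr hL hroot hall]
    simp only [hplaced]
    ext z
    simp only [mem_iUnion, exists_prop]
    exact ⟨fun ⟨i, hi⟩ => ⟨i, i.2, hi⟩, fun ⟨i, hi, h⟩ => ⟨⟨i, hi⟩, h⟩⟩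
  · intro i j h1 h2 h3 h4 hp
    replace h2 := hne h2
    replace h3 := hne h3
    replace h4 := hne h4
    rw [hpoint, hpoint] at hp
    rw [hpoint, hplaced, hplaced, hplaced, hplaced]
    rw [hnext] at *
    rw [hnext] at *
    exact A.not_hingesCross_placedPiece hk hr hL i.2 j.2 (hne h1) h2 h3 h4 hp

end Arrangement

/-! ### The dual graph -/

/-- The ball is homeomorphic to the plane, and the complement of a countable set in a real vector
space of dimension at least two is connected. -/
theorem isConnected_ball_diff (p : ℂ) {ε : ℝ} (hε : 0 < ε) {V : Set ℂ} (hV : V.Countable) :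
    IsConnected (Metric.ball p ε \ V) := by
  let e := OpenPartialHomeomorph.univBall p ε
  have hs : e.source = univ := OpenPartialHomeomorph.univBall_source p ε
  have ht : e.target = Metric.ball p ε := OpenPartialHomeomorph.univBall_target p hε
  have hinj : Function.Injective e := by
    rw [← injOn_univ, ← hs]; exact e.injOn
  have hrange : range e = Metric.ball p ε := by
    rw [← image_univ, ← hs, e.image_source_eq_target, ht]
  have h : e '' (e ⁻¹' V)ᶜ = Metric.ball p ε \ V := by
    rw [← preimage_compl, image_preimage_eq_inter_range, hrange, inter_comm, sdiff_eq]
  rw [← h]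
  refine (Set.Countable.isConnected_compl_of_one_lt_rank ?_ (hV.preimage hinj)).image _
    (OpenPartialHomeomorph.continuous_univBall p ε).continuousOn
  rw [Complex.rank_real_complex]
  norm_num

/-- Two closed sets whose union has connected interior do not meet in a countable set only. -/
theorem not_countable_inter_of_isConnected {A B : Set ℂ} (hA : IsClosed A) (hB : IsClosed B)
    (hA' : (interior A).Nonempty) (hB' : (interior B).Nonempty)
    (h : IsConnected (interior (A ∪ B))) : ¬ (A ∩ B).Countable := by
  intro hV
  set V := A ∩ B with hVdef
  -- The points near which everything outside `V` belongs to `S`.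
  let D : Set ℂ → Set ℂ := fun S => {p | ∃ ε > 0, Metric.ball p ε \ V ⊆ S}
  have hopen : ∀ S, IsOpen (D S) := by
    intro S
    refine Metric.isOpen_iff.2 ?_
    rintro p ⟨ε, hε, hp⟩
    refine ⟨ε, hε, fun q hq => ⟨ε - dist q p, sub_pos.2 hq, ?_⟩⟩
    exact (sdiff_subset_sdiff_left (Metric.ball_subset_ball' (by linarith))).trans hp
  have hmeet : ∀ S, (interior S).Nonempty → S ⊆ A ∪ B → (interior (A ∪ B) ∩ D S).Nonempty := by
    rintro S ⟨p, hp⟩ hS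
    obtain ⟨ε, hε, h⟩ := Metric.isOpen_iff.1 isOpen_interior p hp
    exact ⟨p, interior_mono hS hp, ε, hε, sdiff_subset.trans (h.trans interior_subset)⟩
  -- A small ball minus `V` is connected and covered by two closed sets that are disjoint there, so
  -- it lies in one of them.
  have hcover : interior (A ∪ B) ⊆ D A ∪ D B := by
    intro p hp
    obtain ⟨ε, hε, h⟩ := Metric.isOpen_iff.1 isOpen_interior p hp
    have hc := (isConnected_ball_diff p hε hV).isPreconnected
    rw [isPreconnected_closed_iff] at hc
    by_contra hcon
    rw [mem_union, not_or] at hcon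
    have hsub : Metric.ball p ε \ V ⊆ A ∪ B := sdiff_subset.trans (h.trans interior_subset)
    have hx : ∀ S T, Metric.ball p ε \ V ⊆ S ∪ T → p ∉ D S → (Metric.ball p ε \ V ∩ T).Nonempty := by
      intro S T hST hS
      obtain ⟨x, hx, hxS⟩ := not_subset.1 fun h => hS ⟨ε, hε, h⟩
      exact ⟨x, hx, (hST hx).resolve_left hxS⟩
    obtain ⟨x, hx, hx'⟩ := hc A B hA hB hsub (hx B A (by rwa [union_comm]) hcon.2)
      (hx A B hsub hcon.1)
    exact hx.2 hx'
  obtain ⟨p, -, ⟨ε, hε, h1⟩, δ, hδ, h2⟩ := h.isPreconnected _ _ (hopen A) (hopen B) hcover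
    (hmeet A hA' subset_union_left) (hmeet B hB' subset_union_right)
  obtain ⟨x, hx, hxV⟩ := (isConnected_ball_diff p (lt_min hε hδ) hV).nonempty
  exact hxV ⟨h1 ⟨Metric.ball_subset_ball (min_le_left _ _) hx, hxV⟩,
    h2 ⟨Metric.ball_subset_ball (min_le_right _ _) hx, hxV⟩⟩

namespace PolyRegular

variable {n k : ℕ} {r : ℝ}

/-- The graph of the tiles; two tiles are adjacent if they share an edge. -/
def dualGraph (F : PolyRegular n k r) : SimpleGraph (Fin n) where
  Adj i j := i ≠ j ∧ ∃ a b, (F.tile i).edge a = (F.tile j).edge b ∧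
    (F.tile i).region ∩ (F.tile j).region = (F.tile i).edge a
  symm := ⟨fun i j ⟨hij, a, b, h, h'⟩ => ⟨hij.symm, b, a, h.symm, by rw [inter_comm, h', h]⟩⟩
  loopless := ⟨fun i h => h.1 rfl⟩

/-- The tiles of one component and the remaining tiles would meet only in isolated vertices, a
finite set, contrary to the connected interior. -/
theorem connected_dualGraph (hk : 3 ≤ k) (hr : 0 < r) (F : PolyRegular n k r) [NeZero n] :
    F.dualGraph.Connected := by
  refine (SimpleGraph.connected_iff _).2 ⟨fun u w => ?_, ⟨0⟩⟩
  by_contra huw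
  set S := {v | F.dualGraph.Reachable u v} with hS
  let T : Set (Fin n) → Set ℂ := fun s => ⋃ v ∈ s, (F.tile v).region
  have hclosed : ∀ s, IsClosed (T s) := fun s =>
    (toFinite s).isClosed_biUnion fun v _ => RegularPolygon.isClosed_region hk hr _
  have hne : ∀ s v, v ∈ s → (interior (T s)).Nonempty := fun s v hv =>
    (RegularPolygon.nonempty_interior_region hk hr (F.tile v)).mono
      (interior_mono (subset_biUnion_of_mem (u := fun v => (F.tile v).region) hv))
  have hunion : T S ∪ T Sᶜ = ⋃ i, (F.tile i).region := by
    simp only [T]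
    rw [← biUnion_union, union_compl_self, biUnion_univ]
  refine not_countable_inter_of_isConnected (hclosed S) (hclosed Sᶜ)
    (hne _ u (SimpleGraph.Reachable.refl u)) (hne _ w huw)
    (by rw [hunion]; exact F.isConnected_interior) ?_
  simp only [T, iUnion₂_inter, inter_iUnion₂]
  refine (toFinite Sᶜ).countable.biUnion fun j hj => (toFinite S).countable.biUnion fun i hi => ?_
  have hij : i ≠ j := fun h => hj (h ▸ hi)
  rcases F.inter_tile i j hij with h | ⟨a, b, -, h⟩ | h
  · rw [h]; exact countable_empty
  · rw [h]; exact countable_singleton _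
  · exact absurd (SimpleGraph.Reachable.trans hi (SimpleGraph.Adj.reachable ⟨hij, h⟩)) hj

end PolyRegular

/-! ### The main theorem -/

namespace Arrangement

variable {n k : ℕ} {r : ℝ} {F : PolyRegular n k r} {P : RegularPolygon k r} {root L : Fin n}

/-- A walk from `root` to a missing tile that avoids `L` must leave the set of placed tiles along a
common edge, and the tile behind it can be added; `d` bounds how often. The position of `root` is
kept because the uncut polygon must stay on `L`. -/
theorem exists_complete (hk : 3 ≤ k) (hr : 0 < r)
    (hconn : (F.dualGraph.induce {L}ᶜ).Connected) (d : ℕ)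
    (A : Arrangement F P root ((k + 1) / 2)) (hroot : root ∈ A.tiles) (hL : L ∉ A.tiles)
    (hd : n ≤ A.tiles.card + d) :
    ∃ A' : Arrangement F P root ((k + 1) / 2), root ∈ A'.tiles ∧ L ∉ A'.tiles ∧
      (∀ x, x ≠ L → x ∈ A'.tiles) ∧ A'.motion 1 root = A.motion 1 root := by
  by_cases hall : ∀ x, x ≠ L → x ∈ A.tiles
  · exact ⟨A, hroot, hL, hall, rfl⟩
  push Not at hall
  obtain ⟨x, hxL, hx⟩ := hall
  induction d generalizing A x with
  | zero =>
    have : A.tiles = Finset.univ :=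
      Finset.eq_univ_of_card _ (le_antisymm (Finset.card_le_univ _) (by simpa using hd))
    exact absurd (this ▸ Finset.mem_univ x) hx
  | succ d ih =>
    have hrL : root ≠ L := by rintro rfl; exact hL hroot
    obtain ⟨w⟩ := hconn.preconnected ⟨root, hrL⟩ ⟨x, hxL⟩
    obtain ⟨e, -, he1, he2⟩ := w.exists_boundary_dart {v | v.1 ∈ A.tiles} hroot hx
    obtain ⟨A', ht, hm⟩ := A.exists_insert hk hr he1 he2 e.adj.2
    have hroot' : root ∈ A'.tiles := ht ▸ Finset.mem_insert_of_mem hroot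
    have hL' : L ∉ A'.tiles := by
      rw [ht, Finset.mem_insert, not_or]
      exact ⟨fun h => e.snd.2 h.symm, hL⟩
    have hd' : n ≤ A'.tiles.card + d := by
      rw [ht, Finset.card_insert_of_notMem he2]; omega
    rw [← hm root hroot]
    by_cases hall : ∀ x, x ≠ L → x ∈ A'.tiles
    · exact ⟨A', hroot', hL', hall, rfl⟩
    push Not at hall
    obtain ⟨y, hyL, hy⟩ := hall
    exact ih A' hroot' hL' hd' y hyL hy

end Arrangement

theorem PolyRegular.exists_arrangement {n k : ℕ} {r : ℝ} (hn : 2 ≤ n) (hk : 3 ≤ k) (hr : 0 < r)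
    (F : PolyRegular n k r) (P : RegularPolygon k r) :
    ∃ (root L : Fin n) (A : Arrangement F P root ((k + 1) / 2)),
      root ∈ A.tiles ∧ A.Covers L ∧ ∀ x, x ≠ L → x ∈ A.tiles := by
  have : NeZero n := ⟨by omega⟩
  have : Nontrivial (Fin n) := Fin.nontrivial_iff_two_le.2 hn
  have hG := F.connected_dualGraph hk hr
  -- A finite connected graph has a vertex whose removal leaves it connected; that tile is reserved
  -- for the uncut polygon.
  obtain ⟨L, hL⟩ := hG.exists_connected_induce_compl_singleton_of_finite_nontrivial
  obtain ⟨z, hz⟩ := exists_ne L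
  obtain ⟨w⟩ := hG.preconnected z L
  obtain ⟨e, -, he1, he2⟩ := w.exists_boundary_dart {L}ᶜ hz (by simp)
  obtain ⟨hne, a, b, he, hi⟩ := e.adj
  rw [notMem_compl_iff, mem_singleton_iff] at he2
  rw [he2] at hne he hi
  set root := e.fst
  obtain ⟨h0, h1⟩ := RegularPolygon.vertex_eq_of_common_edge hk hr he hi
  -- The vertices of the root tile are renumbered so that the edge shared with `L` becomes the edge
  -- `0`, where the uncut polygon is attached.
  obtain ⟨R, hR, hv⟩ := RegularPolygon.exists_isShift hk (F.tile root) 0 a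
  obtain ⟨g, rfl⟩ := RegularPolygon.exists_move hr P R
  have hflip := RegularPolygon.flip_isShift hk ((hv 0).trans h0) ((hv 1).trans h1)
  obtain ⟨A, hA, hA1⟩ := Arrangement.exists_singleton ((k + 1) / 2) F P root g hR
  obtain ⟨A', h1, h2, h3, h4⟩ := A.exists_complete hk hr hL n
    (by rw [hA]; exact Finset.mem_singleton_self _)
    (by rw [hA, Finset.mem_singleton]; exact hne.symm) (by omega)
  refine ⟨root, L, A', h1, ⟨h2, ?_⟩, h3⟩
  rw [Arrangement.polygon, h4, hA1]
  exact hflip.region_eq hk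

theorem mainTheorem1 (n k : ℕ) (hn : 2 ≤ n) (hk : 3 ≤ k) (r : ℝ) (hr : 0 < r) :
    ∃ H : CyclicHinging (⌈(k : ℝ) / 2⌉₊ * (n - 1)),
      ∀ F : PolyRegular n k r, H.RotatesInto F.region := by
  have hceil : ⌈(k : ℝ) / 2⌉₊ = (k + 1) / 2 := by
    rw [Nat.ceil_eq_iff (by omega), lt_div_iff₀ two_pos, div_le_iff₀ two_pos]
    norm_cast
    omega
  rw [hceil]
  -- Any starting polygon would serve. The hinged pieces drawn in it are fixed before `F` is given.
  let P : RegularPolygon k r := ⟨0, r, by simp [abs_of_pos hr]⟩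
  obtain ⟨H, hpiece, hhinge⟩ := RegularPolygon.exists_cyclicHinging hk hr P (n - 1)
  refine ⟨H, fun F => ?_⟩
  obtain ⟨root, L, A, hroot, hL, hall⟩ := F.exists_arrangement hn hk hr P
  have hcard : n - 1 = A.tiles.card := by
    have : A.tiles = Finset.univ.erase L := by
      ext x
      rw [Finset.mem_erase]
      exact ⟨fun h => ⟨fun e => hL.1 (e ▸ h), Finset.mem_univ x⟩, fun h => hall x h.1⟩
    rw [this, Finset.card_erase_of_mem (Finset.mem_univ L), Finset.card_univ, Fintype.card_fin]
  generalize n - 1 = s at *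
  subst hcard
  exact A.rotatesInto hk hr hL hroot hall hpiece hhinge
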